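/- Let $(M,g)$ be a spacetime, i.e. a smooth $4$-manifold with a smooth Lorentzian metric of signature $(-,+,+,+)$ and Levi-Civita connection $\nabla$, and let $l$ be a null geodesic congruence on $M$: a smooth nowhere vanishing null vector field whose integral curves are geodesics, $\nabla_l l=c\,l$ for some function $c$ (affine parametrization, $c=0$, is allowed but not required). A tetrad is a quadruple $(s,l,\alpha,n)$ with $g(s,s)=g(\alpha,\alpha)=-g(n,l)=1$ and all other inner products equal to $0$. Put $h=s^\flat\otimes s^\flat+\alpha^\flat\otimes\alpha^\flat$, $B_{\mu\nu}=h_\mu{}^\lambda h_\nu{}^\sigma\nabla_\lambda l_\sigma$, $\theta=\tfrac12\big[g(\nabla_s l,s)+g(\nabla_\alpha l,\alpha)\big]$, and let the shear tensor $\sigma_{\mu\nu}=B_{(\mu\nu)}-\theta h_{\mu\nu}$ be the trace-free symmetric part of $B$; $l$ is shear-free if $\sigma=0$ at every point. (1) At every point and for every tetrad there, uniform equipartition of null mean curvature, i.e. $$g(\nabla_s l,s)=g(\nabla_\alpha l,\alpha)\quad\text{and}\quad g(\nabla_s l,\alpha)+g(\nabla_\alpha l,s)=0,$$ holds if and only if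 $\sigma=0$. (2) Suppose that $l$ is shear-free. Then every point of $M$ has an open neighbourhood $U$ with a smooth chart $(x^1,\dots,x^4)$ from $U$ onto a cube $(-r,r)^4$ such that $l=\partial/\partial x^1$ on $U$, vector fields $s,\alpha,n$ on $U$, and a smooth function $\Theta_0$ on $U$, with the following properties. For every smooth function $\tilde\Theta$ of three variables on $(-r,r)^3$, put $\Theta=\Theta_0+\tilde\Theta(x^2,x^3,x^4)$, $\hat s=\cos\Theta\,s+\sin\Theta\,\alpha$ and $\hat\alpha=-\sin\Theta\,s+\cos\Theta\,\alpha$. Then $(\hat s,l,\hat\alpha,n)$ is a smooth tetrad on $U$, and $\operatorname{span}(l,\hat s)$ is the tangent distribution of a null field sheet foliation of $U$: a foliation of $U$ by $2$-surfaces tangent to $l$ and $\hat s$ for which equipartition $g(\nabla_{\hat s}l,\hat s)=g(\nabla_{\hat\alpha}l,\hat\alpha)$ holds. At a point of $U$, the tangent planes given by two functions $\tilde\Theta_1,\tilde\Theta_2$ coincide if and only if $\tilde\Theta_1-\tilde\Theta_2\in\pi\mathbb Z$ at the corresponding point $(x^2,x^3,x^4)$. Moreover, each such foliation carries null force-free fields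 containing an arbitrary function of two variables: for every smooth chart $(z^1,\dots,z^4)$ with domain $V\subseteq U$ in which the surfaces of constant $(z^3,z^4)$ are tangent to the foliation, write $\hat\alpha^\flat=\alpha_3\,dz^3+\alpha_4\,dz^4$ and $l^\flat=l_3\,dz^3+l_4\,dz^4$; then $\alpha_3l_4-\alpha_4l_3\neq0$ on $V$, and with $\kappa=(\alpha_3l_4-\alpha_4l_3)^{-1}$, for every smooth function $u$ of two variables on the set of values of $(z^3,z^4)$, the two-form $$F=u(z^3,z^4)\,\kappa\;\hat\alpha^\flat\wedge l^\flat$$ is a null force-free field on $V$: $F$ is smooth, $dF=0$, $F(j^\sharp,\cdot)=0$ where $j=*\,d*F$, and $F_{\mu\nu}F^{\mu\nu}=0$; and at points where $u\neq0$ the kernel of $F$ is exactly the tangent plane $\operatorname{span}(l,\hat s)$ of the foliation. -/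

import Mathlib

open scoped Manifold ContDiff

noncomputable section

namespace NullFFE

variable {M : Type*} [TopologicalSpace M] [ChartedSpace (EuclideanSpace ℝ (Fin 4)) M]

/-- The atlas of all smooth coordinate charts of the 4-manifold `M`. -/
def charts (M : Type*) [TopologicalSpace M] [ChartedSpace (EuclideanSpace ℝ (Fin 4)) M] :
    Set (OpenPartialHomeomorph M (EuclideanSpace ℝ (Fin 4))) :=
  IsManifold.maximalAtlas (𝓡 4) ∞ M

/-- Fields of bilinear forms on the tangent spaces. -/
abbrev BilinField (M : Type*) [TopologicalSpace M]
    [ChartedSpace (EuclideanSpace ℝ (Fin 4)) M] : Type _ :=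
  (x : M) → LinearMap.BilinForm ℝ (TangentSpace (𝓡 4) x)

/-- Vector fields. -/
abbrev VectorField (M : Type*) [TopologicalSpace M]
    [ChartedSpace (EuclideanSpace ℝ (Fin 4)) M] : Type _ :=
  (x : M) → TangentSpace (𝓡 4) x

/-- Smoothness of a vector field on a set. -/
def SmoothOn [IsManifold (𝓡 4) ∞ M] (X : VectorField M) (U : Set M) : Prop :=
  ContMDiffOn (𝓡 4) (𝓡 4).tangent ∞ (fun x => (⟨x, X x⟩ : TangentBundle (𝓡 4) M)) U

/-! ### Coordinates -/

/-- The coordinate vector field `∂ᵢ` of the chart `e` (meaningful on `e.source`). -/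
def coordVec (e : OpenPartialHomeomorph M (EuclideanSpace ℝ (Fin 4))) (i : Fin 4) :
    VectorField M :=
  fun x => (mfderiv (𝓡 4) (𝓡 4) e.symm (e x) (EuclideanSpace.single i (1 : ℝ)) :)

/-- The differential `dxⁱ` at `x` of the `i`-th coordinate function of the chart `e`; its value at
a tangent vector `v` is the `i`-th component of `v`. -/
def coordDiff (e : OpenPartialHomeomorph M (EuclideanSpace ℝ (Fin 4))) (i : Fin 4) (x : M) :
    TangentSpace (𝓡 4) x →L[ℝ] ℝ :=
  mfderiv (𝓡 4) 𝓘(ℝ, ℝ) (fun x' => e x' i) x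

/-- The partial derivative `∂ᵢ f` in the chart `e`. -/
def pderiv (e : OpenPartialHomeomorph M (EuclideanSpace ℝ (Fin 4))) (i : Fin 4) (f : M → ℝ)
    (x : M) : ℝ :=
  fderiv ℝ (fun y => f (e.symm y)) (e x) (EuclideanSpace.single i (1 : ℝ))

/-- The component `Tᵢⱼ` in the chart `e`. -/
def comp (e : OpenPartialHomeomorph M (EuclideanSpace ℝ (Fin 4))) (T : BilinField M)
    (i j : Fin 4) (x : M) : ℝ :=
  T x (coordVec e i x) (coordVec e j x)

/-- A field of bilinear forms is smooth on `U` when its components in all charts are. -/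
def SmoothBilinOn (T : BilinField M) (U : Set M) : Prop :=
  ∀ e ∈ charts M, ∀ i j, ContMDiffOn (𝓡 4) 𝓘(ℝ, ℝ) ∞ (comp e T i j) (e.source ∩ U)

/-- A smooth Lorentzian metric of signature `(-,+,+,+)`. -/
structure LorentzMetric (M : Type*) [TopologicalSpace M]
    [ChartedSpace (EuclideanSpace ℝ (Fin 4)) M] where
  val : BilinField M
  symm : ∀ x v w, val x v w = val x w v
  lorentz : ∀ x, ∃ b : Module.Basis (Fin 4) ℝ (TangentSpace (𝓡 4) x),
    ∀ i j, val x (b i) (b j) = if i = j then (if i = 0 then -1 else 1) else 0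
  smooth : SmoothBilinOn val Set.univ

variable (g : LorentzMetric M) (e : OpenPartialHomeomorph M (EuclideanSpace ℝ (Fin 4)))

/-- The matrix `gᵢⱼ` in the chart `e`. -/
def metricMatrix (x : M) : Matrix (Fin 4) (Fin 4) ℝ :=
  Matrix.of fun i j => comp e g.val i j x

/-- The inverse metric `gⁱʲ`. -/
def metricInv (i j : Fin 4) (x : M) : ℝ := (metricMatrix g e x)⁻¹ i j

/-! ### Levi-Civita connection -/

/-- Christoffel symbols `Γᵏᵢⱼ` in the chart `e`. -/
def christoffel (k i j : Fin 4) (x : M) : ℝ :=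
  (1 / 2) * ∑ m, metricInv g e k m x *
    (pderiv e i (comp e g.val j m) x + pderiv e j (comp e g.val i m) x
      - pderiv e m (comp e g.val i j) x)

/-- The covariant derivative `∇ᵥ X` at `x`, computed in the chart `e`. -/
def nabla (X : VectorField M) (x : M) (v : TangentSpace (𝓡 4) x) : TangentSpace (𝓡 4) x :=
  ∑ k, (∑ i, coordDiff e i x v *
    (pderiv e i (fun x' => coordDiff e k x' (X x')) x
      + ∑ j, christoffel g e k i j x * coordDiff e j x (X x))) • coordVec e k x

/-! ### Null geodesic congruences, tetrads, equipartition, shear -/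

/-- `l` is a smooth nowhere vanishing null vector field on `U` whose integral curves are
geodesics (not necessarily affinely parametrized). -/
structure IsNullGeodesicOn [IsManifold (𝓡 4) ∞ M] (l : VectorField M) (U : Set M) : Prop where
  smooth : SmoothOn l U
  ne_zero : ∀ x ∈ U, l x ≠ 0
  null : ∀ x ∈ U, g.val x (l x) (l x) = 0
  geodesic : ∀ e ∈ charts M, ∀ x ∈ e.source ∩ U, ∃ c : ℝ, nabla g e l x (l x) = c • l x

/-- The inner products of a tetrad `(s, l, α, n)` at the point `x`. -/
structure IsTetrad (x : M) (s l α n : TangentSpace (𝓡 4) x) : Prop where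
  ll : g.val x l l = 0
  ss : g.val x s s = 1
  αα : g.val x α α = 1
  nn : g.val x n n = 0
  nl : g.val x n l = -1
  ls : g.val x l s = 0
  αl : g.val x α l = 0
  αs : g.val x α s = 0
  ns : g.val x n s = 0
  nα : g.val x n α = 0

/-- Equipartition of null mean curvature at `x`: `g(∇ₛ l, s) = g(∇_α l, α)`. -/
def Equipartition (l : VectorField M) (x : M) (s α : TangentSpace (𝓡 4) x) : Prop :=
  g.val x (nabla g e l x s) s = g.val x (nabla g e l x α) α

/-- Uniform equipartition of null mean curvature at `x`: equipartition together with
`g(∇ₛ l, α) + g(∇_α l, s) = 0`. -/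
def UniformEquipartition (l : VectorField M) (x : M) (s α : TangentSpace (𝓡 4) x) : Prop :=
  Equipartition g e l x s α ∧
    g.val x (nabla g e l x s) α + g.val x (nabla g e l x α) s = 0

/-- The null mean curvature `θ = ½ (g(∇ₛ l, s) + g(∇_α l, α))`. -/
def nullExpansion (l : VectorField M) (x : M) (s α : TangentSpace (𝓡 4) x) : ℝ :=
  (1 / 2) * (g.val x (nabla g e l x s) s + g.val x (nabla g e l x α) α)

/-- The projection of `v` onto the transverse plane spanned by `s` and `α`. -/
def transProj (x : M) (s α v : TangentSpace (𝓡 4) x) : TangentSpace (𝓡 4) x :=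
  g.val x s v • s + g.val x α v • α

/-- The transverse metric `h = s ⊗ s + α ⊗ α`. -/
def transMetric (x : M) (s α v w : TangentSpace (𝓡 4) x) : ℝ :=
  g.val x s v * g.val x s w + g.val x α v * g.val x α w

/-- The tensor `B(v, w) = g(∇_{hv} l, hw)`. -/
def defTensor (l : VectorField M) (x : M) (s α v w : TangentSpace (𝓡 4) x) : ℝ :=
  g.val x (nabla g e l x (transProj g x s α v)) (transProj g x s α w)

/-- The shear tensor of `l`: the symmetric part of `B` minus its trace part. As `h` has trace `2`
and `B` has trace `2 θ`, the trace part of `B` is `θ h`. -/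
def shear (l : VectorField M) (x : M) (s α v w : TangentSpace (𝓡 4) x) : ℝ :=
  (1 / 2) * (defTensor g e l x s α v w + defTensor g e l x s α w v)
    - nullExpansion g e l x s α * transMetric g x s α v w

/-- `l` is shear-free: its shear tensor vanishes at every point. -/
def IsShearFree (l : VectorField M) : Prop :=
  ∀ e ∈ charts M, ∀ x ∈ e.source, ∀ s α n : TangentSpace (𝓡 4) x,
    IsTetrad g x s (l x) α n → ∀ v w, shear g e l x s α v w = 0

/-! ### Foliations -/

/-- The plane field spanned by two vector fields. -/
def spanField (l s : VectorField M) (x : M) : Submodule ℝ (TangentSpace (𝓡 4) x) :=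
  Submodule.span ℝ {l x, s x}

/-- `z` is a chart adapted to the plane field `D`: the slices on which the last two coordinates
are constant are integral surfaces of `D`. -/
def IsAdaptedChart (D : (x : M) → Submodule ℝ (TangentSpace (𝓡 4) x))
    (z : OpenPartialHomeomorph M (EuclideanSpace ℝ (Fin 4))) : Prop :=
  z ∈ charts M ∧ ∀ x ∈ z.source, ∀ v, v ∈ D x ↔ coordDiff z 2 x v = 0 ∧ coordDiff z 3 x v = 0

/-- `D` is the field of tangent planes of a foliation of the open set `U` by surfaces: `U` is
covered by adapted charts. -/
def IsFoliation (U : Set M) (D : (x : M) → Submodule ℝ (TangentSpace (𝓡 4) x)) : Prop :=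
  IsOpen U ∧ ∀ q ∈ U, ∃ z, IsAdaptedChart D z ∧ q ∈ z.source ∧ z.source ⊆ U

/-- The fields `l` and `s` span the tangent planes of a null field sheet foliation of `U`, for
which `(s, l, α, n)` is a foliation-adapted frame. -/
structure IsNullFieldSheetFoliation [IsManifold (𝓡 4) ∞ M] (U : Set M)
    (s l α n : VectorField M) : Prop where
  foliation : IsFoliation U (spanField l s)
  nullGeodesic : IsNullGeodesicOn g l U
  smooth_s : SmoothOn s U
  smooth_α : SmoothOn α U
  smooth_n : SmoothOn n U
  tetrad : ∀ x ∈ U, IsTetrad g x (s x) (l x) (α x) (n x)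
  equipartition : ∀ e ∈ charts M, ∀ x ∈ e.source ∩ U, Equipartition g e l x (s x) (α x)

/-! ### Electrodynamics -/

/-- The Levi-Civita symbol. -/
def leviCivita (i j k m : Fin 4) : ℝ :=
  (Matrix.of fun a b : Fin 4 => if ![i, j, k, m] a = b then (1 : ℝ) else 0).det

/-- The volume density `√|det g|`. -/
def volDensity (x : M) : ℝ := Real.sqrt |(metricMatrix g e x).det|

/-- Exterior derivative of a two-form with components `f i j`. -/
def extDeriv2 (f : Fin 4 → Fin 4 → M → ℝ) (i j k : Fin 4) (x : M) : ℝ :=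
  pderiv e i (f j k) x + pderiv e j (f k i) x + pderiv e k (f i j) x

/-- Raising both indices of a covariant 2-tensor. -/
def raise2 (f : Fin 4 → Fin 4 → M → ℝ) (a b : Fin 4) (x : M) : ℝ :=
  ∑ c, ∑ d, metricInv g e a c x * metricInv g e b d x * f c d x

/-- The Hodge star of a two-form. -/
def hodge2 (f : Fin 4 → Fin 4 → M → ℝ) (i j : Fin 4) (x : M) : ℝ :=
  (1 / 2) * volDensity g e x * ∑ a, ∑ b, leviCivita a b i j * raise2 g e f a b x

/-- The Hodge star of a three-form. -/
def hodge3 (t : Fin 4 → Fin 4 → Fin 4 → M → ℝ) (i : Fin 4) (x : M) : ℝ :=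
  (1 / 6) * volDensity g e x * ∑ a, ∑ b, ∑ c, leviCivita a b c i *
    ∑ a', ∑ b', ∑ c', metricInv g e a a' x * metricInv g e b b' x * metricInv g e c c' x *
      t a' b' c' x

/-- The components of the current `j = * d * F` in the chart `e`. -/
def current (F : BilinField M) (i : Fin 4) (x : M) : ℝ :=
  hodge3 g e (extDeriv2 e (hodge2 g e (comp e F))) i x

/-- `F` is a null force-free electromagnetic field on `V`: a smooth two-form with `dF = 0`,
`F(j♯, ·) = 0` for `j = * d * F`, and `F_{μν} F^{μν} = 0`. -/
structure IsNullForceFree (F : BilinField M) (V : Set M) : Prop where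
  alt : ∀ x ∈ V, (F x).IsAlt
  smooth : SmoothBilinOn F V
  closed : ∀ e ∈ charts M, ∀ x ∈ e.source ∩ V, ∀ i j k, extDeriv2 e (comp e F) i j k x = 0
  forceFree : ∀ e ∈ charts M, ∀ x ∈ e.source ∩ V, ∀ k,
    ∑ i, (∑ m, metricInv g e i m x * current g e F m x) * comp e F i k x = 0
  null : ∀ e ∈ charts M, ∀ x ∈ e.source ∩ V,
    ∑ a, ∑ b, comp e F a b x * raise2 g e (comp e F) a b x = 0

/-- The determinant `α₃ l₄ - α₄ l₃` of the coefficients of `α♭`, `l♭` with respect to the last two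
coordinate differentials of the chart `z`. -/
def coeffDet (z : OpenPartialHomeomorph M (EuclideanSpace ℝ (Fin 4))) (α l : VectorField M)
    (x : M) : ℝ :=
  g.val x (α x) (coordVec z 2 x) * g.val x (l x) (coordVec z 3 x)
    - g.val x (α x) (coordVec z 3 x) * g.val x (l x) (coordVec z 2 x)

/-- The two-form `α♭ ∧ l♭`. -/
def wedgeFlat (α l : VectorField M) : BilinField M := fun x =>
  LinearMap.mk₂ ℝ
    (fun v w => g.val x (α x) v * g.val x (l x) w - g.val x (α x) w * g.val x (l x) v)
    (by intros; simp only [map_add]; ring)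
    (by intros; simp only [map_smul, smul_eq_mul]; ring)
    (by intros; simp only [map_add]; ring)
    (by intros; simp only [map_smul, smul_eq_mul]; ring)

/-- The field `F = u κ α♭ ∧ l♭`, where `κ = (α₃ l₄ - α₄ l₃)⁻¹` and `u` is a function of the last
two coordinates of the chart `z`. -/
def nullField (z : OpenPartialHomeomorph M (EuclideanSpace ℝ (Fin 4))) (u : ℝ × ℝ → ℝ)
    (α l : VectorField M) : BilinField M := fun x =>
  (u (z x 2, z x 3) * (coeffDet g z α l x)⁻¹) • wedgeFlat g α l x

/-! ### Rotated frames -/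

/-- `ŝ = cos Θ s + sin Θ α`. -/
def rotS (Θ : M → ℝ) (s α : VectorField M) : VectorField M := fun x =>
  Real.cos (Θ x) • s x + Real.sin (Θ x) • α x

/-- `α̂ = - sin Θ s + cos Θ α`. -/
def rotA (Θ : M → ℝ) (s α : VectorField M) : VectorField M := fun x =>
  (-Real.sin (Θ x)) • s x + Real.cos (Θ x) • α x

/-- The angle `Θ₀ + f(x², x³, x⁴)` in the chart `e = (x¹, x², x³, x⁴)`. -/
def angle (Θ₀ : M → ℝ) (f : ℝ × ℝ × ℝ → ℝ) : M → ℝ := fun x =>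
  Θ₀ x + f (e x 1, e x 2, e x 3)

end NullFFE

end

/-!
Null force-free fields from shear-free null geodesic congruences.

**Equipartition and shear.** In a tetrad the restriction of `v, w ↦ g(∇ᵥ l, w)` to the transverse
plane spanned by `s` and `α` is a 2 × 2 matrix, and both the vanishing of the shear and uniform
equipartition say that its symmetric part is a multiple of the identity
(`uniformEquipartition_iff_shear_eq_zero`). This property is invariant under rotations of `s` and
`α`, so that without shear every rotated frame satisfies equipartition.

**The foliations.** The brackets `[l, ŝ]` are orthogonal to `l`, because `l` is null and geodesic
(`val_bracket_null`). Hence `span (l, ŝ) = {l♭ = α̂♭ = 0}` is involutive if and only if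
`g([l, ŝ], α̂) = 0`, and without shear this number is `l(Θ) + g([l, s], α)` (`val_bracket_rotS`).
In a chart with `l = ∂₁` the condition is the equation `∂₁Θ = - g([l, s], α)`, which is solved by
integration and determines `Θ` up to functions of the other three coordinates
(`exists_flowBox_tetrad_angle`). Involutivity then says that the direction of the tail of `ŝ`, its
components other than the first, does not depend on the first coordinate; straightening the tail in
the remaining three coordinates gives the charts of the foliation (`isFoliation_spanField`).

**The fields.** In an adapted chart `z` the covectors `α̂♭` and `l♭` are combinations of `dz³` and
`dz⁴`, so that `F = u κ α̂♭ ∧ l♭` equals `u(z³, z⁴) dz³ ∧ dz⁴`, which is closed; it is null since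
`g(l, l) = g(α̂, l) = 0`. The current `* d * F` is a multiple of the divergence of the bivector
`φ α̂ ∧ l` with `φ = u κ` (`sum_metricInv_mul_current`), and `F(j♯, ·) = 0` means that this
divergence is annihilated by `l♭` and by `α̂♭`. The contraction with `l♭` is a multiple of
`g(l, [α̂, l])`, which vanishes. The contraction with `α̂♭` is `φ g(α̂, [α̂, l]) - div(φ l)`;
invariance of `u dz³ ∧ dz⁴` under the flow of `l` yields a transport equation for `φ`
(`sum_coordDiff_mul_pderiv_coefficient`), by which `div(φ l) = φ g(∇_ŝ l, ŝ)`, while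
`g(α̂, [α̂, l]) = g(∇_α̂ l, α̂)`. Equipartition makes the difference vanish (`nullField_forceFree`).

**Smooth flows.** Straightening a vector field (`exists_straightening`) needs a flow that is smooth
in all variables. Composition with a smooth map is a smooth map on the Banach space of continuous
curves, so `exists_smooth_flow` follows from the inverse function theorem, applied to the integral
equation satisfied by integral curves.
-/

noncomputable section

namespace NullFFE

open Set Filter Topology MeasureTheory

/-! ### Smooth dependence of flows on initial values -/

section Nemytskii
universe v

variable {E F H : Type v} [NormedAddCommGroup E] [NormedSpace ℝ E] [NormedAddCommGroup F]
  [NormedSpace ℝ F] [NormedAddCommGroup H] [NormedSpace ℝ H]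

/-- A bounded bilinear map applied pointwise to curves, as a bounded bilinear map on spaces of
curves. -/
def curveBilin (B : H →L[ℝ] E →L[ℝ] F) :
    C(unitInterval, H) →L[ℝ] C(unitInterval, E) →L[ℝ] C(unitInterval, F) :=
  LinearMap.mkContinuous₂
    (LinearMap.mk₂ ℝ (fun (A : C(unitInterval, H)) (h : C(unitInterval, E)) =>
        (⟨fun t => B (A t) (h t), by fun_prop⟩ : C(unitInterval, F)))
      (by intros; ext; simp) (by intros; ext; simp) (by intros; ext; simp) (by intros; ext; simp))
    ‖B‖ (by
      intro A h
      refine (ContinuousMap.norm_le _ (by positivity)).2 fun t => ?_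
      refine (B.le_opNorm₂ (A t) (h t)).trans ?_
      gcongr
      · exact A.norm_coe_le_norm t
      · exact h.norm_coe_le_norm t)

theorem contDiff_curveBilin (B : H →L[ℝ] E →L[ℝ] F) {n : WithTop ℕ∞} :
    ContDiff ℝ n (fun A => curveBilin B A) :=
  ContinuousLinearMap.contDiff (𝕜 := ℝ) (E := C(unitInterval, H))
    (F := C(unitInterval, E) →L[ℝ] C(unitInterval, F)) (curveBilin B)

/-- The derivative of the composition operator with `f` is multiplication by the derivative of `f`
along the curve. The derivative is written as `B ∘ f'` with a bounded bilinear map `B`, so that it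
is again built from a composition operator. -/
theorem hasFDerivAt_postcomp {f : E → F} {f' : E → H} (B : H →L[ℝ] E →L[ℝ] F)
    (hf : ∀ x, HasFDerivAt f (B (f' x)) x) (hc : Continuous f) (hc' : Continuous f')
    (γ : C(unitInterval, E)) :
    HasFDerivAt (fun η : C(unitInterval, E) => (ContinuousMap.mk f hc).comp η)
      (curveBilin B ((ContinuousMap.mk f' hc').comp γ)) γ := by
  rw [hasFDerivAt_iff_isLittleO, Asymptotics.isLittleO_iff]
  intro c hc0
  have hcont : Continuous fun η : C(unitInterval, E) => (ContinuousMap.mk f' hc').comp η :=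
    ContinuousMap.continuous_postcomp _
  obtain ⟨ρ, hρ, hρc⟩ : ∃ ρ > 0, ‖B‖ * ρ ≤ c := by
    refine ⟨c / (‖B‖ + 1), by positivity, ?_⟩
    rw [mul_div_assoc', div_le_iff₀ (by positivity)]
    nlinarith [norm_nonneg B]
  obtain ⟨δ, hδ, hclose⟩ := Metric.continuous_iff.1 hcont γ ρ hρ
  filter_upwards [Metric.ball_mem_nhds γ hδ] with η hη
  refine (ContinuousMap.norm_le _ (by positivity)).2 fun t => ?_
  have hηt : ‖η t - γ t‖ < δ := by
    have := (η - γ).norm_coe_le_norm t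
    rw [mem_ball_iff_norm] at hη
    exact this.trans_lt hη
  -- the bound on `f'` at nearby points comes from translating the whole curve by a constant
  have key : ∀ z ∈ Metric.ball (γ t) δ, ‖B (f' z) - B (f' (γ t))‖ ≤ c := by
    intro z hz
    have h1 : dist (γ + ContinuousMap.const _ (z - γ t)) γ < δ := by
      rw [dist_eq_norm, add_sub_cancel_left]
      refine lt_of_le_of_lt ((ContinuousMap.norm_le _ (norm_nonneg (z - γ t))).2 fun s => le_rfl) ?_
      simpa [dist_eq_norm] using hz
    have h2 := hclose _ h1
    rw [dist_eq_norm] at h2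
    have h3 := (((ContinuousMap.mk f' hc').comp (γ + ContinuousMap.const _ (z - γ t)) -
      (ContinuousMap.mk f' hc').comp γ)).norm_coe_le_norm t
    simp only [ContinuousMap.coe_sub, Pi.sub_apply, ContinuousMap.comp_apply,
      ContinuousMap.coe_mk, ContinuousMap.add_apply, ContinuousMap.const_apply,
      add_sub_cancel] at h3
    rw [← map_sub]
    refine (B.le_opNorm _).trans (le_trans ?_ hρc)
    gcongr
    exact h3.trans h2.le
  have := (convex_ball (γ t) δ).norm_image_sub_le_of_norm_hasFDerivWithin_le' (f := f)
    (f' := fun x => B (f' x)) (φ := B (f' (γ t))) (C := c)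
    (fun x _ => (hf x).hasFDerivWithinAt) key
    (Metric.mem_ball_self hδ) (y := η t) (by simpa [dist_eq_norm] using hηt)
  refine this.trans ?_
  gcongr
  exact (η - γ).norm_coe_le_norm t

/-- Composition with a smooth map is a smooth map between spaces of curves. -/
theorem contDiff_postcomp {f : E → F} (hf : ContDiff ℝ ∞ f) :
    ContDiff ℝ ∞ (fun η : C(unitInterval, E) => (ContinuousMap.mk f hf.continuous).comp η) := by
  rw [contDiff_infty]
  intro n
  induction n generalizing F with
  | zero => exact contDiff_zero.2 (ContinuousMap.continuous_postcomp _)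
  | succ n ih =>
    have hf' : ContDiff ℝ ∞ (fderiv ℝ f) := hf.fderiv_right (by simp)
    have hd : ∀ x, HasFDerivAt f (ContinuousLinearMap.id ℝ (E →L[ℝ] F) (fderiv ℝ f x)) x :=
      fun x => (hf.differentiable (by simp) x).hasFDerivAt
    push_cast
    rw [contDiff_succ_iff_hasFDerivAt]
    exact ⟨fun η => curveBilin (ContinuousLinearMap.id ℝ (E →L[ℝ] F))
        ((ContinuousMap.mk _ hf'.continuous).comp η),
      (contDiff_curveBilin _).comp (ih hf'),
      fun η => hasFDerivAt_postcomp _ hd hf.continuous hf'.continuous η⟩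

/-- The primitive vanishing at `0` of a curve, as a bounded operator on the space of curves. -/
def primitive (E : Type*) [NormedAddCommGroup E] [NormedSpace ℝ E] :
    C(unitInterval, E) →L[ℝ] C(unitInterval, E) :=
  LinearMap.mkContinuous
    { toFun := fun η => ⟨fun t => ∫ r in (0 : ℝ)..t, η (projIcc 0 1 zero_le_one r), by
        have h : Continuous fun r : ℝ => η (projIcc 0 1 zero_le_one r) := by fun_prop
        exact (intervalIntegral.continuous_primitive
          (fun a b => h.intervalIntegrable a b) 0).comp continuous_subtype_val⟩
      map_add' := fun η ζ => by
        ext t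
        exact intervalIntegral.integral_add
          (Continuous.intervalIntegrable (by fun_prop) _ _)
          (Continuous.intervalIntegrable (by fun_prop) _ _)
      map_smul' := fun c η => by
        ext t
        exact intervalIntegral.integral_smul c _ }
    1 (by
      intro η
      rw [one_mul]
      refine (ContinuousMap.norm_le _ (norm_nonneg _)).2 fun t => ?_
      refine (intervalIntegral.norm_integral_le_of_norm_le_const
        (C := ‖η‖) fun r _ => η.norm_coe_le_norm _).trans ?_
      rw [sub_zero, abs_of_nonneg t.2.1]
      exact mul_le_of_le_one_right (norm_nonneg _) t.2.2)

theorem primitive_apply (η : C(unitInterval, E)) (t : unitInterval) :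
    primitive E η t = ∫ r in (0 : ℝ)..t, η (projIcc 0 1 zero_le_one r) := rfl

/-- The integral equation `γ(t) = τ ∫₀ᵗ V(x + γ)`, whose solutions are the displacements along
integral curves of `τ V`, written as a map on pairs of data `(x, τ)` and curves `γ`. -/
def integralEq (V : C(E, E)) (a : (E × ℝ) × C(unitInterval, E)) :
    (E × ℝ) × C(unitInterval, E) :=
  (a.1, a.2 - a.1.2 • primitive E (V.comp (ContinuousMap.const _ a.1.1 + a.2)))

theorem contDiff_integralEq {V : E → E} (hV : ContDiff ℝ ∞ V) :
    ContDiff ℝ ∞ (integralEq ⟨V, hV.continuous⟩) := by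
  have hc : ContDiff ℝ ∞ fun x : E => ContinuousMap.const unitInterval x :=
    (ContinuousLinearMap.const ℝ unitInterval (M := E)).contDiff
  have h1 : ContDiff ℝ ∞ fun a : (E × ℝ) × C(unitInterval, E) =>
      ContinuousMap.const unitInterval a.1.1 + a.2 :=
    (hc.comp (contDiff_fst.comp contDiff_fst)).add contDiff_snd
  have h2 := (primitive E).contDiff.comp ((contDiff_postcomp hV).comp h1)
  exact contDiff_fst.prodMk (contDiff_snd.sub ((contDiff_snd.comp contDiff_fst).smul h2))

/-- At time `τ = 0` the integral equation reads `γ = 0`, and its linearization is the shear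
`((x, τ), γ) ↦ ((x, τ), γ - τ w)`, which is invertible. -/
theorem hasFDerivAt_integralEq {V : E → E} (hV : ContDiff ℝ ∞ V) (p : E) :
    ∃ L : ((E × ℝ) × C(unitInterval, E)) ≃L[ℝ] ((E × ℝ) × C(unitInterval, E)),
      HasFDerivAt (integralEq ⟨V, hV.continuous⟩)
        (L : ((E × ℝ) × C(unitInterval, E)) →L[ℝ] ((E × ℝ) × C(unitInterval, E)))
        ((p, 0), 0) := by
  have hc : ContDiff ℝ ∞ fun x : E => ContinuousMap.const unitInterval x :=
    (ContinuousLinearMap.const ℝ unitInterval (M := E)).contDiff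
  have h1 : ContDiff ℝ ∞ fun a : (E × ℝ) × C(unitInterval, E) =>
      ContinuousMap.const unitInterval a.1.1 + a.2 :=
    (hc.comp (contDiff_fst.comp contDiff_fst)).add contDiff_snd
  have h2 := (primitive E).contDiff.comp ((contDiff_postcomp hV).comp h1)
  have h3 := (h2.differentiable (by simp) ((p, 0), 0)).hasFDerivAt
  set w := primitive E (ContinuousMap.comp ⟨V, hV.continuous⟩
    (ContinuousMap.const unitInterval p + 0)) with hw
  refine ⟨ContinuousLinearEquiv.skewProd (.refl ℝ _) (.refl ℝ _)
    (-((ContinuousLinearMap.snd ℝ E ℝ).smulRight w)), ?_⟩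
  have h5 : HasFDerivAt (fun a : (E × ℝ) × C(unitInterval, E) => a.1.2)
      ((ContinuousLinearMap.snd ℝ E ℝ).comp (ContinuousLinearMap.fst ℝ (E × ℝ) _))
      ((p, 0), 0) :=
    ((ContinuousLinearMap.snd ℝ E ℝ).comp
      (ContinuousLinearMap.fst ℝ (E × ℝ) C(unitInterval, E))).hasFDerivAt
  have h4 := (hasFDerivAt_fst (𝕜 := ℝ) (p := (((p, 0), 0) : (E × ℝ) × C(unitInterval, E)))).prodMk
    (hasFDerivAt_snd.sub (h5.smul h3))
  refine h4.congr_fderiv ?_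
  ext a <;> simp [hw, sub_eq_add_neg]

omit [NormedSpace ℝ E] in
theorem norm_comp_le (γ : C(unitInterval, E)) (f : C(unitInterval, unitInterval)) :
    ‖γ.comp f‖ ≤ ‖γ‖ :=
  (ContinuousMap.norm_le _ (norm_nonneg γ)).2 fun s => γ.norm_coe_le_norm (f s)

/-- Pieces of solution curves are, after reparametrization, solution curves for shorter times. -/
theorem integralEq_rescale {V : C(E, E)} {x : E} {τ : ℝ} {γ : C(unitInterval, E)}
    (h : γ = τ • primitive E (V.comp (ContinuousMap.const _ x + γ))) (t : unitInterval) :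
    integralEq V ((x, t * τ), γ.comp ⟨fun s => t * s, by fun_prop⟩) = ((x, t * τ), 0) := by
  refine Prod.ext rfl (sub_eq_zero.2 ?_)
  ext s
  have h1 : γ (t * s) = τ • ∫ r in (0 : ℝ)..(t * s : ℝ),
      V (x + γ (projIcc 0 1 zero_le_one r)) := by
    conv_lhs => rw [h]
    rfl
  have h2 : (∫ r in (0 : ℝ)..s, V (x + γ (t * projIcc 0 1 zero_le_one r))) =
      ∫ r in (0 : ℝ)..s, V (x + γ (projIcc 0 1 zero_le_one (t * r))) := by
    apply intervalIntegral.integral_congr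
    intro r hr
    rw [uIcc_of_le s.2.1] at hr
    have hr' : r ∈ Icc (0 : ℝ) 1 := ⟨hr.1, hr.2.trans s.2.2⟩
    have htr : (t : ℝ) * r ∈ Icc (0 : ℝ) 1 := (t * ⟨r, hr'⟩ : unitInterval).2
    simp only [projIcc_of_mem _ hr', projIcc_of_mem _ htr]
    rfl
  have h3 := intervalIntegral.smul_integral_comp_mul_left (a := 0) (b := (s : ℝ))
    (fun r => V (x + γ (projIcc 0 1 zero_le_one r))) (t : ℝ)
  rw [mul_zero] at h3
  change γ (t * s) = ((t : ℝ) * τ) •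
    ∫ r in (0 : ℝ)..s, V (x + γ (t * projIcc 0 1 zero_le_one r))
  rw [h1, h2, ← h3, smul_smul, mul_comm]

omit [NormedAddCommGroup H] [NormedSpace ℝ H] in
/-- The smooth inverse function theorem, with an inverse smooth on its whole domain. -/
theorem exists_smooth_local_inverse {E F : Type*} [NormedAddCommGroup E] [NormedSpace ℝ E]
    [NormedAddCommGroup F] [NormedSpace ℝ F] [CompleteSpace E] {f : E → F} {N : Set E} {a : E}
    (hN : IsOpen N) (ha : a ∈ N) (hf : ContDiffOn ℝ ∞ f N) {L : E ≃L[ℝ] F}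
    (hL : HasFDerivAt f (L : E →L[ℝ] F) a) :
    ∃ k : OpenPartialHomeomorph E F, (∀ x, k x = f x) ∧ a ∈ k.source ∧ k.source ⊆ N ∧
      ContDiffOn ℝ ∞ k.symm k.target := by
  have hat : ∀ x ∈ N, ContDiffAt ℝ ∞ f x := fun x hx => hf.contDiffAt (hN.mem_nhds hx)
  set h := (hat a ha).toOpenPartialHomeomorph f hL (by simp)
  have hmem : a ∈ h.source :=
    ContDiffAt.mem_toOpenPartialHomeomorph_source (hat a ha) hL (by simp)
  set S : Set E := N ∩ fderiv ℝ f ⁻¹' range ((↑) : (E ≃L[ℝ] F) → E →L[ℝ] F)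
  have hSo : IsOpen S :=
    (hf.continuousOn_fderiv_of_isOpen hN (by simp)).isOpen_inter_preimage hN
      ContinuousLinearEquiv.isOpen
  set k := h.restrOpen S hSo with hk
  refine ⟨k, fun x => rfl, ?_, ?_, fun b hb => ?_⟩
  · rw [hk, OpenPartialHomeomorph.restrOpen_source]
    exact ⟨hmem, ha, L, hL.fderiv.symm⟩
  · rw [hk, OpenPartialHomeomorph.restrOpen_source]
    exact fun x hx => hx.2.1
  · have hb' := k.map_target hb
    rw [hk, OpenPartialHomeomorph.restrOpen_source] at hb'
    obtain ⟨hbN, e, he⟩ := hb'.2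
    exact (k.contDiffAt_symm hb (f₀' := e)
      (by rw [he]; exact ((hat _ hbN).differentiableAt (by simp)).hasFDerivAt)
      (hat _ hbN)).contDiffWithinAt

/-- The solution of the integral equation depends smoothly on the data `(x, τ)`, and solutions for
shorter times are reparametrized pieces of solutions for longer times. -/
theorem exists_smooth_solution [CompleteSpace E] {V : E → E} (hV : ContDiff ℝ ∞ V) (p : E) :
    ∃ ε > 0, ∃ σ : E × ℝ → C(unitInterval, E), ContDiffOn ℝ ∞ σ (Metric.ball (p, 0) ε) ∧
      ∀ x τ, (x, τ) ∈ Metric.ball (p, (0 : ℝ)) ε →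
        σ (x, τ) = τ • primitive E
          ((ContinuousMap.mk V hV.continuous).comp (ContinuousMap.const _ x + σ (x, τ))) ∧
        ∀ t : unitInterval, σ (x, t * τ) = (σ (x, τ)).comp ⟨fun s => t * s, by fun_prop⟩ := by
  obtain ⟨L, hL⟩ := hasFDerivAt_integralEq hV p
  obtain ⟨k, hkΦ, hmemk, -, hksymm⟩ := exists_smooth_local_inverse isOpen_univ (mem_univ _)
    (contDiff_integralEq hV).contDiffOn hL
  have hkp : k ((p, 0), 0) = ((p, 0), 0) := by simp [hkΦ, integralEq]
  have hmemt : ((p, 0), 0) ∈ k.target := by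
    have := k.map_source hmemk
    rwa [hkp] at this
  have hsymp : k.symm ((p, 0), 0) = ((p, 0), 0) := by
    conv_lhs => rw [← hkp]
    exact k.left_inv hmemk
  obtain ⟨δ, hδ, hball⟩ := Metric.isOpen_iff.1 k.open_source _ hmemk
  -- the data for which the solution curve exists and stays in the domain of uniqueness
  have hev : ∀ᶠ q in 𝓝 ((p, 0) : E × ℝ), (q, 0) ∈ k.target ∧
      k.symm (q, 0) ∈ Metric.ball (((p, 0), 0) : (E × ℝ) × C(unitInterval, E)) δ := by
    have hi : ContinuousAt (fun q : E × ℝ => ((q, 0) : (E × ℝ) × C(unitInterval, E))) (p, 0) := by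
      fun_prop
    refine (hi.eventually (k.open_target.mem_nhds hmemt)).and ?_
    have hc : ContinuousAt (fun q : E × ℝ => k.symm (q, 0)) (p, 0) :=
      ContinuousAt.comp (f := fun q : E × ℝ => ((q, 0) : (E × ℝ) × C(unitInterval, E)))
        (k.continuousAt_symm hmemt) hi
    have h1 : Metric.ball (((p, 0), 0) : (E × ℝ) × C(unitInterval, E)) δ ∈
        𝓝 (k.symm ((p, 0), 0)) := by
      rw [hsymp]
      exact Metric.ball_mem_nhds _ hδ
    exact hc.eventually h1
  obtain ⟨ε₀, hε₀, hε⟩ := Metric.eventually_nhds_iff_ball.1 hev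
  refine ⟨min ε₀ δ, lt_min hε₀ hδ, fun q => (k.symm (q, 0)).2, ?_, fun x τ hq => ?_⟩
  · refine contDiff_snd.comp_contDiffOn (hksymm.comp
      (contDiff_id.prodMk contDiff_const).contDiffOn ?_)
    exact fun q hq => (hε q (Metric.ball_subset_ball (min_le_left _ _) hq)).1
  obtain ⟨h1, h2⟩ := hε _ (Metric.ball_subset_ball (min_le_left _ _) hq)
  have h3 := k.right_inv h1
  rw [hkΦ, integralEq] at h3
  have h4 : (k.symm ((x, τ), 0)).1 = (x, τ) := congrArg Prod.fst h3
  have h5 := congrArg Prod.snd h3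
  simp only [h4, sub_eq_zero] at h5
  refine ⟨h5, fun t => ?_⟩
  -- a reparametrized piece of the solution solves the equation for the shorter time, and it lies in
  -- the domain where solutions are unique
  have hδγ : ‖(k.symm ((x, τ), 0)).2‖ < δ := by
    rw [← ball_prod_same] at h2
    simpa using h2.2
  have hq' : (x, (t : ℝ) * τ) ∈ Metric.ball ((p, 0) : E × ℝ) (min ε₀ δ) := by
    rw [← ball_prod_same] at hq ⊢
    refine ⟨hq.1, ?_⟩
    have h6 := hq.2
    simp only [Metric.mem_ball, dist_zero_right, Real.norm_eq_abs, abs_mul] at h6 ⊢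
    refine (mul_le_of_le_one_left (abs_nonneg _) ?_).trans_lt h6
    rw [abs_of_nonneg t.2.1]
    exact t.2.2
  have hmem' : ((x, (t : ℝ) * τ), (k.symm ((x, τ), 0)).2.comp
      (⟨fun s => t * s, by fun_prop⟩ : C(unitInterval, unitInterval))) ∈ k.source := by
    apply hball
    rw [← ball_prod_same]
    refine ⟨Metric.ball_subset_ball (min_le_right _ _) hq', ?_⟩
    rw [mem_ball_zero_iff]
    exact (norm_comp_le _ _).trans_lt hδγ
  have h6 : k.symm ((x, (t : ℝ) * τ), 0) = ((x, (t : ℝ) * τ), (k.symm ((x, τ), 0)).2.comp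
      (⟨fun s => t * s, by fun_prop⟩ : C(unitInterval, unitInterval))) := by
    rw [← integralEq_rescale h5 t, ← hkΦ]
    exact k.left_inv hmem'
  show (k.symm ((x, (t : ℝ) * τ), 0)).2 = _
  rw [h6]

/-- **Smooth dependence on initial values.** A smooth vector field has a smooth local flow. -/
theorem exists_smooth_flow [CompleteSpace E] {V : E → E} (hV : ContDiff ℝ ∞ V) (p : E) :
    ∃ ε > 0, ∃ φ : E × ℝ → E, ContDiffOn ℝ ∞ φ (Metric.ball (p, 0) ε) ∧
      ∀ x t, (x, t) ∈ Metric.ball (p, (0 : ℝ)) ε →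
        φ (x, 0) = x ∧ HasDerivAt (fun t => φ (x, t)) (V (φ (x, t))) t := by
  obtain ⟨ε, hε, σ, hσ, hsol⟩ := exists_smooth_solution hV p
  obtain ⟨φ, hφ⟩ : ∃ φ : E × ℝ → E, ∀ x τ, φ (x, τ) = x + σ (x, τ) 1 :=
    ⟨fun q => q.1 + σ q 1, fun _ _ => rfl⟩
  have hφsm : ContDiffOn ℝ ∞ φ (Metric.ball (p, 0) ε) := by
    have h2 := (ContinuousMap.evalCLM ℝ (1 : unitInterval) (M := E)).contDiff.comp_contDiffOn hσ
      (n := ∞)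
    exact (contDiff_fst.contDiffOn.add h2).congr fun q _ => hφ q.1 q.2
  have hscale : ∀ x τ, (x, τ) ∈ Metric.ball ((p, 0) : E × ℝ) ε → ∀ t : unitInterval,
      φ (x, t * τ) = x + σ (x, τ) t := by
    intro x τ hq t
    have h1 : σ (x, t * τ) 1 = σ (x, τ) (t * 1) := by rw [(hsol x τ hq).2 t]; rfl
    rw [hφ, h1, mul_one]
  have hint : ∀ x τ, (x, τ) ∈ Metric.ball ((p, 0) : E × ℝ) ε →
      φ (x, τ) = x + ∫ r in (0 : ℝ)..τ, V (φ (x, r)) := by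
    intro x τ hq
    have h3 : σ (x, τ) 1 = τ • ∫ r in (0 : ℝ)..1,
        V (x + σ (x, τ) (projIcc 0 1 zero_le_one r)) := by
      conv_lhs => rw [(hsol x τ hq).1]
      rfl
    rw [hφ, h3]
    congr 1
    have h5 := intervalIntegral.smul_integral_comp_mul_right (a := 0) (b := 1)
      (fun r => V (φ (x, r))) τ
    rw [zero_mul, one_mul] at h5
    rw [← h5]
    congr 1
    apply intervalIntegral.integral_congr
    intro r hr
    rw [uIcc_of_le zero_le_one] at hr
    have h6 := hscale x τ hq ⟨r, hr⟩
    simp only at h6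
    simp only [h6, projIcc_of_mem _ hr]
  refine ⟨ε, hε, φ, hφsm, fun x t hq => ?_⟩
  have hx : x ∈ Metric.ball p ε := by rw [← ball_prod_same] at hq; exact hq.1
  have ht : t ∈ Metric.ball (0 : ℝ) ε := by rw [← ball_prod_same] at hq; exact hq.2
  have hcont : ContinuousOn (fun r => V (φ (x, r))) (Metric.ball (0 : ℝ) ε) := by
    refine hV.continuous.comp_continuousOn (hφsm.continuousOn.comp (by fun_prop) ?_)
    intro r hr
    rw [← ball_prod_same]
    exact ⟨hx, hr⟩
  constructor
  · have := hint x 0 (by rw [← ball_prod_same]; exact ⟨hx, Metric.mem_ball_self hε⟩)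
    simpa using this
  · have hsub : uIcc 0 t ⊆ Metric.ball (0 : ℝ) ε :=
      (convex_ball (0 : ℝ) ε).ordConnected.uIcc_subset (Metric.mem_ball_self hε) ht
    have h1 := intervalIntegral.integral_hasDerivAt_right
      ((hcont.mono hsub).intervalIntegrable)
      (hcont.stronglyMeasurableAtFilter Metric.isOpen_ball t ht)
      (hcont.continuousAt (Metric.isOpen_ball.mem_nhds ht))
    refine (h1.const_add x).congr_of_eventuallyEq ?_
    filter_upwards [Metric.isOpen_ball.mem_nhds ht] with r hr
    exact hint x r (by rw [← ball_prod_same]; exact ⟨hx, hr⟩)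

end Nemytskii

/-! ### Straightening of vector fields -/

section Straightening

universe v

variable {E F : Type v} [NormedAddCommGroup E] [NormedSpace ℝ E] [NormedAddCommGroup F]
  [NormedSpace ℝ F]

/-- A locally defined smooth map agrees near any point with a globally defined one. -/
theorem exists_contDiff_extension [FiniteDimensional ℝ E] {f : E → F} {U : Set E} {p : E}
    (hU : IsOpen U) (hp : p ∈ U) (hf : ContDiffOn ℝ ∞ f U) :
    ∃ f' : E → F, ContDiff ℝ ∞ f' ∧ f' =ᶠ[𝓝 p] f := by
  obtain ⟨δ, hδ, hball⟩ := Metric.isOpen_iff.1 hU p hp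
  let χ : ContDiffBump p := ⟨δ / 4, δ / 2, by positivity, by linarith⟩
  refine ⟨fun y => χ y • f y, contDiff_iff_contDiffAt.2 fun y => ?_, ?_⟩
  · by_cases hy : y ∈ U
    · exact χ.contDiff.contDiffAt.smul (hf.contDiffAt (hU.mem_nhds hy))
    · have hy' : y ∈ (tsupport χ)ᶜ := by
        rw [χ.tsupport_eq]
        intro h
        exact hy (hball (lt_of_le_of_lt h (half_lt_self hδ)))
      refine (contDiffAt_const (c := 0)).congr_of_eventuallyEq ?_
      filter_upwards [(isClosed_tsupport χ).isOpen_compl.mem_nhds hy'] with z hz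
      rw [image_eq_zero_of_notMem_tsupport hz, zero_smul]
  · filter_upwards [χ.eventuallyEq_one] with z hz
    simp [hz]

/-- The case `w = V p` of the straightening theorem: flow for the time `ev y`, starting from the
point of an affine hyperplane through `p` transverse to `V p`. -/
theorem exists_straightening_aux [FiniteDimensional ℝ E] {V : E → E} (hV : ContDiff ℝ ∞ V) {p : E}
    (hp : V p ≠ 0) :
    ∃ ψ : OpenPartialHomeomorph E E, 0 ∈ ψ.source ∧ ψ 0 = p ∧ ContDiffOn ℝ ∞ ψ ψ.source ∧
      ContDiffOn ℝ ∞ ψ.symm ψ.target ∧ ∀ y ∈ ψ.source, fderiv ℝ ψ y (V p) = V (ψ y) := by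
  have : CompleteSpace E := FiniteDimensional.complete ℝ E
  obtain ⟨ε, hε, φ, hφ, hflow⟩ := exists_smooth_flow hV p
  obtain ⟨ev, hev⟩ := SeparatingDual.exists_eq_one (R := ℝ) hp
  set a : E → E × ℝ := fun y => (p + (y - ev y • V p), ev y) with ha
  have hasm : ContDiff ℝ ∞ a := by fun_prop
  set N := a ⁻¹' Metric.ball (p, 0) ε
  have hN : IsOpen N := Metric.isOpen_ball.preimage hasm.continuous
  have h0 : (0 : E) ∈ N := by
    change a 0 ∈ Metric.ball (p, (0 : ℝ)) ε
    simp only [ha, map_zero, zero_smul, sub_zero, add_zero]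
    exact Metric.mem_ball_self hε
  have hΨ : ContDiffOn ℝ ∞ (φ ∘ a) N := hφ.comp hasm.contDiffOn fun y hy => hy
  have hdiff : ∀ y ∈ N, DifferentiableAt ℝ (φ ∘ a) y := fun y hy =>
    (hΨ.contDiffAt (hN.mem_nhds hy)).differentiableAt (by simp)
  -- the derivative of `φ ∘ a` is computed along lines
  have hline : ∀ y ∈ N, ∀ w d, HasDerivAt (fun t : ℝ => (φ ∘ a) (y + t • w)) d 0 →
      fderiv ℝ (φ ∘ a) y w = d := by
    intro y hy w d hd
    have h1 : HasDerivAt (fun t : ℝ => y + t • w) w 0 := by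
      simpa using ((hasDerivAt_id (0 : ℝ)).smul_const w).const_add y
    have h2 := HasFDerivAt.comp_hasDerivAt (f := fun t : ℝ => y + t • w) (0 : ℝ)
      (by simpa using (hdiff y hy).hasFDerivAt) h1
    exact h2.unique hd
  have hflowdir : ∀ y ∈ N, fderiv ℝ (φ ∘ a) y (V p) = V ((φ ∘ a) y) := by
    intro y hy
    refine hline y hy _ _ ?_
    have h1 := (hflow _ _ hy).2
    have h2 : (fun t : ℝ => (φ ∘ a) (y + t • V p)) =
        fun t => φ (p + (y - ev y • V p), ev y + t) := by
      funext t
      simp only [ha, Function.comp_apply, map_add, map_smul, hev, smul_eq_mul, mul_one, add_smul]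
      congr 2
      abel
    rw [h2]
    have h3 : HasDerivAt (fun t : ℝ => φ (p + (y - ev y • V p), t))
      (V (φ (p + (y - ev y • V p), ev y))) (ev y + 0) := by rw [add_zero]; exact h1
    simpa using h3.comp_const_add (ev y) 0
  -- at the origin `φ ∘ a` has derivative `id`, on the hyperplane and in the flow direction
  have hid : HasFDerivAt (φ ∘ a) ((ContinuousLinearEquiv.refl ℝ E : E ≃L[ℝ] E) : E →L[ℝ] E) 0 := by
    refine (hdiff 0 h0).hasFDerivAt.congr_fderiv ?_
    ext w
    have h1 : fderiv ℝ (φ ∘ a) 0 (w - ev w • V p) = w - ev w • V p := by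
      refine hline 0 h0 _ _ ?_
      have h3 : HasDerivAt (fun t : ℝ => p + t • (w - ev w • V p)) (w - ev w • V p) 0 := by
        simpa using ((hasDerivAt_id (0 : ℝ)).smul_const (w - ev w • V p)).const_add p
      refine h3.congr_of_eventuallyEq ?_
      have h4 : ∀ᶠ t : ℝ in 𝓝 0, t • (w - ev w • V p) ∈ N := by
        have : Continuous fun t : ℝ => t • (w - ev w • V p) := by fun_prop
        exact this.continuousAt.eventually (hN.mem_nhds (by simpa using h0))
      filter_upwards [h4] with t ht
      have h5 := (hflow _ _ ht).1
      simpa [ha, hev] using h5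
    have h2 := hflowdir 0 h0
    have h6 : V ((φ ∘ a) 0) = V p := by
      have := (hflow _ _ h0).1
      simpa [ha] using congrArg V this
    rw [h6] at h2
    have h7 : w = (w - ev w • V p) + ev w • V p := by abel
    conv_lhs => rw [h7, map_add, map_smul, h1, h2]
    simp
  obtain ⟨k, hk, hk0, hkN, hks⟩ := exists_smooth_local_inverse hN h0 hΨ hid
  have hkeq : (k : E → E) = φ ∘ a := funext hk
  refine ⟨k, hk0, ?_, ?_, hks, fun y hy => ?_⟩
  · have := (hflow _ _ h0).1
    rw [hkeq]
    simpa [ha] using this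
  · rw [hkeq]
    exact hΨ.mono hkN
  · rw [hkeq]
    exact hflowdir y (hkN hy)

/-- **Straightening theorem.** Near a point where it does not vanish, a smooth vector field is the
image of a given constant field `w ≠ 0` under a local diffeomorphism. -/
theorem exists_straightening [FiniteDimensional ℝ E] {V : E → E} {U : Set E} {p w : E}
    (hU : IsOpen U) (hpU : p ∈ U) (hV : ContDiffOn ℝ ∞ V U) (hp : V p ≠ 0) (hw : w ≠ 0) :
    ∃ ψ : OpenPartialHomeomorph E E, 0 ∈ ψ.source ∧ ψ 0 = p ∧ ψ.target ⊆ U ∧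
      ContDiffOn ℝ ∞ ψ ψ.source ∧ ContDiffOn ℝ ∞ ψ.symm ψ.target ∧
      ∀ y ∈ ψ.source, fderiv ℝ ψ y w = V (ψ y) := by
  obtain ⟨V', hV', heq⟩ := exists_contDiff_extension hU hpU hV
  obtain ⟨O, hO, hOo, hpO⟩ := eventually_nhds_iff.1 (heq.and (hU.mem_nhds hpU))
  have hp' : V' p = V p := heq.eq_of_nhds
  obtain ⟨ψ, h0, hψ0, hψ, hψs, hd⟩ := exists_straightening_aux hV' (by rwa [hp'])
  obtain ⟨A, hA⟩ := SeparatingDual.exists_continuousLinearEquiv_apply_eq (R := ℝ) hw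
    (hp' ▸ hp : V' p ≠ 0)
  set k := A.toHomeomorph.toOpenPartialHomeomorph.trans (ψ.trans (.ofSet O hOo)) with hk
  have hks : ∀ y, y ∈ k.source ↔ A y ∈ ψ.source ∧ ψ (A y) ∈ O := by
    intro y
    simp [hk]
  have hkt : ∀ y, y ∈ k.target ↔ y ∈ O ∧ y ∈ ψ.target := by
    intro y
    simp [hk]
  refine ⟨k, ?_, ?_, ?_, ?_, ?_, ?_⟩
  · rw [hks, map_zero, hψ0]
    exact ⟨h0, hpO⟩
  · simp [hk, hψ0]
  · exact fun y hy => (hO y ((hkt y).1 hy).1).2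
  · exact hψ.comp A.contDiff.contDiffOn fun y hy => ((hks y).1 hy).1
  · exact A.symm.contDiff.comp_contDiffOn (hψs.mono fun y hy => ((hkt y).1 hy).2)
  · intro y hy
    obtain ⟨h1, h2⟩ := (hks y).1 hy
    have h3 : DifferentiableAt ℝ ψ (A y) :=
      (hψ.contDiffAt (ψ.open_source.mem_nhds h1)).differentiableAt (by simp)
    have h4 : HasFDerivAt k ((fderiv ℝ ψ (A y)).comp (A : E →L[ℝ] E)) y :=
      h3.hasFDerivAt.comp y A.hasFDerivAt
    rw [h4.fderiv]
    change fderiv ℝ ψ (A y) (A w) = _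
    rw [hA, hd _ h1]
    exact (hO _ h2).1

/-- A smooth function has a smooth primitive in a given direction. -/
theorem exists_directional_primitive {E : Type} [NormedAddCommGroup E] [NormedSpace ℝ E]
    {h : E → ℝ} (hh : ContDiff ℝ ∞ h) {v : E} (hv : v ≠ 0) :
    ∃ Θ : E → ℝ, ContDiff ℝ ∞ Θ ∧ ∀ y, fderiv ℝ Θ y v = h y := by
  obtain ⟨ev, hev⟩ := SeparatingDual.exists_eq_one (R := ℝ) hv
  -- the segment from the hyperplane `ev = 0` to `y` in the direction `v`
  set γ : E → C(unitInterval, E) := fun y => ContinuousMap.const _ y +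
    ev y • (⟨fun r => ((r : ℝ) - 1) • v, by fun_prop⟩ : C(unitInterval, E)) with hγ
  have hγsm : ContDiff ℝ ∞ γ :=
    (ContinuousLinearMap.const ℝ unitInterval (M := E)).contDiff.add
      (ev.contDiff.smul contDiff_const)
  set Θ : E → ℝ := fun y => ev y * ∫ r in (0 : ℝ)..1, h (y + ev y • (r - 1) • v) with hΘ
  have hΘ' : Θ = fun y => ev y *
      primitive ℝ ((ContinuousMap.mk h hh.continuous).comp (γ y)) 1 := by
    funext y
    rw [primitive_apply]
    simp only [hΘ, Set.Icc.coe_one]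
    congr 1
    apply intervalIntegral.integral_congr
    intro r hr
    rw [uIcc_of_le zero_le_one] at hr
    simp [hγ, projIcc_of_mem _ hr]
  have hsm : ContDiff ℝ ∞ Θ := by
    rw [hΘ']
    exact ev.contDiff.mul ((ContinuousMap.evalCLM ℝ (1 : unitInterval) (M := ℝ)).contDiff.comp
      ((primitive ℝ).contDiff.comp ((contDiff_postcomp hh).comp hγsm)))
  refine ⟨Θ, hsm, fun y => ?_⟩
  have h1 : ∀ t : ℝ, Θ (y + t • v) =
      ∫ r in (0 : ℝ)..(ev y + t), h (y - ev y • v + r • v) := by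
    intro t
    have h2 := intervalIntegral.smul_integral_comp_mul_right (a := 0) (b := 1)
      (fun r => h (y - ev y • v + r • v)) (ev y + t)
    rw [zero_mul, one_mul] at h2
    rw [← h2]
    simp only [hΘ, map_add, map_smul, hev, smul_eq_mul, mul_one]
    congr 2
    funext r
    congr 1
    module
  have h3 : HasDerivAt (fun t : ℝ => Θ (y + t • v)) (h y) 0 := by
    have hc : Continuous fun r : ℝ => h (y - ev y • v + r • v) :=
      hh.continuous.comp (by fun_prop)
    have h4 := (hc.integral_hasStrictDerivAt 0 (ev y + 0)).hasDerivAt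
    have h5 := h4.comp_const_add (ev y) 0
    simp only [add_zero, sub_add_cancel] at h5
    exact h5.congr_of_eventuallyEq (Eventually.of_forall h1)
  have h6 : HasDerivAt (fun t : ℝ => y + t • v) v 0 := by
    simpa using ((hasDerivAt_id (0 : ℝ)).smul_const v).const_add y
  exact (HasFDerivAt.comp_hasDerivAt (l := Θ) (f := fun t : ℝ => y + t • v) (0 : ℝ)
    (by simpa using (hsm.differentiable (by simp) y).hasFDerivAt) h6).unique h3

end Straightening

/-! ### Components and partial derivatives in charts -/

section Coordinates

variable {M : Type*} [TopologicalSpace M] [ChartedSpace (EuclideanSpace ℝ (Fin 4)) M]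
  {e : OpenPartialHomeomorph M (EuclideanSpace ℝ (Fin 4))}

/-- Smoothness of a real function on a set. -/
abbrev SmoothFunOn (f : M → ℝ) (U : Set M) : Prop := ContMDiffOn (𝓡 4) 𝓘(ℝ, ℝ) ∞ f U

theorem mdifferentiable_of_mem_charts (he : e ∈ charts M) : e.MDifferentiable (𝓡 4) (𝓡 4) :=
  ⟨(contMDiffOn_of_mem_maximalAtlas he).mdifferentiableOn (by simp),
    (contMDiffOn_symm_of_mem_maximalAtlas he).mdifferentiableOn (by simp)⟩

theorem smoothFunOn_coord (he : e ∈ charts M) (i : Fin 4) :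
    SmoothFunOn (fun x => e x i) e.source :=
  (EuclideanSpace.proj i : EuclideanSpace ℝ (Fin 4) →L[ℝ] ℝ).contMDiff.comp_contMDiffOn
    (contMDiffOn_of_mem_maximalAtlas he)

theorem SmoothFunOn.mdifferentiableAt {f : M → ℝ} {U : Set M} (hf : SmoothFunOn f U)
    (hU : IsOpen U) {x : M} (hx : x ∈ U) : MDifferentiableAt (𝓡 4) 𝓘(ℝ, ℝ) f x :=
  (hf.contMDiffAt (hU.mem_nhds hx)).mdifferentiableAt (by simp)

/-- The derivative of the chart `e` at `x`, with values in the model space: it sends a tangent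
vector to the vector of its components. -/
def chartDeriv (e : OpenPartialHomeomorph M (EuclideanSpace ℝ (Fin 4))) (x : M) :
    TangentSpace (𝓡 4) x →L[ℝ] EuclideanSpace ℝ (Fin 4) :=
  mfderiv (𝓡 4) (𝓡 4) e x

/-- The differentials of the coordinate functions are the components of the derivative of the
chart. -/
theorem coordDiff_apply (he : e ∈ charts M) {x : M} (hx : x ∈ e.source) (i : Fin 4)
    (v : TangentSpace (𝓡 4) x) :
    coordDiff e i x v = chartDeriv e x v i := by
  have h1 := ((EuclideanSpace.proj i : EuclideanSpace ℝ (Fin 4) →L[ℝ] ℝ).hasMFDerivAt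
    (x := e x)).comp x ((mdifferentiable_of_mem_charts he).mdifferentiableAt hx).hasMFDerivAt
  have h2 := h1.mfderiv
  unfold coordDiff
  exact congrArg (fun L : TangentSpace (𝓡 4) x →L[ℝ] ℝ => L v) h2

theorem coordDiff_coordVec (he : e ∈ charts M) {x : M} (hx : x ∈ e.source) (i j : Fin 4) :
    coordDiff e i x (coordVec e j x) = if i = j then 1 else 0 := by
  rw [coordDiff_apply he hx]
  have h1 := (mdifferentiable_of_mem_charts he).comp_symm_deriv (e.map_source hx)
  rw [e.left_inv hx] at h1
  have h2 := congrArg (fun L : EuclideanSpace ℝ (Fin 4) →L[ℝ] EuclideanSpace ℝ (Fin 4) =>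
    L (EuclideanSpace.single j (1 : ℝ)) i) h1
  refine h2.trans ?_
  change (EuclideanSpace.single j (1 : ℝ) : EuclideanSpace ℝ (Fin 4)) i = _
  simp

theorem sum_coordDiff_smul_coordVec (he : e ∈ charts M) {x : M} (hx : x ∈ e.source)
    (v : TangentSpace (𝓡 4) x) : ∑ i, coordDiff e i x v • coordVec e i x = v := by
  have h1 := (mdifferentiable_of_mem_charts he).symm_comp_deriv hx
  have h2 := congrArg (fun L : TangentSpace (𝓡 4) x →L[ℝ] TangentSpace (𝓡 4) x => L v) h1
  refine Eq.trans ?_ h2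
  change _ = mfderiv (𝓡 4) (𝓡 4) e.symm (e x) (chartDeriv e x v)
  have h3 : chartDeriv e x v =
      ∑ i, coordDiff e i x v • EuclideanSpace.single i (1 : ℝ) := by
    ext j
    simp [coordDiff_apply he hx, Pi.single_apply]
  rw [h3]
  refine Eq.trans ?_ (map_sum (mfderiv (𝓡 4) (𝓡 4) e.symm (e x) :
    EuclideanSpace ℝ (Fin 4) →L[ℝ] TangentSpace (𝓡 4) (e.symm (e x))) _ _).symm
  refine Finset.sum_congr rfl fun i _ => ?_
  exact (map_smul (mfderiv (𝓡 4) (𝓡 4) e.symm (e x) :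
    EuclideanSpace ℝ (Fin 4) →L[ℝ] TangentSpace (𝓡 4) (e.symm (e x))) _ _).symm

theorem smoothOn_coordVec [IsManifold (𝓡 4) ∞ M] (he : e ∈ charts M) (i : Fin 4) :
    SmoothOn (coordVec e i) e.source := by
  have h1 := (contMDiffOn_symm_of_mem_maximalAtlas he).contMDiffOn_tangentMapWithin
    (m := ∞) (by simp) e.open_target.uniqueMDiffOn
  have h2 : ContMDiffOn (𝓡 4) (𝓡 4).tangent ∞ (fun x => (⟨e x, EuclideanSpace.single i (1 : ℝ)⟩ :
      TangentBundle (𝓡 4) (EuclideanSpace ℝ (Fin 4)))) e.source := by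
    have h3 : ContMDiff (𝓡 4) (𝓡 4).tangent ∞ (fun y : EuclideanSpace ℝ (Fin 4) =>
        (⟨y, EuclideanSpace.single i (1 : ℝ)⟩ : TangentBundle (𝓡 4) (EuclideanSpace ℝ (Fin 4)))) :=
      contMDiff_vectorSpace_iff_contDiff.2 contDiff_const
    exact h3.comp_contMDiffOn (contMDiffOn_of_mem_maximalAtlas he)
  refine (h1.comp h2 fun x hx => e.map_source hx).congr fun x hx => ?_
  have h4 : mfderivWithin (𝓡 4) (𝓡 4) e.symm e.target (e x) =
      mfderiv (𝓡 4) (𝓡 4) e.symm (e x) :=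
    mfderivWithin_of_isOpen e.open_target (e.map_source hx)
  simp only [Function.comp_apply, tangentMapWithin, h4]
  refine Bundle.TotalSpace.ext (e.left_inv hx).symm ?_
  exact HEq.rfl

theorem SmoothOn.mfderiv_apply [IsManifold (𝓡 4) ∞ M] {X : VectorField M} {U : Set M}
    {f : M → ℝ} (hX : SmoothOn X U) (hf : SmoothFunOn f U) (hU : IsOpen U) :
    SmoothFunOn (fun x => mfderiv (𝓡 4) 𝓘(ℝ, ℝ) f x (X x)) U := by
  have h1 := hf.contMDiffOn_tangentMapWithin (m := ∞) (by simp) hU.uniqueMDiffOn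
  have h2 := (contMDiff_snd_tangentBundle_modelSpace ℝ 𝓘(ℝ, ℝ) (n := ∞)).comp_contMDiffOn
    (h1.comp hX fun x hx => hx)
  refine h2.congr fun x hx => ?_
  have h3 : mfderivWithin (𝓡 4) 𝓘(ℝ, ℝ) f U x = mfderiv (𝓡 4) 𝓘(ℝ, ℝ) f x :=
    mfderivWithin_of_isOpen hU hx
  rw [← h3]
  rfl

theorem SmoothOn.mono [IsManifold (𝓡 4) ∞ M] {X : VectorField M} {U V : Set M}
    (hX : SmoothOn X U) (h : V ⊆ U) : SmoothOn X V := ContMDiffOn.mono hX h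

theorem SmoothOn.coordDiff [IsManifold (𝓡 4) ∞ M] {X : VectorField M} {U : Set M}
    (hX : SmoothOn X U) (hU : IsOpen U) (he : e ∈ charts M) (i : Fin 4) :
    SmoothFunOn (fun x => coordDiff e i x (X x)) (e.source ∩ U) :=
  (hX.mono inter_subset_right).mfderiv_apply ((smoothFunOn_coord he i).mono inter_subset_left)
    (e.open_source.inter hU)

theorem SmoothOn.smul [IsManifold (𝓡 4) ∞ M] {X : VectorField M} {U : Set M} {f : M → ℝ}
    (hf : SmoothFunOn f U) (hX : SmoothOn X U) : SmoothOn (fun x => f x • X x) U := by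
  exact ContMDiffOn.smul_section hf hX

theorem SmoothOn.add [IsManifold (𝓡 4) ∞ M] {X Y : VectorField M} {U : Set M}
    (hX : SmoothOn X U) (hY : SmoothOn Y U) : SmoothOn (fun x => X x + Y x) U := by
  exact ContMDiffOn.add_section hX hY

theorem SmoothOn.sum [IsManifold (𝓡 4) ∞ M] {ι : Type*} {s : Finset ι} {X : ι → VectorField M}
    {U : Set M} (hX : ∀ i ∈ s, SmoothOn (X i) U) : SmoothOn (fun x => ∑ i ∈ s, X i x) U := by
  exact ContMDiffOn.sum_section hX

theorem differentiableAt_comp_symm (he : e ∈ charts M) {x : M} (hx : x ∈ e.source) {f : M → ℝ}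
    (hf : MDifferentiableAt (𝓡 4) 𝓘(ℝ, ℝ) f x) :
    DifferentiableAt ℝ (fun y => f (e.symm y)) (e x) := by
  have h1 := (mdifferentiable_of_mem_charts he).mdifferentiableAt_symm (e.map_source hx)
  have h2 : MDifferentiableAt (𝓡 4) 𝓘(ℝ, ℝ) (f ∘ e.symm) (e x) :=
    MDifferentiableAt.comp (e x) (by rwa [e.left_inv hx]) h1
  exact mdifferentiableAt_iff_differentiableAt.1 h2

theorem pderiv_eq_mfderiv (he : e ∈ charts M) {x : M} (hx : x ∈ e.source) {f : M → ℝ}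
    (hf : MDifferentiableAt (𝓡 4) 𝓘(ℝ, ℝ) f x) (i : Fin 4) :
    pderiv e i f x = mfderiv (𝓡 4) 𝓘(ℝ, ℝ) f x (coordVec e i x) := by
  have h1 := (mdifferentiable_of_mem_charts he).mdifferentiableAt_symm (e.map_source hx)
  have h3 : mfderiv (𝓡 4) 𝓘(ℝ, ℝ) (f ∘ e.symm) (e x) =
      (mfderiv (𝓡 4) 𝓘(ℝ, ℝ) f (e.symm (e x))).comp (mfderiv (𝓡 4) (𝓡 4) e.symm (e x)) :=
    mfderiv_comp (e x) (by rwa [e.left_inv hx]) h1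
  rw [e.left_inv hx, mfderiv_eq_fderiv] at h3
  exact congrArg (fun L : EuclideanSpace ℝ (Fin 4) →L[ℝ] ℝ =>
    L (EuclideanSpace.single i (1 : ℝ))) h3

/-- `v(f) = vⁱ ∂ᵢf` for a tangent vector `v`. -/
theorem mfderiv_eq_sum (he : e ∈ charts M) {x : M} (hx : x ∈ e.source) {f : M → ℝ}
    (hf : MDifferentiableAt (𝓡 4) 𝓘(ℝ, ℝ) f x) (v : TangentSpace (𝓡 4) x) :
    mfderiv (𝓡 4) 𝓘(ℝ, ℝ) f x v = ∑ i, coordDiff e i x v * pderiv e i f x := by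
  conv_lhs => rw [← sum_coordDiff_smul_coordVec he hx v]
  refine (map_sum (mfderiv (𝓡 4) 𝓘(ℝ, ℝ) f x) _ _).trans ?_
  refine Finset.sum_congr rfl fun i _ => ?_
  rw [pderiv_eq_mfderiv he hx hf]
  exact map_smul (mfderiv (𝓡 4) 𝓘(ℝ, ℝ) f x) _ _

theorem smoothFunOn_pderiv [IsManifold (𝓡 4) ∞ M] (he : e ∈ charts M) {f : M → ℝ} {U : Set M}
    (hU : IsOpen U) (hf : SmoothFunOn f U) (i : Fin 4) :
    SmoothFunOn (pderiv e i f) (e.source ∩ U) :=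
  ContMDiffOn.congr (((smoothOn_coordVec he i).mono inter_subset_left).mfderiv_apply
    (hf.mono inter_subset_right) (e.open_source.inter hU))
    fun _ hx => pderiv_eq_mfderiv he hx.1 (hf.mdifferentiableAt hU hx.2) i

omit [ChartedSpace (EuclideanSpace ℝ (Fin 4)) M] in
theorem pderiv_congr {f h : M → ℝ} {x : M} (hx : x ∈ e.source) (hfh : f =ᶠ[𝓝 x] h) (i : Fin 4) :
    pderiv e i f x = pderiv e i h x := by
  unfold pderiv
  have h1 : Tendsto e.symm (𝓝 (e x)) (𝓝 x) := by
    have := e.continuousAt_symm (e.map_source hx)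
    rwa [ContinuousAt, e.left_inv hx] at this
  have h2 : (fun y => f (e.symm y)) =ᶠ[𝓝 (e x)] fun y => h (e.symm y) := h1.eventually hfh
  rw [h2.fderiv_eq]

omit [ChartedSpace (EuclideanSpace ℝ (Fin 4)) M] in
theorem pderiv_const (c : ℝ) (i : Fin 4) (x : M) : pderiv e i (fun _ => c) x = 0 := by
  simp [pderiv]

theorem pderiv_add (he : e ∈ charts M) {x : M} (hx : x ∈ e.source) {f h : M → ℝ}
    (hf : MDifferentiableAt (𝓡 4) 𝓘(ℝ, ℝ) f x) (hh : MDifferentiableAt (𝓡 4) 𝓘(ℝ, ℝ) h x)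
    (i : Fin 4) :
    pderiv e i (fun x => f x + h x) x = pderiv e i f x + pderiv e i h x := by
  unfold pderiv
  rw [fderiv_fun_add (differentiableAt_comp_symm he hx hf) (differentiableAt_comp_symm he hx hh)]
  rfl

theorem pderiv_sub (he : e ∈ charts M) {x : M} (hx : x ∈ e.source) {f h : M → ℝ}
    (hf : MDifferentiableAt (𝓡 4) 𝓘(ℝ, ℝ) f x) (hh : MDifferentiableAt (𝓡 4) 𝓘(ℝ, ℝ) h x)
    (i : Fin 4) :
    pderiv e i (fun x => f x - h x) x = pderiv e i f x - pderiv e i h x := by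
  unfold pderiv
  rw [fderiv_fun_sub (differentiableAt_comp_symm he hx hf) (differentiableAt_comp_symm he hx hh)]
  rfl

theorem pderiv_mul (he : e ∈ charts M) {x : M} (hx : x ∈ e.source) {f h : M → ℝ}
    (hf : MDifferentiableAt (𝓡 4) 𝓘(ℝ, ℝ) f x) (hh : MDifferentiableAt (𝓡 4) 𝓘(ℝ, ℝ) h x)
    (i : Fin 4) :
    pderiv e i (fun x => f x * h x) x = pderiv e i f x * h x + f x * pderiv e i h x := by
  unfold pderiv
  rw [fderiv_fun_mul (differentiableAt_comp_symm he hx hf) (differentiableAt_comp_symm he hx hh)]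
  simp [e.left_inv hx]
  ring

theorem pderiv_sum (he : e ∈ charts M) {x : M} (hx : x ∈ e.source) {ι : Type*} {s : Finset ι}
    {f : ι → M → ℝ} (hf : ∀ k ∈ s, MDifferentiableAt (𝓡 4) 𝓘(ℝ, ℝ) (f k) x) (i : Fin 4) :
    pderiv e i (fun x => ∑ k ∈ s, f k x) x = ∑ k ∈ s, pderiv e i (f k) x := by
  unfold pderiv
  rw [fderiv_fun_sum fun k hk => differentiableAt_comp_symm he hx (hf k hk)]
  simp

theorem pderiv_comm (he : e ∈ charts M) {U : Set M} (hU : IsOpen U) {x : M}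
    (hx : x ∈ e.source ∩ U) {f : M → ℝ} (hf : SmoothFunOn f U) (i j : Fin 4) :
    pderiv e i (pderiv e j f) x = pderiv e j (pderiv e i f) x := by
  set F : EuclideanSpace ℝ (Fin 4) → ℝ := fun y => f (e.symm y) with hF
  have hsm : ContDiffAt ℝ ∞ F (e x) := by
    have h1 := (contMDiffAt_symm_of_mem_maximalAtlas he (e.map_source hx.1))
    have h2 : ContMDiffAt (𝓡 4) 𝓘(ℝ, ℝ) ∞ f (e.symm (e x)) := by
      rw [e.left_inv hx.1]
      exact hf.contMDiffAt (hU.mem_nhds hx.2)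
    exact contMDiffAt_iff_contDiffAt.1 (h2.comp (e x) h1)
  have hd : DifferentiableAt ℝ (fderiv ℝ F) (e x) :=
    (hsm.fderiv_right (m := 1)
      (by norm_num; exact WithTop.coe_le_coe.2 le_top)).differentiableAt (by simp)
  have key : ∀ i j, pderiv e i (pderiv e j f) x = fderiv ℝ (fderiv ℝ F) (e x)
      (EuclideanSpace.single i 1) (EuclideanSpace.single j 1) := by
    intro i j
    have h1 : (fun y => pderiv e j f (e.symm y)) =ᶠ[𝓝 (e x)]
        fun y => fderiv ℝ F y (EuclideanSpace.single j 1) := by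
      filter_upwards [e.open_target.mem_nhds (e.map_source hx.1)] with y hy
      simp only [pderiv, e.right_inv hy, hF]
    rw [pderiv, h1.fderiv_eq, fderiv_clm_apply hd (differentiableAt_const _)]
    simp
  rw [key, key]
  exact (hsm.isSymmSndFDerivAt (by simp; exact WithTop.coe_le_coe.2 le_top)) _ _

end Coordinates

/-! ### Linear algebra of Lorentz metrics and tetrads -/

section LorentzAlgebra

variable {M : Type*} [TopologicalSpace M] [ChartedSpace (EuclideanSpace ℝ (Fin 4)) M]
  {g : LorentzMetric M} {x : M}

/-- In the coordinates of an orthonormal basis the metric is the Minkowski form. -/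
theorem exists_minkowski_coords (g : LorentzMetric M) (x : M) :
    ∃ b : Module.Basis (Fin 4) ℝ (TangentSpace (𝓡 4) x), ∀ v w,
      g.val x v w = -(b.repr v 0 * b.repr w 0) + b.repr v 1 * b.repr w 1 +
        b.repr v 2 * b.repr w 2 + b.repr v 3 * b.repr w 3 := by
  obtain ⟨b, hb⟩ := g.lorentz x
  refine ⟨b, fun v w => ?_⟩
  conv_lhs => rw [← b.sum_repr v, ← b.sum_repr w]
  simp only [Fin.sum_univ_four, map_add, map_smul, LinearMap.add_apply, LinearMap.smul_apply,
    smul_eq_mul, hb]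
  simp only [Fin.isValue, Fin.reduceEq, if_true, if_false]
  ring

theorem eq_zero_of_orthogonal {v : TangentSpace (𝓡 4) x} (h : ∀ w, g.val x v w = 0) : v = 0 := by
  obtain ⟨b, hb⟩ := exists_minkowski_coords g x
  apply b.repr.injective
  ext i
  have h1 := fun j => h (b j)
  simp only [hb, b.repr_self] at h1
  fin_cases i
  · simpa using h1 0
  · simpa using h1 1
  · simpa using h1 2
  · simpa using h1 3

theorem finrank_tangentSpace (x : M) : Module.finrank ℝ (TangentSpace (𝓡 4) x) = 4 := by
  change Module.finrank ℝ (EuclideanSpace ℝ (Fin 4)) = 4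
  simp

instance (x : M) : Module.Finite ℝ (TangentSpace (𝓡 4) x) :=
  inferInstanceAs (Module.Finite ℝ (EuclideanSpace ℝ (Fin 4)))

/-- A nonzero vector orthogonal to a timelike vector is spacelike, by the Cauchy–Schwarz inequality
for the spatial components. -/
theorem pos_of_orthogonal_timelike {t v : TangentSpace (𝓡 4) x} (ht : g.val x t t < 0)
    (hvt : g.val x v t = 0) (hv : v ≠ 0) : 0 < g.val x v v := by
  obtain ⟨b, hb⟩ := exists_minkowski_coords g x
  by_contra! h
  rw [hb] at ht hvt h
  apply hv
  apply b.repr.injective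
  set a := b.repr v
  set c := b.repr t
  have hcs : (a 1 * c 1 + a 2 * c 2 + a 3 * c 3) ^ 2 ≤
      (a 1 ^ 2 + a 2 ^ 2 + a 3 ^ 2) * (c 1 ^ 2 + c 2 ^ 2 + c 3 ^ 2) := by
    nlinarith [sq_nonneg (a 1 * c 2 - a 2 * c 1), sq_nonneg (a 1 * c 3 - a 3 * c 1),
      sq_nonneg (a 2 * c 3 - a 3 * c 2)]
  have h1 : a 1 * c 1 + a 2 * c 2 + a 3 * c 3 = a 0 * c 0 := by linarith
  have h2 : (a 1 ^ 2 + a 2 ^ 2 + a 3 ^ 2) * (c 1 ^ 2 + c 2 ^ 2 + c 3 ^ 2) ≤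
      a 0 ^ 2 * (c 1 ^ 2 + c 2 ^ 2 + c 3 ^ 2) := by
    gcongr
    linarith
  rw [h1] at hcs
  have h3 : a 0 ^ 2 * (c 0 ^ 2 - (c 1 ^ 2 + c 2 ^ 2 + c 3 ^ 2)) ≤ 0 := by nlinarith
  have h4 : 0 < c 0 ^ 2 - (c 1 ^ 2 + c 2 ^ 2 + c 3 ^ 2) := by linarith
  have h5 : a 0 ^ 2 ≤ 0 := by
    by_contra! h6
    exact absurd (mul_pos h6 h4) (not_lt.2 h3)
  have h0 : a 0 = 0 := pow_eq_zero_iff two_ne_zero |>.1 (le_antisymm h5 (sq_nonneg _))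
  have h1' : a 1 = 0 := by nlinarith [sq_nonneg (a 1), sq_nonneg (a 2), sq_nonneg (a 3)]
  have h2' : a 2 = 0 := by nlinarith [sq_nonneg (a 1), sq_nonneg (a 2), sq_nonneg (a 3)]
  have h3' : a 3 = 0 := by nlinarith [sq_nonneg (a 1), sq_nonneg (a 2), sq_nonneg (a 3)]
  ext i
  rw [map_zero]
  fin_cases i <;> assumption

theorem exists_ne_zero_orthogonal {k : ℕ} (hk : k < 4) (w : Fin k → TangentSpace (𝓡 4) x) :
    ∃ v : TangentSpace (𝓡 4) x, v ≠ 0 ∧ ∀ i, g.val x (w i) v = 0 := by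
  have h := LinearMap.ker_ne_bot_of_finrank_lt (f := LinearMap.pi fun i => g.val x (w i))
    (by simpa [finrank_tangentSpace] using hk)
  obtain ⟨v, hv, hv0⟩ := (Submodule.ne_bot_iff _).1 h
  exact ⟨v, hv0, fun i => congrFun (LinearMap.mem_ker.1 hv) i⟩

/-- Every nonzero null vector belongs to a tetrad: choose `n` in a plane containing `l`, and then an
orthonormal basis of the orthogonal complement of that plane. -/
theorem exists_isTetrad {l : TangentSpace (𝓡 4) x} (hl : l ≠ 0) (hll : g.val x l l = 0) :
    ∃ s α n, IsTetrad g x s l α n := by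
  obtain ⟨w, hw⟩ : ∃ w, g.val x l w ≠ 0 := by
    by_contra! h
    exact hl (eq_zero_of_orthogonal h)
  obtain ⟨n, hnl, hnn⟩ : ∃ n, g.val x n l = -1 ∧ g.val x n n = 0 := by
    refine ⟨(-(g.val x l w)⁻¹) • w + ((g.val x l w)⁻¹ ^ 2 * g.val x w w / 2) • l, ?_, ?_⟩
    · simp [hll, g.symm x w l, hw]
    · simp [hll, g.symm x w l]
      field_simp
      ring
  have hln : g.val x l n = -1 := by rw [g.symm, hnl]
  have hpos : ∀ v, v ≠ 0 → g.val x l v = 0 → g.val x n v = 0 → 0 < g.val x v v := by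
    intro v hv h1 h2
    refine pos_of_orthogonal_timelike (t := l + n) ?_ ?_ hv
    · simp [hll, hnn, hnl, hln]
    · simp [g.symm x v, h1, h2]
  have hunit : ∀ v, 0 < g.val x v v →
      g.val x ((√(g.val x v v))⁻¹ • v) ((√(g.val x v v))⁻¹ • v) = 1 := by
    intro v hv
    have h := Real.mul_self_sqrt hv.le
    have h' : √(g.val x v v) ≠ 0 := (Real.sqrt_pos.2 hv).ne'
    simp only [map_smul, LinearMap.smul_apply, smul_eq_mul]
    field_simp
    rw [sq, h]
  obtain ⟨s, hs0, hs⟩ := exists_ne_zero_orthogonal (g := g) (k := 2) (by norm_num) ![l, n]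
  have hsl := hs 0
  have hsn := hs 1
  obtain ⟨α, hα0, hα⟩ := exists_ne_zero_orthogonal (g := g) (k := 3) (by norm_num) ![l, n, s]
  have hαl := hα 0
  have hαn := hα 1
  have hαs := hα 2
  simp only [Fin.isValue, Matrix.cons_val] at hsl hsn hαl hαn hαs
  refine ⟨(√(g.val x s s))⁻¹ • s, (√(g.val x α α))⁻¹ • α, n,
    hll, hunit s (hpos s hs0 hsl hsn), hunit α (hpos α hα0 hαl hαn), hnn, hnl, ?_, ?_, ?_, ?_, ?_⟩
  · simp [hsl]
  · simp [g.symm x α l, hαl]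
  · simp [g.symm x α s, hαs]
  · simp [hsn]
  · simp [hαn]

variable {s l α n : TangentSpace (𝓡 4) x}

namespace IsTetrad

variable (h : IsTetrad g x s l α n)
include h

theorem sl : g.val x s l = 0 := by rw [g.symm, h.ls]
theorem lα : g.val x l α = 0 := by rw [g.symm, h.αl]
theorem sα : g.val x s α = 0 := by rw [g.symm, h.αs]
theorem sn : g.val x s n = 0 := by rw [g.symm, h.ns]
theorem αn : g.val x α n = 0 := by rw [g.symm, h.nα]
theorem ln : g.val x l n = -1 := by rw [g.symm, h.nl]

/-- The expansion of a vector in a tetrad: the dual basis of `(s, α, l, n)` is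
`(s♭, α♭, -n♭, -l♭)`. -/
theorem expand (v : TangentSpace (𝓡 4) x) :
    v = g.val x s v • s + g.val x α v • α - g.val x n v • l - g.val x l v • n := by
  have hli : LinearIndependent ℝ ![s, l, α, n] := by
    rw [Fintype.linearIndependent_iff]
    intro c hc
    rw [Fin.sum_univ_four] at hc
    simp only [Matrix.cons_val] at hc
    have h1 := congrArg (g.val x s) hc
    have h2 := congrArg (g.val x l) hc
    have h3 := congrArg (g.val x α) hc
    have h4 := congrArg (g.val x n) hc
    simp only [map_add, map_smul, map_zero, h.ss, h.sl, h.sα, h.sn, h.ll, h.ls, h.lα, h.ln, h.αs,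
      h.αl, h.αα, h.αn, h.ns, h.nl, h.nα, h.nn, smul_eq_mul] at h1 h2 h3 h4
    intro i
    fin_cases i
    · change c 0 = 0
      linarith
    · change c 1 = 0
      linarith
    · change c 2 = 0
      linarith
    · change c 3 = 0
      linarith
  have hspan := hli.span_eq_top_of_card_eq_finrank' (by simp [finrank_tangentSpace])
  rw [← sub_eq_zero]
  refine eq_zero_of_orthogonal (g := g) fun w => ?_
  have hw : w ∈ Submodule.span ℝ (range ![s, l, α, n]) := by rw [hspan]; trivial
  have hv : ∀ u, g.val x v u = g.val x u v := fun u => g.symm x v u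
  induction hw using Submodule.span_induction with
  | mem u hu =>
    obtain ⟨i, rfl⟩ := hu
    fin_cases i <;>
    simp [hv, h.ss, h.sl, h.sα, h.ll, h.ls, h.lα, h.αs,
      h.αl, h.αα, h.ns, h.nl, h.nα, h.nn, h.sn, h.ln, h.αn]
  | zero => simp
  | add u u' _ _ hu hu' => rw [map_add, hu, hu', add_zero]
  | smul c u _ hu => rw [map_smul, hu, smul_zero]

/-- The plane spanned by `l` and `s` is the common kernel of `l♭` and `α♭`. -/
theorem mem_span_iff (v : TangentSpace (𝓡 4) x) :
    v ∈ Submodule.span ℝ {l, s} ↔ g.val x l v = 0 ∧ g.val x α v = 0 := by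
  rw [Submodule.mem_span_pair]
  constructor
  · rintro ⟨a, b, rfl⟩
    simp [h.ll, h.ls, h.αl, h.αs]
  · rintro ⟨h1, h2⟩
    refine ⟨-g.val x n v, g.val x s v, ?_⟩
    conv_rhs => rw [h.expand v, h1, h2]
    module

end IsTetrad

/-! ### Equipartition and shear -/

variable {e : OpenPartialHomeomorph M (EuclideanSpace ℝ (Fin 4))}

theorem nabla_add (X : VectorField M) (v w : TangentSpace (𝓡 4) x) :
    nabla g e X x (v + w) = nabla g e X x v + nabla g e X x w := by
  simp only [nabla, map_add, add_mul, Finset.sum_add_distrib, add_smul]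

theorem nabla_smul (X : VectorField M) (c : ℝ) (v : TangentSpace (𝓡 4) x) :
    nabla g e X x (c • v) = c • nabla g e X x v := by
  simp only [nabla, map_smul, smul_eq_mul, mul_assoc, ← Finset.mul_sum, mul_smul, Finset.smul_sum]

/-- The components of the shear in the frame `(s, α)` are, up to factors, the two quantities whose
vanishing is uniform equipartition. -/
theorem uniformEquipartition_iff_shear_eq_zero {l : VectorField M}
    (h : IsTetrad g x s (l x) α n) :
    UniformEquipartition g e l x s α ↔ ∀ v w, shear g e l x s α v w = 0 := by
  constructor
  · rintro ⟨h1, h2⟩ v w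
    simp only [Equipartition] at h1
    simp only [shear, defTensor, nullExpansion, transMetric, transProj, nabla_add, nabla_smul,
      map_add, map_smul, LinearMap.add_apply, LinearMap.smul_apply, smul_eq_mul]
    rw [h1]
    linear_combination (1 / 2) * (g.val x s v * g.val x α w + g.val x α v * g.val x s w) * h2
  · intro H
    have h1 := H s s
    have h2 := H s α
    simp only [shear, defTensor, nullExpansion, transMetric, transProj, h.ss, h.αs,
      h.αα, h.sα, zero_smul, one_smul, add_zero, zero_add] at h1 h2
    constructor
    · simp only [Equipartition]
      linarith
    · linarith
end LorentzAlgebra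

/-! ### The Levi-Civita connection -/

section Connection

variable {M : Type*} [TopologicalSpace M] [ChartedSpace (EuclideanSpace ℝ (Fin 4)) M]
  {g : LorentzMetric M} {x : M} {e : OpenPartialHomeomorph M (EuclideanSpace ℝ (Fin 4))}

theorem smoothFunOn_comp (g : LorentzMetric M) (he : e ∈ charts M) (i j : Fin 4) :
    SmoothFunOn (comp e g.val i j) e.source := by
  simpa using g.smooth e he i j

theorem comp_symm (g : LorentzMetric M) (i j : Fin 4) : comp e g.val i j = comp e g.val j i :=
  funext fun x => g.symm x _ _

theorem val_eq_sum (he : e ∈ charts M) (hx : x ∈ e.source) (T : BilinField M)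
    (v w : TangentSpace (𝓡 4) x) :
    T x v w = ∑ i, ∑ j, comp e T i j x * coordDiff e i x v * coordDiff e j x w := by
  conv_lhs => rw [← sum_coordDiff_smul_coordVec he hx v, ← sum_coordDiff_smul_coordVec he hx w]
  simp only [map_sum, map_smul, LinearMap.sum_apply, LinearMap.smul_apply, smul_eq_mul,
    Finset.mul_sum, comp]
  rw [Finset.sum_comm]
  exact Finset.sum_congr rfl fun i _ => Finset.sum_congr rfl fun j _ => by ring

theorem smoothFunOn_val [IsManifold (𝓡 4) ∞ M] (g : LorentzMetric M) {X Y : VectorField M}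
    {U : Set M} (hU : IsOpen U) (hX : SmoothOn X U) (hY : SmoothOn Y U) :
    SmoothFunOn (fun x => g.val x (X x) (Y x)) U := by
  intro x hx
  set e := chartAt (EuclideanSpace ℝ (Fin 4)) x
  have he : e ∈ charts M := IsManifold.chart_mem_maximalAtlas x
  have hxe : x ∈ e.source := mem_chart_source _ x
  have h1 : SmoothFunOn (fun x => ∑ i, ∑ j, comp e g.val i j x * coordDiff e i x (X x) *
      coordDiff e j x (Y x)) (e.source ∩ U) := by
    refine contMDiffOn_finsetSum fun i _ => contMDiffOn_finsetSum fun j _ => ?_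
    exact (((smoothFunOn_comp g he i j).mono inter_subset_left).mul
      (hX.coordDiff hU he i)).mul (hY.coordDiff hU he j)
  have h2 := h1.congr fun y hy => val_eq_sum he hy.1 g.val (X y) (Y y)
  exact (h2.contMDiffAt ((e.open_source.inter hU).mem_nhds ⟨hxe, hx⟩)).contMDiffWithinAt

theorem det_metricMatrix_ne_zero (he : e ∈ charts M) (hx : x ∈ e.source) :
    (metricMatrix g e x).det ≠ 0 := by
  intro h
  obtain ⟨c, hc0, hc⟩ := Matrix.exists_mulVec_eq_zero_iff.2 h
  apply hc0
  have h1 : ∀ w, g.val x w (∑ j, c j • coordVec e j x) = 0 := by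
    intro w
    rw [← sum_coordDiff_smul_coordVec he hx w]
    simp only [map_sum, map_smul, LinearMap.sum_apply, LinearMap.smul_apply, smul_eq_mul,
      Finset.mul_sum]
    rw [Finset.sum_comm]
    refine Finset.sum_eq_zero fun i _ => ?_
    have h2 := congrFun hc i
    simp only [Matrix.mulVec, dotProduct, metricMatrix, Matrix.of_apply, comp, Pi.zero_apply] at h2
    calc ∑ j, c j * (coordDiff e i x w * g.val x (coordVec e i x) (coordVec e j x))
        = coordDiff e i x w * ∑ j, g.val x (coordVec e i x) (coordVec e j x) * c j := by
          rw [Finset.mul_sum]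
          exact Finset.sum_congr rfl fun j _ => by ring
      _ = 0 := by rw [h2, mul_zero]
  have h2 := eq_zero_of_orthogonal (g := g) fun w => (g.symm x _ w).trans (h1 w)
  funext i
  have h3 := congrArg (coordDiff e i x) h2
  simpa [coordDiff_coordVec he hx] using h3

theorem sum_metricInv_mul_comp (he : e ∈ charts M) (hx : x ∈ e.source) (i j : Fin 4) :
    ∑ m, metricInv g e i m x * comp e g.val m j x = if i = j then 1 else 0 := by
  have h := Matrix.nonsing_inv_mul (metricMatrix g e x)
    (isUnit_iff_ne_zero.2 (det_metricMatrix_ne_zero he hx))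
  have h1 := congrFun (congrFun h i) j
  rw [Matrix.mul_apply, Matrix.one_apply] at h1
  exact h1

theorem metricInv_symm (i j : Fin 4) : metricInv g e i j x = metricInv g e j i x := by
  have h : (metricMatrix g e x).transpose = metricMatrix g e x := by
    ext i j
    simp only [Matrix.transpose_apply, metricMatrix, Matrix.of_apply, comp_symm g i j]
  unfold metricInv
  conv_lhs => rw [← h, ← Matrix.transpose_nonsing_inv, Matrix.transpose_apply]

theorem sum_comp_mul_metricInv (he : e ∈ charts M) (hx : x ∈ e.source) (i j : Fin 4) :
    ∑ m, comp e g.val i m x * metricInv g e m j x = if i = j then 1 else 0 := by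
  have h := Matrix.mul_nonsing_inv (metricMatrix g e x)
    (isUnit_iff_ne_zero.2 (det_metricMatrix_ne_zero he hx))
  have h1 := congrFun (congrFun h i) j
  rw [Matrix.mul_apply, Matrix.one_apply] at h1
  exact h1

theorem christoffel_symm (k i j : Fin 4) : christoffel g e k i j x = christoffel g e k j i x := by
  simp only [christoffel]
  congr 1
  refine Finset.sum_congr rfl fun m _ => ?_
  rw [comp_symm g i j]
  ring

/-- The Christoffel symbols with all indices lowered. -/
theorem sum_comp_mul_christoffel (he : e ∈ charts M) (hx : x ∈ e.source) (m i j : Fin 4) :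
    ∑ k, comp e g.val m k x * christoffel g e k i j x =
      (1 / 2) * (pderiv e i (comp e g.val j m) x + pderiv e j (comp e g.val i m) x
        - pderiv e m (comp e g.val i j) x) := by
  simp only [christoffel, Finset.mul_sum]
  rw [Finset.sum_comm]
  have h : ∀ a, ∑ k, comp e g.val m k x * (1 / 2 * (metricInv g e k a x *
      (pderiv e i (comp e g.val j a) x + pderiv e j (comp e g.val i a) x
        - pderiv e a (comp e g.val i j) x))) = (if m = a then 1 else 0) *
      ((1 / 2) * (pderiv e i (comp e g.val j a) x + pderiv e j (comp e g.val i a) x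
        - pderiv e a (comp e g.val i j) x)) := by
    intro a
    rw [← sum_comp_mul_metricInv (g := g) he hx m a, Finset.sum_mul]
    exact Finset.sum_congr rfl fun k _ => by ring
  simp only [h, ite_mul, one_mul, zero_mul, Finset.sum_ite_eq, Finset.mem_univ, if_true]

theorem coordDiff_nabla (he : e ∈ charts M) (hx : x ∈ e.source) (X : VectorField M)
    (v : TangentSpace (𝓡 4) x) (k : Fin 4) :
    coordDiff e k x (nabla g e X x v) = ∑ i, coordDiff e i x v *
      (pderiv e i (fun x' => coordDiff e k x' (X x')) x
        + ∑ j, christoffel g e k i j x * coordDiff e j x (X x)) := by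
  simp [nabla, coordDiff_coordVec he hx]

/-- The Koszul form of `∇`: inverse metric and Christoffel symbols are eliminated in favour of
derivatives of the metric. -/
theorem val_nabla_coordVec (he : e ∈ charts M) (hx : x ∈ e.source) (X : VectorField M) (i : Fin 4)
    (w : TangentSpace (𝓡 4) x) :
    g.val x w (nabla g e X x (coordVec e i x)) = ∑ m, coordDiff e m x w *
      (∑ k, comp e g.val m k x * pderiv e i (fun x' => coordDiff e k x' (X x')) x +
        ∑ j, (1 / 2) * (pderiv e i (comp e g.val j m) x + pderiv e j (comp e g.val i m) x
        - pderiv e m (comp e g.val i j) x) * coordDiff e j x (X x)) := by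
  rw [val_eq_sum he hx]
  refine Finset.sum_congr rfl fun m _ => ?_
  simp only [coordDiff_nabla he hx, coordDiff_coordVec he hx, ite_mul, one_mul, zero_mul,
    Finset.sum_ite_eq', Finset.mem_univ, if_true, ← sum_comp_mul_christoffel he hx]
  simp only [Finset.sum_mul]
  rw [Finset.sum_comm (s := Finset.univ (α := Fin 4)) (t := Finset.univ (α := Fin 4))
    (f := fun j k => comp e g.val m k x * christoffel g e k i j x * coordDiff e j x (X x)),
    ← Finset.sum_add_distrib, Finset.mul_sum]
  refine Finset.sum_congr rfl fun k _ => ?_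
  simp only [mul_add, Finset.mul_sum]
  congr 1
  · ring
  · exact Finset.sum_congr rfl fun j _ => by ring

variable [IsManifold (𝓡 4) ∞ M] {X Y : VectorField M} {U : Set M}

/-- The Levi-Civita connection is metric. -/
theorem pderiv_val (he : e ∈ charts M) (hU : IsOpen U) (hx : x ∈ e.source ∩ U)
    (hX : SmoothOn X U) (hY : SmoothOn Y U) (i : Fin 4) :
    pderiv e i (fun x => g.val x (X x) (Y x)) x =
      g.val x (nabla g e X x (coordVec e i x)) (Y x) +
        g.val x (X x) (nabla g e Y x (coordVec e i x)) := by
  have hN : IsOpen (e.source ∩ U) := e.open_source.inter hU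
  have hXd : ∀ k, MDifferentiableAt (𝓡 4) 𝓘(ℝ, ℝ) (fun x => coordDiff e k x (X x)) x :=
    fun k => (hX.coordDiff hU he k).mdifferentiableAt hN hx
  have hYd : ∀ k, MDifferentiableAt (𝓡 4) 𝓘(ℝ, ℝ) (fun x => coordDiff e k x (Y x)) x :=
    fun k => (hY.coordDiff hU he k).mdifferentiableAt hN hx
  have hgd : ∀ j k, MDifferentiableAt (𝓡 4) 𝓘(ℝ, ℝ) (comp e g.val j k) x :=
    fun j k => (smoothFunOn_comp g he j k).mdifferentiableAt e.open_source hx.1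
  have h1 : (fun x => g.val x (X x) (Y x)) =ᶠ[𝓝 x] fun x => ∑ j, ∑ k,
      comp e g.val j k x * coordDiff e j x (X x) * coordDiff e k x (Y x) := by
    filter_upwards [e.open_source.mem_nhds hx.1] with y hy
    exact val_eq_sum he hy g.val (X y) (Y y)
  have h2 : ∀ j k, pderiv e i (fun x => comp e g.val j k x * coordDiff e j x (X x) *
      coordDiff e k x (Y x)) x = (pderiv e i (comp e g.val j k) x * coordDiff e j x (X x) +
        comp e g.val j k x * pderiv e i (fun x => coordDiff e j x (X x)) x) *
          coordDiff e k x (Y x) + comp e g.val j k x * coordDiff e j x (X x) *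
            pderiv e i (fun x => coordDiff e k x (Y x)) x := by
    intro j k
    have h4 : MDifferentiableAt (𝓡 4) 𝓘(ℝ, ℝ)
        (fun x => comp e g.val j k x * coordDiff e j x (X x)) x := (hgd j k).mul (hXd j)
    rw [pderiv_mul he hx.1 h4 (hYd k), pderiv_mul he hx.1 (hgd j k) (hXd j)]
  have h3 : ∀ j k, MDifferentiableAt (𝓡 4) 𝓘(ℝ, ℝ) (fun x => comp e g.val j k x *
      coordDiff e j x (X x) * coordDiff e k x (Y x)) x :=
    fun j k => ((hgd j k).mul (hXd j)).mul (hYd k)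
  have h4 : ∀ j, MDifferentiableAt (𝓡 4) 𝓘(ℝ, ℝ) (fun x => ∑ k, comp e g.val j k x *
      coordDiff e j x (X x) * coordDiff e k x (Y x)) x :=
    fun j => SmoothFunOn.mdifferentiableAt (contMDiffOn_finsetSum fun k _ =>
      (((smoothFunOn_comp g he j k).mono inter_subset_left).mul
        (hX.coordDiff hU he j)).mul (hY.coordDiff hU he k)) hN hx
  rw [pderiv_congr hx.1 h1, pderiv_sum he hx.1 fun j _ => h4 j]
  simp only [fun j => pderiv_sum he hx.1 (s := Finset.univ) (fun k _ => h3 j k) i, h2]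
  rw [g.symm x _ (Y x), val_nabla_coordVec he hx.1, val_nabla_coordVec he hx.1]
  simp only [mul_add, Finset.mul_sum, Finset.sum_add_distrib, add_mul]
  rw [Finset.sum_comm (f := fun m k => coordDiff e m x (Y x) * (comp e g.val m k x *
    pderiv e i (fun x' => coordDiff e k x' (X x')) x)),
    Finset.sum_comm (f := fun m j => coordDiff e m x (Y x) * (1 / 2 *
      (pderiv e i (comp e g.val j m) x + pderiv e j (comp e g.val i m) x
        - pderiv e m (comp e g.val i j) x) * coordDiff e j x (X x)))]
  simp only [← Finset.sum_add_distrib]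
  refine Finset.sum_congr rfl fun j _ => Finset.sum_congr rfl fun k _ => ?_
  rw [comp_symm g k j]
  ring

/-- Differentiating a constant inner product of two vector fields. -/
theorem val_nabla_add_eq_zero (he : e ∈ charts M) (hU : IsOpen U) (hx : x ∈ e.source ∩ U)
    (hX : SmoothOn X U) (hY : SmoothOn Y U) {c : ℝ} (hc : ∀ y ∈ U, g.val y (X y) (Y y) = c)
    (v : TangentSpace (𝓡 4) x) :
    g.val x (nabla g e X x v) (Y x) + g.val x (X x) (nabla g e Y x v) = 0 := by
  have h1 : ∀ i, g.val x (nabla g e X x (coordVec e i x)) (Y x) +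
      g.val x (X x) (nabla g e Y x (coordVec e i x)) = 0 := by
    intro i
    have h2 : (fun x => g.val x (X x) (Y x)) =ᶠ[𝓝 x] fun _ => c := by
      filter_upwards [hU.mem_nhds hx.2] with y hy using hc y hy
    rw [← pderiv_val he hU hx hX hY, pderiv_congr hx.1 h2, pderiv_const]
  have h2 : ∀ Z : VectorField M, nabla g e Z x v =
      ∑ i, coordDiff e i x v • nabla g e Z x (coordVec e i x) := by
    intro Z
    conv_lhs => rw [← sum_coordDiff_smul_coordVec he hx.1 v]
    simp only [Fin.sum_univ_four, nabla_add, nabla_smul]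
  rw [h2, h2]
  simp only [map_sum, map_smul, LinearMap.sum_apply, LinearMap.smul_apply, smul_eq_mul]
  rw [← Finset.sum_add_distrib]
  exact Finset.sum_eq_zero fun i _ => by rw [← mul_add, h1, mul_zero]

/-- The Lie bracket of vector fields, computed in the chart `e`. -/
def bracket (e : OpenPartialHomeomorph M (EuclideanSpace ℝ (Fin 4))) (X Y : VectorField M) (x : M) :
    TangentSpace (𝓡 4) x :=
  ∑ k, (∑ i, (coordDiff e i x (X x) * pderiv e i (fun x' => coordDiff e k x' (Y x')) x -
    coordDiff e i x (Y x) * pderiv e i (fun x' => coordDiff e k x' (X x')) x)) • coordVec e k x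

omit [IsManifold (𝓡 4) ∞ M] in
/-- The Levi-Civita connection is torsion-free. -/
theorem nabla_sub_nabla (X Y : VectorField M) :
    nabla g e Y x (X x) - nabla g e X x (Y x) = bracket e X Y x := by
  simp only [nabla, bracket, ← Finset.sum_sub_distrib, ← sub_smul]
  refine Finset.sum_congr rfl fun k _ => ?_
  congr 1
  simp only [mul_add, Finset.sum_add_distrib, Finset.sum_sub_distrib, Finset.mul_sum]
  rw [Finset.sum_comm (f := fun i j => coordDiff e i x (Y x) *
    (christoffel g e k i j x * coordDiff e j x (X x)))]
  have : ∀ i j, coordDiff e i x (X x) * (christoffel g e k i j x * coordDiff e j x (Y x)) =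
      coordDiff e j x (Y x) * (christoffel g e k j i x * coordDiff e i x (X x)) := by
    intro i j
    rw [christoffel_symm k i j]
    ring
  simp only [this]
  ring

theorem nabla_fun_smul (he : e ∈ charts M) (hU : IsOpen U) (hx : x ∈ e.source ∩ U) {f : M → ℝ}
    (hf : SmoothFunOn f U) (hX : SmoothOn X U) (v : TangentSpace (𝓡 4) x) :
    nabla g e (fun y => f y • X y) x v =
      (∑ i, coordDiff e i x v * pderiv e i f x) • X x + f x • nabla g e X x v := by
  conv_rhs => rw [← sum_coordDiff_smul_coordVec he hx.1 (X x)]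
  simp only [nabla, Finset.smul_sum, smul_smul, ← Finset.sum_add_distrib, ← add_smul]
  refine Finset.sum_congr rfl fun k _ => ?_
  congr 1
  rw [Finset.sum_mul, Finset.mul_sum, ← Finset.sum_add_distrib]
  refine Finset.sum_congr rfl fun i _ => ?_
  have h1 := pderiv_mul he hx.1 (hf.mdifferentiableAt hU hx.2)
    ((hX.coordDiff hU he k).mdifferentiableAt (e.open_source.inter hU) hx) i
  simp only [map_smul, smul_eq_mul, h1]
  have h2 : ∑ j, christoffel g e k i j x * (f x * coordDiff e j x (X x)) =
      f x * ∑ j, christoffel g e k i j x * coordDiff e j x (X x) := by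
    rw [Finset.mul_sum]
    exact Finset.sum_congr rfl fun j _ => by ring
  rw [h2]
  ring

theorem nabla_fun_add (he : e ∈ charts M) (hU : IsOpen U) (hx : x ∈ e.source ∩ U)
    (hX : SmoothOn X U) (hY : SmoothOn Y U) (v : TangentSpace (𝓡 4) x) :
    nabla g e (fun y => X y + Y y) x v = nabla g e X x v + nabla g e Y x v := by
  simp only [nabla, ← Finset.sum_add_distrib, ← add_smul]
  refine Finset.sum_congr rfl fun k _ => ?_
  congr 1
  refine Finset.sum_congr rfl fun i _ => ?_
  have h1 := pderiv_add he hx.1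
    ((hX.coordDiff hU he k).mdifferentiableAt (e.open_source.inter hU) hx)
    ((hY.coordDiff hU he k).mdifferentiableAt (e.open_source.inter hU) hx) i
  simp only [map_add, h1, mul_add, Finset.sum_add_distrib]
  ring

end Connection

/-! ### Rotated tetrads -/

section Rotation

variable {M : Type*} [TopologicalSpace M] [ChartedSpace (EuclideanSpace ℝ (Fin 4)) M]
  {g : LorentzMetric M} {x : M} {e : OpenPartialHomeomorph M (EuclideanSpace ℝ (Fin 4))}

theorem IsTetrad.rotate {s l α n : TangentSpace (𝓡 4) x} (h : IsTetrad g x s l α n) (θ : ℝ) :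
    IsTetrad g x (Real.cos θ • s + Real.sin θ • α) l (-Real.sin θ • s + Real.cos θ • α) n := by
  have h1 := Real.cos_sq_add_sin_sq θ
  constructor <;> simp only [map_add, map_smul, LinearMap.add_apply, LinearMap.smul_apply,
    smul_eq_mul, h.ss, h.sα, h.ll, h.ls, h.lα, h.αs, h.αl, h.αα, h.ns, h.nl, h.nα, h.nn, h.sl]
  · linear_combination h1
  · linear_combination h1
  · ring
  · ring
  · ring
  · ring
  · ring

/-- Two rotated frames span the same plane with `l` precisely if the sine of the difference of the
angles vanishes. -/
theorem span_rotate_eq_iff {s l α n : TangentSpace (𝓡 4) x} (h : IsTetrad g x s l α n)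
    (θ₁ θ₂ : ℝ) :
    Submodule.span ℝ {l, Real.cos θ₁ • s + Real.sin θ₁ • α} =
      Submodule.span ℝ {l, Real.cos θ₂ • s + Real.sin θ₂ • α} ↔
    ∃ k : ℤ, θ₁ - θ₂ = k * Real.pi := by
  have hsin : ∀ θ₁ θ₂ : ℝ, Real.cos θ₁ • s + Real.sin θ₁ • α ∈
      Submodule.span ℝ {l, Real.cos θ₂ • s + Real.sin θ₂ • α} ↔ Real.sin (θ₁ - θ₂) = 0 := by
    intro θ₁ θ₂
    rw [(h.rotate θ₂).mem_span_iff, Real.sin_sub]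
    simp only [map_add, map_smul, LinearMap.add_apply, LinearMap.smul_apply, smul_eq_mul,
      h.ls, h.lα, h.ss, h.sα, h.αs, h.αα]
    constructor
    · rintro ⟨-, h2⟩
      linarith
    · intro h2
      exact ⟨by ring, by linarith⟩
  have hle : ∀ θ₁ θ₂ : ℝ, Real.sin (θ₁ - θ₂) = 0 →
      Submodule.span ℝ {l, Real.cos θ₁ • s + Real.sin θ₁ • α} ≤
        Submodule.span ℝ {l, Real.cos θ₂ • s + Real.sin θ₂ • α} := by
    intro θ₁ θ₂ h0
    rw [Submodule.span_le]
    rintro v (rfl | rfl)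
    · exact Submodule.subset_span (mem_insert _ _)
    · exact (hsin _ _).2 h0
  have hiff : (∃ k : ℤ, θ₁ - θ₂ = k * Real.pi) ↔ Real.sin (θ₁ - θ₂) = 0 := by
    rw [Real.sin_eq_zero_iff]
    exact exists_congr fun k => eq_comm
  rw [hiff]
  constructor
  · intro heq
    rw [← hsin, ← heq]
    exact Submodule.subset_span (mem_insert_of_mem _ rfl)
  · intro h0
    refine le_antisymm (hle _ _ h0) (hle _ _ ?_)
    rw [← neg_sub, Real.sin_neg, h0, neg_zero]

theorem pderiv_cos (he : e ∈ charts M) (hx : x ∈ e.source) {f : M → ℝ}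
    (hf : MDifferentiableAt (𝓡 4) 𝓘(ℝ, ℝ) f x) (i : Fin 4) :
    pderiv e i (fun y => Real.cos (f y)) x = -Real.sin (f x) * pderiv e i f x := by
  unfold pderiv
  rw [fderiv_cos (differentiableAt_comp_symm he hx hf)]
  simp [e.left_inv hx]

theorem pderiv_sin (he : e ∈ charts M) (hx : x ∈ e.source) {f : M → ℝ}
    (hf : MDifferentiableAt (𝓡 4) 𝓘(ℝ, ℝ) f x) (i : Fin 4) :
    pderiv e i (fun y => Real.sin (f y)) x = Real.cos (f x) * pderiv e i f x := by
  unfold pderiv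
  rw [fderiv_sin (differentiableAt_comp_symm he hx hf)]
  simp [e.left_inv hx]

theorem SmoothFunOn.cos {f : M → ℝ} {U : Set M} (hf : SmoothFunOn f U) :
    SmoothFunOn (fun y => Real.cos (f y)) U :=
  Real.contDiff_cos.contMDiff.comp_contMDiffOn hf

theorem SmoothFunOn.sin {f : M → ℝ} {U : Set M} (hf : SmoothFunOn f U) :
    SmoothFunOn (fun y => Real.sin (f y)) U :=
  Real.contDiff_sin.contMDiff.comp_contMDiffOn hf

variable [IsManifold (𝓡 4) ∞ M] {U : Set M} {s l α n : VectorField M} {Θ : M → ℝ}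

theorem smoothOn_rotS (hs : SmoothOn s U) (hα : SmoothOn α U) (hΘ : SmoothFunOn Θ U) :
    SmoothOn (rotS Θ s α) U :=
  .add (.smul hΘ.cos hs) (.smul hΘ.sin hα)

theorem smoothOn_rotA (hs : SmoothOn s U) (hα : SmoothOn α U) (hΘ : SmoothFunOn Θ U) :
    SmoothOn (rotA Θ s α) U :=
  .add (.smul (ContMDiffOn.neg hΘ.sin) hs) (.smul hΘ.cos hα)

/-- The derivative of the rotated field: the derivative of the angle contributes a multiple of the
other rotated field. -/
theorem nabla_rotS (he : e ∈ charts M) (hU : IsOpen U) (hx : x ∈ e.source ∩ U)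
    (hs : SmoothOn s U) (hα : SmoothOn α U) (hΘ : SmoothFunOn Θ U) (v : TangentSpace (𝓡 4) x) :
    nabla g e (rotS Θ s α) x v =
      (∑ i, coordDiff e i x v * pderiv e i Θ x) • rotA Θ s α x +
        (Real.cos (Θ x) • nabla g e s x v + Real.sin (Θ x) • nabla g e α x v) := by
  have hc := hΘ.cos
  have hsn := hΘ.sin
  have hΘx := hΘ.mdifferentiableAt hU hx.2
  unfold rotS
  rw [nabla_fun_add he hU hx (.smul hc hs) (.smul hsn hα), nabla_fun_smul he hU hx hc hs,
    nabla_fun_smul he hU hx hsn hα]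
  simp only [pderiv_cos he hx.1 hΘx, pderiv_sin he hx.1 hΘx, mul_left_comm (coordDiff e _ x v),
    ← Finset.mul_sum, rotA]
  module

/-- For a null geodesic field `l`, brackets with fields orthogonal to `l` stay orthogonal to
`l`. -/
theorem val_bracket_null (he : e ∈ charts M) (hU : IsOpen U) (hx : x ∈ e.source ∩ U)
    (hl : IsNullGeodesicOn g l U) {X : VectorField M} (hX : SmoothOn X U)
    (hXl : ∀ y ∈ U, g.val y (X y) (l y) = 0) : g.val x (bracket e l X x) (l x) = 0 := by
  obtain ⟨c, hc⟩ := hl.geodesic e he x hx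
  have h1 := val_nabla_add_eq_zero he hU hx hX hl.smooth hXl (l x)
  have h2 := val_nabla_add_eq_zero he hU hx hl.smooth hl.smooth hl.null (X x)
  rw [g.symm x (l x)] at h2
  rw [hc, map_smul, hXl x hx.2, smul_zero, add_zero] at h1
  rw [← nabla_sub_nabla (g := g), map_sub, LinearMap.sub_apply, h1]
  linarith

/-- If equipartition is uniform, rotating the frame by `Θ` changes the obstruction to the
integrability of `span (l, s)` by the derivative of `Θ` along `l`. -/
theorem val_bracket_rotS (he : e ∈ charts M) (hU : IsOpen U) (hx : x ∈ e.source ∩ U)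
    (hs : SmoothOn s U) (hα : SmoothOn α U) (hΘ : SmoothFunOn Θ U)
    (ht : ∀ y ∈ U, IsTetrad g y (s y) (l y) (α y) (n y))
    (heq : UniformEquipartition g e l x (s x) (α x)) :
    g.val x (bracket e l (rotS Θ s α) x) (rotA Θ s α x) =
      (∑ i, coordDiff e i x (l x) * pderiv e i Θ x) + g.val x (bracket e l s x) (α x) := by
  have hss := val_nabla_add_eq_zero he hU hx hs hs (fun y hy => (ht y hy).ss) (l x)
  have hαα := val_nabla_add_eq_zero he hU hx hα hα (fun y hy => (ht y hy).αα) (l x)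
  have hsα := val_nabla_add_eq_zero he hU hx hs hα (fun y hy => (ht y hy).sα) (l x)
  have htx := ht x hx.2
  obtain ⟨h1, h2⟩ := heq
  simp only [Equipartition] at h1
  have hcs := Real.cos_sq_add_sin_sq (Θ x)
  rw [g.symm x (s x)] at hss hsα
  rw [g.symm x (α x)] at hαα
  rw [← nabla_sub_nabla (g := g), ← nabla_sub_nabla (g := g), nabla_rotS he hU hx hs hα hΘ]
  simp only [rotS, rotA, nabla_add, nabla_smul, map_add, map_sub, map_smul, LinearMap.add_apply,
    LinearMap.sub_apply, LinearMap.smul_apply, smul_eq_mul, htx.ss, htx.sα, htx.αs, htx.αα]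
  linear_combination
    ((∑ i, coordDiff e i x (l x) * pderiv e i Θ x) + g.val x (nabla g e s x (l x)) (α x)
        - g.val x (nabla g e l x (s x)) (α x)) * hcs
      + Real.cos (Θ x) * Real.sin (Θ x) * h1
      - Real.cos (Θ x) * Real.sin (Θ x) / 2 * hss
      + Real.cos (Θ x) * Real.sin (Θ x) / 2 * hαα
      - Real.sin (Θ x) ^ 2 * hsα + Real.sin (Θ x) ^ 2 * h2
end Rotation

/-! ### Integrability of plane fields -/

section Frobenius

/-- Directions of a solution of `f' = b f` do not change. -/
theorem exists_smul_eq_of_hasDerivAt {F : Type*} [NormedAddCommGroup F] [InnerProductSpace ℝ F]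
    {f : ℝ → F} {b : ℝ → ℝ} {r : ℝ} (hf : ∀ t ∈ Ioo (-r) r, HasDerivAt f (b t • f t) t)
    (h0 : ∀ t ∈ Ioo (-r) r, f t ≠ 0) {t t' : ℝ} (ht : t ∈ Ioo (-r) r) (ht' : t' ∈ Ioo (-r) r) :
    ∃ μ : ℝ, μ ≠ 0 ∧ f t' = μ • f t := by
  set w := f t' with hw
  -- the projection of the fixed vector `w` to the line spanned by `f` is constant
  set Q : ℝ → F := fun t => ((‖f t‖ ^ 2)⁻¹ * inner ℝ (f t) w) • f t with hQ
  have hQ' : ∀ t ∈ Ioo (-r) r, HasDerivAt Q 0 t := by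
    intro t ht
    have h1 := hf t ht
    have hn : ‖f t‖ ^ 2 ≠ 0 := by
      have := norm_ne_zero_iff.2 (h0 t ht)
      positivity
    have h2 := h1.norm_sq.inv hn
    have h3 : HasDerivAt (fun t => inner ℝ (f t) w) (inner ℝ (b t • f t) w) t := by
      simpa using h1.inner ℝ (hasDerivAt_const t w)
    have h4 := (h2.mul h3).smul h1
    refine h4.congr_deriv ?_
    simp only [Pi.mul_apply, Pi.inv_apply, real_inner_smul_left, real_inner_smul_right,
      real_inner_self_eq_norm_sq, smul_smul, ← add_smul]
    rw [smul_eq_zero]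
    left
    field_simp
    ring
  have hconst : Q t = Q t' := by
    refine isOpen_Ioo.is_const_of_deriv_eq_zero isPreconnected_Ioo
      (fun s hs => (hQ' s hs).differentiableAt.differentiableWithinAt)
      (fun s hs => (hQ' s hs).deriv) ht ht'
  have hQt' : Q t' = w := by
    have hn : ‖w‖ ^ 2 ≠ 0 := by
      have := norm_ne_zero_iff.2 (h0 t' ht')
      positivity
    simp only [hQ, ← hw, real_inner_self_eq_norm_sq]
    rw [inv_mul_cancel₀ hn, one_smul]
  refine ⟨(‖f t‖ ^ 2)⁻¹ * inner ℝ (f t) w, fun h => ?_, ?_⟩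
  · have : Q t = 0 := by simp only [hQ, h, zero_smul]
    rw [hconst, hQt'] at this
    exact h0 t' ht' this
  · exact (hconst.trans hQt').symm

/-- Splitting off the first coordinate. -/
def splitFirst : EuclideanSpace ℝ (Fin 4) ≃L[ℝ] ℝ × EuclideanSpace ℝ (Fin 3) :=
  LinearEquiv.toContinuousLinearEquiv
    { toFun := fun y => (y 0, WithLp.toLp 2 fun i => y i.succ)
      invFun := fun q => WithLp.toLp 2 (Fin.cons q.1 q.2 : Fin 4 → ℝ)
      map_add' := fun y z => rfl
      map_smul' := fun c y => rfl
      left_inv := fun y => by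
        ext i
        refine Fin.cases ?_ (fun j => ?_) i <;> simp
      right_inv := fun q => by
        ext <;> simp }

@[simp]
theorem splitFirst_fst (y : EuclideanSpace ℝ (Fin 4)) : (splitFirst y).1 = y 0 := rfl

@[simp]
theorem splitFirst_snd (y : EuclideanSpace ℝ (Fin 4)) (i : Fin 3) :
    (splitFirst y).2 i = y i.succ := rfl

@[simp]
theorem splitFirst_symm_zero (q : ℝ × EuclideanSpace ℝ (Fin 3)) :
    splitFirst.symm q 0 = q.1 := rfl

@[simp]
theorem splitFirst_symm_succ (q : ℝ × EuclideanSpace ℝ (Fin 3)) (i : Fin 3) :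
    splitFirst.symm q i.succ = q.2 i := rfl

/-- The open cube of side `2 r`. -/
def cube (k : ℕ) (r : ℝ) : Set (EuclideanSpace ℝ (Fin k)) := {y | ∀ i, |y i| < r}

theorem isOpen_cube (k : ℕ) (r : ℝ) : IsOpen (cube k r) := by
  simp only [cube, Set.ofPred_forall]
  exact isOpen_iInter_of_finite fun i =>
    isOpen_lt (by fun_prop) continuous_const

theorem splitFirst_mem_iff {r : ℝ} (y : EuclideanSpace ℝ (Fin 4)) :
    y ∈ cube 4 r ↔ |(splitFirst y).1| < r ∧ (splitFirst y).2 ∈ cube 3 r := by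
  simp only [cube, Set.mem_ofPred_eq, splitFirst_fst, splitFirst_snd]
  exact Fin.forall_fin_succ

variable {M : Type*} [TopologicalSpace M] [ChartedSpace (EuclideanSpace ℝ (Fin 4)) M]
  [IsManifold (𝓡 4) ∞ M]
  {g : LorentzMetric M} {x : M} {e : OpenPartialHomeomorph M (EuclideanSpace ℝ (Fin 4))}

/-- A chart followed by a diffeomorphism between open sets of the model space is a chart. -/
theorem trans_mem_charts (he : e ∈ charts M)
    {Z : OpenPartialHomeomorph (EuclideanSpace ℝ (Fin 4)) (EuclideanSpace ℝ (Fin 4))}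
    (hZ : ContDiffOn ℝ ∞ Z Z.source) (hZ' : ContDiffOn ℝ ∞ Z.symm Z.target) :
    e.trans Z ∈ charts M := by
  refine OpenPartialHomeomorph.mem_maximalAtlas_of_contMDiffOn _ ?_ ?_
  · refine (contMDiffOn_iff_contDiffOn.2 hZ).comp
      ((contMDiffOn_of_mem_maximalAtlas he).mono ?_) ?_
    · simp
    · intro x hx
      simpa using hx.2
  · refine (contMDiffOn_symm_of_mem_maximalAtlas he).comp
      ((contMDiffOn_iff_contDiffOn.2 hZ').mono ?_) ?_
    · simp
    · intro x hx
      simpa using hx.2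

omit [IsManifold (𝓡 4) ∞ M] in
theorem chartDeriv_trans (he : e ∈ charts M)
    {Z : OpenPartialHomeomorph (EuclideanSpace ℝ (Fin 4)) (EuclideanSpace ℝ (Fin 4))}
    (hZ : ContDiffOn ℝ ∞ Z Z.source) (hx : x ∈ (e.trans Z).source) (v : TangentSpace (𝓡 4) x) :
    chartDeriv (e.trans Z) x v = fderiv ℝ Z (e x) (chartDeriv e x v) := by
  rw [e.trans_source] at hx
  have h1 := ((hZ.contDiffAt (Z.open_source.mem_nhds hx.2)).differentiableAt (by simp))
  have h2 := mfderiv_comp x h1.mdifferentiableAt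
    ((mdifferentiable_of_mem_charts he).mdifferentiableAt hx.1)
  rw [mfderiv_eq_fderiv] at h2
  exact congrArg (fun L : TangentSpace (𝓡 4) x →L[ℝ] EuclideanSpace ℝ (Fin 4) => L v) h2

/-- The product of the identity in the first coordinate with the inverse of a local
diffeomorphism `ψ` of the remaining coordinates. -/
def prodChart (ψ : OpenPartialHomeomorph (EuclideanSpace ℝ (Fin 3)) (EuclideanSpace ℝ (Fin 3))) :
    OpenPartialHomeomorph (EuclideanSpace ℝ (Fin 4)) (EuclideanSpace ℝ (Fin 4)) :=
  (splitFirst.toHomeomorph.toOpenPartialHomeomorph.trans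
    ((OpenPartialHomeomorph.refl ℝ).prod ψ.symm)).trans
      splitFirst.symm.toHomeomorph.toOpenPartialHomeomorph

theorem mem_prodChart_source
    (ψ : OpenPartialHomeomorph (EuclideanSpace ℝ (Fin 3)) (EuclideanSpace ℝ (Fin 3)))
    (y : EuclideanSpace ℝ (Fin 4)) :
    y ∈ (prodChart ψ).source ↔ (splitFirst y).2 ∈ ψ.target := by
  simp [prodChart]

theorem mem_prodChart_target
    (ψ : OpenPartialHomeomorph (EuclideanSpace ℝ (Fin 3)) (EuclideanSpace ℝ (Fin 3)))
    (y : EuclideanSpace ℝ (Fin 4)) :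
    y ∈ (prodChart ψ).target ↔ (splitFirst y).2 ∈ ψ.source := by
  simp [prodChart]

theorem contDiffOn_prodChart
    {ψ : OpenPartialHomeomorph (EuclideanSpace ℝ (Fin 3)) (EuclideanSpace ℝ (Fin 3))}
    (h : ContDiffOn ℝ ∞ ψ.symm ψ.target) :
    ContDiffOn ℝ ∞ (prodChart ψ) (prodChart ψ).source := by
  refine splitFirst.symm.contDiff.comp_contDiffOn (ContDiffOn.prodMk ?_ (h.comp ?_ ?_))
  · exact (contDiff_fst.comp splitFirst.contDiff).contDiffOn
  · exact (contDiff_snd.comp splitFirst.contDiff).contDiffOn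
  · exact fun y hy => (mem_prodChart_source ψ y).1 hy

theorem contDiffOn_prodChart_symm
    {ψ : OpenPartialHomeomorph (EuclideanSpace ℝ (Fin 3)) (EuclideanSpace ℝ (Fin 3))}
    (h : ContDiffOn ℝ ∞ ψ ψ.source) :
    ContDiffOn ℝ ∞ (prodChart ψ).symm (prodChart ψ).target := by
  refine splitFirst.symm.contDiff.comp_contDiffOn (ContDiffOn.prodMk ?_ (h.comp ?_ ?_))
  · exact (contDiff_fst.comp splitFirst.contDiff).contDiffOn
  · exact (contDiff_snd.comp splitFirst.contDiff).contDiffOn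
  · exact fun y hy => (mem_prodChart_target ψ y).1 hy

theorem fderiv_prodChart
    {ψ : OpenPartialHomeomorph (EuclideanSpace ℝ (Fin 3)) (EuclideanSpace ℝ (Fin 3))}
    (h : ContDiffOn ℝ ∞ ψ.symm ψ.target) {y : EuclideanSpace ℝ (Fin 4)}
    (hy : (splitFirst y).2 ∈ ψ.target) (u : EuclideanSpace ℝ (Fin 4)) :
    fderiv ℝ (prodChart ψ) y u =
      splitFirst.symm (u 0, fderiv ℝ ψ.symm (splitFirst y).2 (splitFirst u).2) := by
  have h1 : HasFDerivAt ψ.symm (fderiv ℝ ψ.symm (splitFirst y).2) (splitFirst y).2 :=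
    ((h.contDiffAt (ψ.open_target.mem_nhds hy)).differentiableAt (by simp)).hasFDerivAt
  have h2 : HasFDerivAt (fun y => (splitFirst y).2)
      ((ContinuousLinearMap.snd ℝ ℝ (EuclideanSpace ℝ (Fin 3))).comp
        (splitFirst : EuclideanSpace ℝ (Fin 4) →L[ℝ] ℝ × EuclideanSpace ℝ (Fin 3))) y :=
    ((ContinuousLinearMap.snd ℝ ℝ (EuclideanSpace ℝ (Fin 3))).comp
      (splitFirst : EuclideanSpace ℝ (Fin 4) →L[ℝ] ℝ × EuclideanSpace ℝ (Fin 3))).hasFDerivAt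
  have h3 : HasFDerivAt (fun y => (splitFirst y).1)
      ((ContinuousLinearMap.fst ℝ ℝ (EuclideanSpace ℝ (Fin 3))).comp
        (splitFirst : EuclideanSpace ℝ (Fin 4) →L[ℝ] ℝ × EuclideanSpace ℝ (Fin 3))) y :=
    ((ContinuousLinearMap.fst ℝ ℝ (EuclideanSpace ℝ (Fin 3))).comp
      (splitFirst : EuclideanSpace ℝ (Fin 4) →L[ℝ] ℝ × EuclideanSpace ℝ (Fin 3))).hasFDerivAt
  have h4 := (splitFirst.symm.hasFDerivAt (x := ((splitFirst y).1, ψ.symm (splitFirst y).2))).comp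
    y (h3.prodMk (h1.comp y h2))
  exact congrArg (fun L : EuclideanSpace ℝ (Fin 4) →L[ℝ] EuclideanSpace ℝ (Fin 4) => L u) h4.fderiv

/-- The derivatives of mutually inverse local diffeomorphisms are mutually inverse. -/
theorem fderiv_symm_fderiv {E : Type*} [NormedAddCommGroup E] [NormedSpace ℝ E]
    {ψ : OpenPartialHomeomorph E E} (h : ContDiffOn ℝ ∞ ψ ψ.source)
    (h' : ContDiffOn ℝ ∞ ψ.symm ψ.target) {y : E} (hy : y ∈ ψ.source) (u : E) :
    fderiv ℝ ψ.symm (ψ y) (fderiv ℝ ψ y u) = u := by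
  have h1 := ((h.contDiffAt (ψ.open_source.mem_nhds hy)).differentiableAt (by simp)).hasFDerivAt
  have h2 := ((h'.contDiffAt (ψ.open_target.mem_nhds (ψ.map_source hy))).differentiableAt
    (by simp)).hasFDerivAt
  have h3 := (h2.comp y h1).congr_of_eventuallyEq (f₁ := id)
    (by filter_upwards [ψ.open_source.mem_nhds hy] with z hz using (ψ.left_inv hz).symm)
  have h4 := h3.unique (hasFDerivAt_id y)
  exact congrArg (fun L : E →L[ℝ] E => L u) h4

/-- The Frobenius theorem for the plane field spanned by `∂₀` and a second field with tail `T`: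
if the direction of `T` does not depend on the first coordinate, then straightening `T` in the
remaining coordinates yields a chart whose last two coordinates have this plane field as the common
kernel of their differentials. -/
theorem exists_frobenius_coords {r : ℝ} {T : EuclideanSpace ℝ (Fin 4) → EuclideanSpace ℝ (Fin 3)}
    (hT : ContDiffOn ℝ ∞ T (cube 4 r)) (h0 : ∀ y ∈ cube 4 r, T y ≠ 0)
    {b : EuclideanSpace ℝ (Fin 4) → ℝ}
    (hb : ∀ y ∈ cube 4 r, fderiv ℝ T y (EuclideanSpace.single 0 1) = b y • T y)
    {q : EuclideanSpace ℝ (Fin 4)} (hq : q ∈ cube 4 r) :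
    ∃ Z : OpenPartialHomeomorph (EuclideanSpace ℝ (Fin 4)) (EuclideanSpace ℝ (Fin 4)),
      q ∈ Z.source ∧ Z.source ⊆ cube 4 r ∧ ContDiffOn ℝ ∞ Z Z.source ∧
      ContDiffOn ℝ ∞ Z.symm Z.target ∧ ∀ y ∈ Z.source, ∀ u,
        ((fderiv ℝ Z y u) 2 = 0 ∧ (fderiv ℝ Z y u) 3 = 0) ↔
          ∃ c : ℝ, (splitFirst u).2 = c • T y := by
  have hq' := (splitFirst_mem_iff q).1 hq
  have hmem : ∀ {t : ℝ} {w : EuclideanSpace ℝ (Fin 3)}, t ∈ Ioo (-r) r → w ∈ cube 3 r →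
      splitFirst.symm (t, w) ∈ cube 4 r := by
    intro t w ht hw
    rw [splitFirst_mem_iff, ContinuousLinearEquiv.apply_symm_apply]
    exact ⟨abs_lt.2 ht, hw⟩
  have hq0 : q 0 ∈ Ioo (-r) r := abs_lt.1 hq'.1
  set T' : EuclideanSpace ℝ (Fin 3) → EuclideanSpace ℝ (Fin 3) :=
    fun w => T (splitFirst.symm (q 0, w)) with hT'
  have hT's : ContDiffOn ℝ ∞ T' (cube 3 r) :=
    hT.comp ((splitFirst.symm.contDiff.comp (contDiff_const.prodMk contDiff_id)).contDiffOn)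
      fun w hw => hmem hq0 hw
  obtain ⟨ψ, hψ0, hψq, hψt, hψs, hψs', hψ⟩ := exists_straightening (isOpen_cube 3 r) hq'.2 hT's
    (h0 _ (hmem hq0 hq'.2)) (w := EuclideanSpace.single 0 1) (by simp)
  -- the direction of `T` is constant along the lines in the first coordinate direction
  have hdir : ∀ y ∈ cube 4 r, ∃ μ : ℝ, μ ≠ 0 ∧ T y = μ • T' (splitFirst y).2 := by
    intro y hy
    have hy' := (splitFirst_mem_iff y).1 hy
    have hder : ∀ t ∈ Ioo (-r) r, HasDerivAt (fun t => T (splitFirst.symm (t, (splitFirst y).2)))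
        (b (splitFirst.symm (t, (splitFirst y).2)) •
          T (splitFirst.symm (t, (splitFirst y).2))) t := by
      intro t ht
      have hyt := hmem ht hy'.2
      rw [← hb _ hyt]
      have h1 := ((hT.contDiffAt ((isOpen_cube 4 r).mem_nhds hyt)).differentiableAt
        (by simp)).hasFDerivAt
      have h2 : HasDerivAt (fun t : ℝ => splitFirst.symm (t, (splitFirst y).2))
          (EuclideanSpace.single 0 1) t := by
        have h3 := splitFirst.symm.hasFDerivAt.comp_hasDerivAt t
          ((hasDerivAt_id t).prodMk (hasDerivAt_const t (splitFirst y).2))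
        refine h3.congr_deriv ?_
        ext i
        refine Fin.cases ?_ (fun j => ?_) i <;> simp
      exact h1.comp_hasDerivAt t h2
    obtain ⟨μ, hμ, h⟩ := exists_smul_eq_of_hasDerivAt hder
      (fun t ht => h0 _ (hmem ht hy'.2)) hq0 (abs_lt.1 hy'.1)
    refine ⟨μ, hμ, ?_⟩
    have hy2 : splitFirst.symm (y 0, (splitFirst y).2) = y := splitFirst.symm_apply_apply y
    have h : T (splitFirst.symm (y 0, (splitFirst y).2)) = μ • T' (splitFirst y).2 := h
    rwa [hy2] at h
  refine ⟨(prodChart ψ).restrOpen (cube 4 r) (isOpen_cube 4 r), ?_, ?_, ?_, ?_, ?_⟩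
  · exact ⟨(mem_prodChart_source ψ q).2 (hψq ▸ ψ.map_source hψ0), hq⟩
  · exact fun y hy => hy.2
  · exact (contDiffOn_prodChart hψs').mono fun y hy => hy.1
  · exact (contDiffOn_prodChart_symm hψs).mono fun y hy => hy.1
  intro y hy u
  have hyψ := (mem_prodChart_source ψ y).1 hy.1
  obtain ⟨μ, hμ, hμT⟩ := hdir y hy.2
  -- `D` maps `T y` to a multiple of the first of the three remaining coordinate vectors, so the
  -- last two components of `D u` vanish exactly when the tail of `u` is a multiple of `T y`
  set D := fderiv ℝ ψ.symm (splitFirst y).2 with hD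
  have hDT : D (T' (splitFirst y).2) = EuclideanSpace.single 0 1 := by
    have h1 := hψ _ (ψ.map_target hyψ)
    rw [ψ.right_inv hyψ] at h1
    rw [← h1, hD]
    have h2 := fderiv_symm_fderiv hψs hψs' (ψ.map_target hyψ) (EuclideanSpace.single 0 1)
    rwa [ψ.right_inv hyψ] at h2
  have hinj : Function.Injective D := by
    refine Function.LeftInverse.injective (g := fderiv ℝ ψ (ψ.symm (splitFirst y).2)) fun u => ?_
    exact fderiv_symm_fderiv (ψ := ψ.symm) hψs' hψs hyψ u
  change ((fderiv ℝ (prodChart ψ) y u) 2 = 0 ∧ (fderiv ℝ (prodChart ψ) y u) 3 = 0) ↔ _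
  rw [fderiv_prodChart hψs' hyψ]
  change (D (splitFirst u).2 1 = 0 ∧ D (splitFirst u).2 2 = 0) ↔ _
  constructor
  · rintro ⟨h1, h2⟩
    refine ⟨D (splitFirst u).2 0 * μ⁻¹, hinj ?_⟩
    rw [hμT, smul_smul, mul_assoc, inv_mul_cancel₀ hμ, mul_one, map_smul, hDT]
    ext i
    fin_cases i <;> simp [h1, h2]
  · rintro ⟨c, hc⟩
    rw [hc, hμT, map_smul, map_smul, hDT]
    simp

/-- Two fields spanning an involutive plane field, the first of which is the first coordinate field
of a cubical chart, are tangent to a foliation. -/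
theorem isFoliation_spanField (he : e ∈ charts M) {r : ℝ} (hr : e.target = cube 4 r)
    {l S : VectorField M} (hl : ∀ x ∈ e.source, l x = coordVec e 0 x) (hS : SmoothOn S e.source)
    (hlS : ∀ x ∈ e.source, ∀ a : ℝ, S x ≠ a • l x)
    (hb : ∀ x ∈ e.source, bracket e l S x ∈ spanField l S x) :
    IsFoliation e.source (spanField l S) := by
  set T : EuclideanSpace ℝ (Fin 4) → EuclideanSpace ℝ (Fin 3) :=
    fun y => WithLp.toLp 2 fun k => coordDiff e k.succ (e.symm y) (S (e.symm y)) with hT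
  have hsm : ∀ k, ContDiffOn ℝ ∞ (fun y => coordDiff e k (e.symm y) (S (e.symm y))) e.target := by
    intro k
    have h1 := (hS.coordDiff e.open_source he k).comp (contMDiffOn_symm_of_mem_maximalAtlas he)
      (fun y hy => ⟨e.map_target hy, e.map_target hy⟩)
    exact contMDiffOn_iff_contDiffOn.1 h1
  have hTs : ContDiffOn ℝ ∞ T (cube 4 r) := by
    rw [← hr, contDiffOn_euclidean]
    exact fun k => hsm k.succ
  have hlk : ∀ x ∈ e.source, ∀ k, coordDiff e k x (l x) = if k = 0 then 1 else 0 := by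
    intro x hx k
    rw [hl x hx, coordDiff_coordVec he hx]
  have hspan : ∀ x ∈ e.source, ∀ v, v ∈ spanField l S x ↔
      ∃ c : ℝ, ∀ k : Fin 3, coordDiff e k.succ x v = c * coordDiff e k.succ x (S x) := by
    intro x hx v
    rw [spanField, Submodule.mem_span_pair]
    constructor
    · rintro ⟨a, c, rfl⟩
      exact ⟨c, fun k => by simp [hlk x hx]⟩
    · rintro ⟨c, hc⟩
      refine ⟨coordDiff e 0 x v - c * coordDiff e 0 x (S x), c, ?_⟩
      have hv := sum_coordDiff_smul_coordVec he hx v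
      have hs := sum_coordDiff_smul_coordVec he hx (S x)
      rw [Fin.sum_univ_succ] at hv hs
      have hs' : c • S x = c • (coordDiff e 0 x (S x) • coordVec e 0 x +
          ∑ k : Fin 3, coordDiff e k.succ x (S x) • coordVec e k.succ x) := by rw [hs]
      conv_rhs => rw [← hv]
      rw [hs', hl x hx]
      simp only [hc, smul_add, Finset.smul_sum, smul_smul, sub_smul]
      abel
  have hTx : ∀ x ∈ e.source, ∀ k, T (e x) k = coordDiff e k.succ x (S x) := by
    intro x hx k
    change coordDiff e k.succ (e.symm (e x)) (S (e.symm (e x))) = _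
    rw [e.left_inv hx]
  have h0 : ∀ y ∈ cube 4 r, T y ≠ 0 := by
    intro y hy h
    rw [← hr] at hy
    have hx := e.map_target hy
    refine hlS _ hx (coordDiff e 0 _ (S (e.symm y))) ?_
    conv_lhs => rw [← sum_coordDiff_smul_coordVec he hx (S (e.symm y))]
    rw [Fin.sum_univ_succ, hl _ hx, add_eq_left]
    refine Finset.sum_eq_zero fun k _ => ?_
    have h1 : coordDiff e k.succ (e.symm y) (S (e.symm y)) = 0 :=
      congrArg (fun w : EuclideanSpace ℝ (Fin 3) => w k) h
    rw [h1, zero_smul]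
  -- as `l = ∂₀`, the bracket with `l` is the derivative of components in the first coordinate
  have hbr : ∀ x ∈ e.source, ∀ k, coordDiff e k x (bracket e l S x) =
      pderiv e 0 (fun x' => coordDiff e k x' (S x')) x := by
    intro x hx k
    have h1 : ∀ i j, pderiv e i (fun x' => coordDiff e j x' (l x')) x = 0 := by
      intro i j
      rw [pderiv_congr hx (h := fun _ => if j = 0 then 1 else 0), pderiv_const]
      filter_upwards [e.open_source.mem_nhds hx] with x' hx' using hlk x' hx' j
    simp [bracket, h1, hlk x hx, coordDiff_coordVec he hx]
  have hder : ∀ y ∈ cube 4 r, ∃ b : ℝ, fderiv ℝ T y (EuclideanSpace.single 0 1) = b • T y := by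
    intro y hy
    have hy' := hy
    rw [← hr] at hy'
    have hx := e.map_target hy'
    obtain ⟨c, hc⟩ := (hspan _ hx _).1 (hb _ hx)
    refine ⟨c, ?_⟩
    ext k
    have h1 : HasFDerivAt T (fderiv ℝ T y) y :=
      ((hTs.contDiffAt ((isOpen_cube 4 r).mem_nhds hy)).differentiableAt (by simp)).hasFDerivAt
    have h2 := ((EuclideanSpace.proj k : EuclideanSpace ℝ (Fin 3) →L[ℝ] ℝ).hasFDerivAt.comp y
      h1).fderiv
    have h3 := congrArg (fun L : EuclideanSpace ℝ (Fin 4) →L[ℝ] ℝ =>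
      L (EuclideanSpace.single 0 1)) h2
    have h4 := hc k
    rw [hbr _ hx, pderiv, e.right_inv hy'] at h4
    exact h3.symm.trans h4
  choose! b hb' using hder
  refine ⟨e.open_source, fun q hq => ?_⟩
  obtain ⟨Z, hqZ, hZr, hZ, hZ', hZT⟩ := exists_frobenius_coords hTs h0 hb'
    (hr ▸ e.map_source hq)
  have hz := trans_mem_charts he hZ hZ'
  refine ⟨e.trans Z, ⟨hz, fun x hx v => ?_⟩, ?_, ?_⟩
  · have hx' := hx
    rw [e.trans_source] at hx'
    rw [coordDiff_apply hz hx, coordDiff_apply hz hx, chartDeriv_trans he hZ hx, hZT _ hx'.2,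
      hspan x hx'.1]
    refine exists_congr fun c => ?_
    constructor
    · intro h
      ext k
      have h1 := h k
      rw [coordDiff_apply he hx'.1, ← hTx x hx'.1] at h1
      exact h1
    · intro h k
      rw [coordDiff_apply he hx'.1, ← hTx x hx'.1]
      exact congrArg (fun w : EuclideanSpace ℝ (Fin 3) => w k) h
  · rw [e.trans_source]
    exact ⟨hq, hqZ⟩
  · rw [e.trans_source]
    exact fun x hx => hx.1

end Frobenius

/-! ### Flow boxes and local tetrads -/

section LocalFrames

variable {M : Type*} [TopologicalSpace M] [ChartedSpace (EuclideanSpace ℝ (Fin 4)) M]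
  {g : LorentzMetric M} {p : M} {e : OpenPartialHomeomorph M (EuclideanSpace ℝ (Fin 4))}

theorem SmoothFunOn.isOpen_inter_preimage {f : M → ℝ} {U : Set M} (hf : SmoothFunOn f U)
    (hU : IsOpen U) {t : Set ℝ} (ht : IsOpen t) : IsOpen (U ∩ f ⁻¹' t) :=
  ContinuousOn.isOpen_inter_preimage (ContMDiffOn.continuousOn hf) hU ht

variable [IsManifold (𝓡 4) ∞ M]

/-- Every tangent vector extends to a vector field with constant components in a given chart. -/
theorem exists_smoothOn_extension (he : e ∈ charts M) (hp : p ∈ e.source)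
    (v : TangentSpace (𝓡 4) p) : ∃ X : VectorField M, SmoothOn X e.source ∧ X p = v :=
  ⟨fun x => ∑ i, coordDiff e i p v • coordVec e i x,
    .sum fun i _ => .smul (f := fun _ => coordDiff e i p v) contMDiffOn_const
      (smoothOn_coordVec he i), sum_coordDiff_smul_coordVec he hp v⟩

/-- A spacelike field can be normalized. -/
theorem exists_smoothOn_normalized (g : LorentzMetric M) {U : Set M} (hU : IsOpen U)
    {X : VectorField M} (hX : SmoothOn X U) (h : ∀ x ∈ U, 0 < g.val x (X x) (X x)) :
    ∃ f : M → ℝ, SmoothOn (fun x => f x • X x) U ∧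
      ∀ x ∈ U, g.val x (f x • X x) (f x • X x) = 1 := by
  refine ⟨fun x => (Real.sqrt (g.val x (X x) (X x)))⁻¹, .smul ?_ hX, fun x hx => ?_⟩
  · have h1 : ContDiffOn ℝ ∞ (fun t : ℝ => (Real.sqrt t)⁻¹) (Ioi 0) := fun t ht =>
      ((Real.contDiffAt_sqrt (ne_of_gt ht)).inv
        (Real.sqrt_ne_zero'.2 ht)).contDiffWithinAt
    exact h1.contMDiffOn.comp (smoothFunOn_val g hU hX hX) h
  · have h1 := Real.sq_sqrt (h x hx).le
    have h2 := Real.sqrt_pos.2 (h x hx)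
    simp only [map_smul, LinearMap.smul_apply, smul_eq_mul]
    field_simp
    linarith

/-- A null field is locally part of a smooth tetrad: extend a tetrad at one point and apply the
Gram–Schmidt process. -/
theorem exists_smooth_tetrad (g : LorentzMetric M) {l : VectorField M} (hl : SmoothOn l univ)
    (hll : ∀ x, g.val x (l x) (l x) = 0) (hp : l p ≠ 0) :
    ∃ W : Set M, IsOpen W ∧ p ∈ W ∧ ∃ s α n : VectorField M, SmoothOn s W ∧ SmoothOn α W ∧
      SmoothOn n W ∧ ∀ x ∈ W, IsTetrad g x (s x) (l x) (α x) (n x) := by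
  obtain ⟨s₀, α₀, n₀, h₀⟩ := exists_isTetrad hp (hll p)
  set e := chartAt (EuclideanSpace ℝ (Fin 4)) p
  have he : e ∈ charts M := IsManifold.chart_mem_maximalAtlas p
  have hpe : p ∈ e.source := mem_chart_source _ p
  obtain ⟨S, hS, hSp⟩ := exists_smoothOn_extension he hpe s₀
  obtain ⟨A, hA, hAp⟩ := exists_smoothOn_extension he hpe α₀
  obtain ⟨N, hN, hNp⟩ := exists_smoothOn_extension he hpe n₀
  have hle := hl.mono (subset_univ e.source)
  have hlN := smoothFunOn_val g e.open_source hle hN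
  set W₁ := e.source ∩ (fun x => g.val x (l x) (N x)) ⁻¹' {0}ᶜ with hW₁
  have hW₁o : IsOpen W₁ := hlN.isOpen_inter_preimage e.open_source isOpen_compl_singleton
  have hpW₁ : p ∈ W₁ := ⟨hpe, by simp [hNp, h₀.ln]⟩
  have hW₁e : W₁ ⊆ e.source := inter_subset_left
  have hinv : SmoothFunOn (fun x => (g.val x (l x) (N x))⁻¹) W₁ :=
    ContMDiffOn.inv₀ (ContMDiffOn.mono hlN hW₁e) fun x hx => hx.2
  set n : VectorField M := fun x => (-(g.val x (l x) (N x))⁻¹) • N x +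
    ((g.val x (l x) (N x))⁻¹ * (g.val x (l x) (N x))⁻¹ * g.val x (N x) (N x) * (1 / 2)) • l x
    with hn
  have hn₁ : SmoothOn n W₁ := by
    refine .add (.smul (ContMDiffOn.neg hinv) (hN.mono hW₁e)) (.smul ?_ (hle.mono hW₁e))
    exact ContMDiffOn.mul (ContMDiffOn.mul (ContMDiffOn.mul hinv hinv)
      ((smoothFunOn_val g e.open_source hN hN).mono hW₁e)) contMDiffOn_const
  have hnl : ∀ x ∈ W₁, g.val x (n x) (l x) = -1 := by
    intro x hx
    have h1 : g.val x (l x) (N x) ≠ 0 := hx.2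
    simp only [hn, map_add, map_smul, LinearMap.add_apply, LinearMap.smul_apply, smul_eq_mul,
      hll x, g.symm x (N x) (l x)]
    field_simp
    ring
  have hnn : ∀ x ∈ W₁, g.val x (n x) (n x) = 0 := by
    intro x hx
    have h1 : g.val x (l x) (N x) ≠ 0 := hx.2
    simp only [hn, map_add, map_smul, LinearMap.add_apply, LinearMap.smul_apply, smul_eq_mul,
      hll x, g.symm x (N x) (l x)]
    field_simp
    ring
  have hnp : n p = n₀ := by
    simp [hn, hNp, h₀.ln, h₀.nn]
  -- the projection of `S` to the orthogonal complement of `l` and `n`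
  have hlW := hle.mono hW₁e
  have hSW := hS.mono hW₁e
  set S' : VectorField M := fun x => S x + (g.val x (S x) (n x) • l x + g.val x (S x) (l x) • n x)
    with hS'
  have hS'W : SmoothOn S' W₁ := .add hSW (.add (.smul (smoothFunOn_val g hW₁o hSW hn₁) hlW)
    (.smul (smoothFunOn_val g hW₁o hSW hlW) hn₁))
  set W₂ := W₁ ∩ (fun x => g.val x (S' x) (S' x)) ⁻¹' Ioi 0 with hW₂
  have hW₂o : IsOpen W₂ :=
    (smoothFunOn_val g hW₁o hS'W hS'W).isOpen_inter_preimage hW₁o isOpen_Ioi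
  have hS'p : S' p = s₀ := by simp [hS', hSp, hnp, h₀.sn, h₀.sl]
  have hpW₂ : p ∈ W₂ := ⟨hpW₁, by simp [hS'p, h₀.ss]⟩
  have hW₂₁ : W₂ ⊆ W₁ := inter_subset_left
  obtain ⟨f, hs, hss⟩ := exists_smoothOn_normalized g hW₂o (hS'W.mono hW₂₁) fun x hx => hx.2
  have hls : ∀ x ∈ W₁, g.val x (l x) (S' x) = 0 := by
    intro x hx
    rw [g.symm]
    simp only [hS', map_add, map_smul, LinearMap.add_apply, LinearMap.smul_apply, smul_eq_mul,
      hll x, hnl x hx]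
    ring
  have hns : ∀ x ∈ W₁, g.val x (n x) (S' x) = 0 := by
    intro x hx
    simp only [hS', map_add, map_smul, smul_eq_mul, hnn x hx, hnl x hx, g.symm x (S x) (n x)]
    ring
  set s : VectorField M := fun x => f x • S' x with hs_def
  have hlW₂ := hlW.mono hW₂₁
  have hnW₂ := hn₁.mono hW₂₁
  have hAW := (hA.mono hW₁e).mono hW₂₁
  -- the projection of `A` to the orthogonal complement of `l`, `n` and `s`
  set A' : VectorField M := fun x => A x + ((g.val x (A x) (n x) • l x + g.val x (A x) (l x) • n x)
    + (-g.val x (A x) (s x)) • s x) with hA'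
  have hA'W : SmoothOn A' W₂ := .add hAW (.add (.add (.smul (smoothFunOn_val g hW₂o hAW hnW₂) hlW₂)
    (.smul (smoothFunOn_val g hW₂o hAW hlW₂) hnW₂))
      (.smul (ContMDiffOn.neg (smoothFunOn_val g hW₂o hAW hs)) hs))
  set W₃ := W₂ ∩ (fun x => g.val x (A' x) (A' x)) ⁻¹' Ioi 0 with hW₃
  have hW₃o : IsOpen W₃ :=
    (smoothFunOn_val g hW₂o hA'W hA'W).isOpen_inter_preimage hW₂o isOpen_Ioi
  have hA'p : A' p = α₀ := by
    simp [hA', hAp, hs_def, hS'p, hnp, h₀.αn, h₀.αl, h₀.αs]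
  have hW₃₂ : W₃ ⊆ W₂ := inter_subset_left
  obtain ⟨f', hα, hαα⟩ := exists_smoothOn_normalized g hW₃o (hA'W.mono hW₃₂) fun x hx => hx.2
  refine ⟨W₃, hW₃o, ⟨hpW₂, by simp [hA'p, h₀.αα]⟩, s, fun x => f' x • A' x, n, hs.mono hW₃₂, hα,
    hnW₂.mono hW₃₂, fun x hx => ?_⟩
  have hx₁ := hW₂₁ hx.1
  have hls' : g.val x (l x) (s x) = 0 := by simp [hs_def, hls x hx₁]
  have hns' : g.val x (n x) (s x) = 0 := by simp [hs_def, hns x hx₁]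
  have hss' : g.val x (s x) (s x) = 1 := hss x hx.1
  refine ⟨hll x, hss', hαα x hx, hnn x hx₁, hnl x hx₁, hls', ?_, ?_, hns', ?_⟩
  · simp only [hA', map_add, map_smul, LinearMap.add_apply, LinearMap.smul_apply, smul_eq_mul,
      hll x, hnl x hx₁, g.symm x (s x) (l x), hls']
    ring
  · simp only [hA', map_add, map_smul, LinearMap.add_apply, LinearMap.smul_apply, smul_eq_mul,
      hls', hns', hss']
    ring
  · simp only [hA', map_add, map_smul, smul_eq_mul, hnn x hx₁, hnl x hx₁, hns',
      g.symm x (A x) (n x)]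
    ring

/-- The restriction of a chart to the preimage of a cube. -/
def restrCube (e : OpenPartialHomeomorph M (EuclideanSpace ℝ (Fin 4))) (r : ℝ) :
    OpenPartialHomeomorph M (EuclideanSpace ℝ (Fin 4)) :=
  (e.symm.restrOpen _ (isOpen_cube 4 r)).symm

/-- A chart centred at `p` restricts to a chart onto a small cube. -/
theorem exists_restrCube (he : e ∈ charts M) (hp : p ∈ e.source) (h0 : e p = 0)
    {N : Set (EuclideanSpace ℝ (Fin 4))} (hN : N ∈ 𝓝 0) :
    ∃ r > 0, restrCube e r ∈ charts M ∧ p ∈ (restrCube e r).source ∧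
      (restrCube e r).source ⊆ e.source ∧ (restrCube e r).target = cube 4 r ∧ cube 4 r ⊆ N := by
  have hte : e.target ∈ 𝓝 0 := e.open_target.mem_nhds (h0 ▸ e.map_source hp)
  obtain ⟨ε, hε, hεN⟩ := Metric.mem_nhds_iff.1 (inter_mem hN hte)
  have hsub : cube 4 (ε / 2) ⊆ Metric.ball 0 ε := by
    intro y hy
    rw [mem_ball_zero_iff, EuclideanSpace.norm_eq, Real.sqrt_lt' hε, Fin.sum_univ_four]
    have h1 : ∀ i, ‖y i‖ ^ 2 < (ε / 2) ^ 2 := fun i => by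
      have : ‖y i‖ < ε / 2 := hy i
      gcongr
    linarith [h1 0, h1 1, h1 2, h1 3]
  refine ⟨ε / 2, by positivity, ?_, ?_, ?_, ?_, fun y hy => (hεN (hsub hy)).1⟩
  · refine OpenPartialHomeomorph.mem_maximalAtlas_of_contMDiffOn _ ?_ ?_
    · exact (contMDiffOn_of_mem_maximalAtlas he).mono fun x hx => hx.1
    · exact (contMDiffOn_symm_of_mem_maximalAtlas he).mono fun y hy => hy.1
  · refine ⟨hp, ?_⟩
    change ∀ i, |e p i| < ε / 2
    simp [h0, hε]
  · exact fun x hx => hx.1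
  · exact inter_eq_right.2 fun y hy => (hεN (hsub hy)).2

/-- A nonvanishing vector field is the first coordinate field of a chart. -/
theorem exists_flowBox {l : VectorField M} (hl : SmoothOn l univ) (hp : l p ≠ 0) :
    ∃ e ∈ charts M, p ∈ e.source ∧ e p = 0 ∧ ∀ x ∈ e.source, l x = coordVec e 0 x := by
  set e := chartAt (EuclideanSpace ℝ (Fin 4)) p
  have he : e ∈ charts M := IsManifold.chart_mem_maximalAtlas p
  have hpe : p ∈ e.source := mem_chart_source _ p
  set V : EuclideanSpace ℝ (Fin 4) → EuclideanSpace ℝ (Fin 4) :=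
    fun y => WithLp.toLp 2 fun k => coordDiff e k (e.symm y) (l (e.symm y)) with hV
  have hVs : ContDiffOn ℝ ∞ V e.target := by
    rw [contDiffOn_euclidean]
    intro k
    have h1 := (hl.coordDiff isOpen_univ he k).comp (contMDiffOn_symm_of_mem_maximalAtlas he)
      (fun y hy => ⟨e.map_target hy, mem_univ _⟩)
    exact contMDiffOn_iff_contDiffOn.1 h1
  have hVe : ∀ x ∈ e.source, V (e x) = chartDeriv e x (l x) := by
    intro x hx
    ext k
    rw [← coordDiff_apply he hx]
    change coordDiff e k (e.symm (e x)) (l (e.symm (e x))) = _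
    rw [e.left_inv hx]
  have hVp : V (e p) ≠ 0 := by
    intro h
    apply hp
    rw [← sum_coordDiff_smul_coordVec he hpe (l p)]
    refine Finset.sum_eq_zero fun k _ => ?_
    rw [coordDiff_apply he hpe, ← hVe p hpe, h]
    simp
  obtain ⟨ψ, hψ0, hψp, hψt, hψs, hψs', hψ⟩ := exists_straightening e.open_target
    (e.map_source hpe) hVs hVp (w := EuclideanSpace.single 0 1) (by simp)
  have hz : e.trans ψ.symm ∈ charts M := trans_mem_charts he hψs' hψs
  refine ⟨e.trans ψ.symm, hz, ?_, ?_, fun x hx => ?_⟩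
  · rw [e.trans_source]
    exact ⟨hpe, (hψp ▸ ψ.map_source hψ0 : e p ∈ ψ.target)⟩
  · change ψ.symm (e p) = 0
    rw [← hψp, ψ.left_inv hψ0]
  · have hx' := hx
    rw [e.trans_source] at hx'
    have hxt : e x ∈ ψ.target := hx'.2
    have h1 : chartDeriv (e.trans ψ.symm) x (l x) = EuclideanSpace.single 0 1 := by
      rw [chartDeriv_trans he hψs' hx, ← hVe x hx'.1]
      have h2 := hψ _ (ψ.map_target hxt)
      rw [ψ.right_inv hxt] at h2
      have h3 := fderiv_symm_fderiv hψs hψs' (ψ.map_target hxt) (EuclideanSpace.single 0 1)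
      rwa [ψ.right_inv hxt, h2] at h3
    rw [← sum_coordDiff_smul_coordVec hz hx (l x)]
    simp [coordDiff_apply hz hx, h1]

theorem smoothOn_bracket (he : e ∈ charts M) {U : Set M} (hU : IsOpen U) {X Y : VectorField M}
    (hX : SmoothOn X U) (hY : SmoothOn Y U) : SmoothOn (bracket e X Y) (e.source ∩ U) := by
  have hN := e.open_source.inter hU
  have hd : ∀ {Z : VectorField M}, SmoothOn Z U → ∀ i k,
      SmoothFunOn (pderiv e i fun x' => coordDiff e k x' (Z x')) (e.source ∩ U) := fun hZ i k =>
    ContMDiffOn.mono (smoothFunOn_pderiv he hN (hZ.coordDiff hU he k) i)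
      fun x hx => ⟨hx.1, hx⟩
  refine .sum fun k _ => .smul (f := fun x => ∑ i, _) ?_
    ((smoothOn_coordVec he k).mono inter_subset_left)
  refine contMDiffOn_finsetSum fun i _ => ContMDiffOn.sub ?_ ?_
  · exact ContMDiffOn.mul (hX.coordDiff hU he i) (hd hY i k)
  · exact ContMDiffOn.mul (hY.coordDiff hU he i) (hd hX i k)

/-- Around every point of a null geodesic congruence there are a cubical flow box chart, a smooth
tetrad, and an angle `Θ₀` whose derivative along `l` cancels the obstruction to the integrability
of `span (l, s)`. -/
theorem exists_flowBox_tetrad_angle {l : VectorField M} (hl : IsNullGeodesicOn g l univ) (p : M) :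
    ∃ e ∈ charts M, ∃ r > 0, p ∈ e.source ∧ e.target = cube 4 r ∧
      (∀ x ∈ e.source, l x = coordVec e 0 x) ∧
      ∃ (s α n : VectorField M) (Θ₀ : M → ℝ), SmoothOn s e.source ∧ SmoothOn α e.source ∧
        SmoothOn n e.source ∧ (∀ x ∈ e.source, IsTetrad g x (s x) (l x) (α x) (n x)) ∧
        SmoothFunOn Θ₀ e.source ∧
        ∀ x ∈ e.source, pderiv e 0 Θ₀ x + g.val x (bracket e l s x) (α x) = 0 := by
  obtain ⟨W, hW, hpW, s, α, n, hs, hα, hn, ht⟩ := exists_smooth_tetrad g hl.smooth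
    (fun x => hl.null x (mem_univ x)) (hl.ne_zero p (mem_univ p))
  obtain ⟨e, he, hpe, hep, hle⟩ := exists_flowBox hl.smooth (hl.ne_zero p (mem_univ p))
  set h : M → ℝ := fun x => g.val x (bracket e l s x) (α x) with hh
  have hNo := e.open_source.inter hW
  have hsm : SmoothFunOn h (e.source ∩ W) := smoothFunOn_val g hNo
    (smoothOn_bracket he hW (hl.smooth.mono (subset_univ W)) hs) (hα.mono inter_subset_right)
  have hO : IsOpen (e.target ∩ e.symm ⁻¹' W) := e.symm.isOpen_inter_preimage hW
  have h0O : (0 : EuclideanSpace ℝ (Fin 4)) ∈ e.target ∩ e.symm ⁻¹' W := by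
    rw [← hep]
    refine ⟨e.map_source hpe, ?_⟩
    rwa [mem_preimage, e.left_inv hpe]
  have hsm' : ContDiffOn ℝ ∞ (fun y => -h (e.symm y)) (e.target ∩ e.symm ⁻¹' W) := by
    refine contMDiffOn_iff_contDiffOn.1 (ContMDiffOn.neg (ContMDiffOn.comp hsm
      ((contMDiffOn_symm_of_mem_maximalAtlas he).mono inter_subset_left) ?_))
    exact fun y hy => ⟨e.map_target hy.1, hy.2⟩
  -- extend the right-hand side to the whole space, so that its primitive is defined everywhere, and
  -- shrink the chart to a cube on which the extension agrees with it
  obtain ⟨f', hf', hf'h⟩ := exists_contDiff_extension hO h0O hsm'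
  obtain ⟨Θ, hΘ, hΘf⟩ := exists_directional_primitive hf'
    (v := (EuclideanSpace.single 0 1 : EuclideanSpace ℝ (Fin 4))) (by simp)
  obtain ⟨r, hr, he', hpe', hse, hte, hN⟩ := exists_restrCube he hpe hep
    (inter_mem (hO.mem_nhds h0O) hf'h)
  set e' := restrCube e r with hee'
  have hxN : ∀ x ∈ e'.source, x ∈ W ∧ f' (e' x) = -h x := by
    intro x hx
    have h1 := hN (hte ▸ e'.map_source hx)
    have h2 : e.symm (e' x) = x := e'.left_inv hx
    have h3 : f' (e' x) = -h (e.symm (e' x)) := h1.2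
    have h4 : e.symm (e' x) ∈ W := h1.1.2
    rw [h2] at h3 h4
    exact ⟨h4, h3⟩
  have hsub : e'.source ⊆ W := fun x hx => (hxN x hx).1
  refine ⟨e', he', r, hr, hpe', hte, fun x hx => ?_, s, α, n, fun x => Θ (e' x), hs.mono hsub,
    hα.mono hsub, hn.mono hsub, fun x hx => ht x (hsub hx), ?_, fun x hx => ?_⟩
  · exact hle x (hse hx)
  · exact hΘ.contMDiff.comp_contMDiffOn (contMDiffOn_of_mem_maximalAtlas he')
  · have h1 : pderiv e' 0 (fun x => Θ (e' x)) x = f' (e' x) := by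
      have h2 : (fun y => Θ (e' (e'.symm y))) =ᶠ[𝓝 (e' x)] Θ := by
        filter_upwards [e'.open_target.mem_nhds (e'.map_source hx)] with y hy
        rw [e'.right_inv hy]
      rw [pderiv, h2.fderiv_eq, hΘf]
    have h3 : bracket e' l s x = bracket e l s x := rfl
    rw [h1, (hxN x hx).2, h3]
    exact neg_add_cancel _

end LocalFrames

/-! ### The Levi-Civita symbol and determinants -/

section LeviCivita

/-- The Vandermonde product of four indices: twelve times the Levi-Civita symbol, as an integer. -/
def vandermondeProd (i j k m : Fin 4) : ℤ :=
  ((j : ℤ) - i) * ((k : ℤ) - i) * ((m : ℤ) - i) * ((k : ℤ) - j) * ((m : ℤ) - j) * ((m : ℤ) - k)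

/-- Multiplying the permutation matrix by the Vandermonde matrix of `0, 1, 2, 3`, whose determinant
is `12`, gives the Vandermonde matrix of the indices. Identities between Levi-Civita symbols thus
become decidable identities between integers. -/
theorem twelve_mul_leviCivita (i j k m : Fin 4) :
    12 * leviCivita i j k m = vandermondeProd i j k m := by
  have hprod : (Matrix.of fun a b : Fin 4 => if ![i, j, k, m] a = b then (1 : ℝ) else 0) *
      Matrix.vandermonde (fun a : Fin 4 => (a : ℝ)) =
      Matrix.vandermonde (fun a => ((![i, j, k, m] a : Fin 4) : ℝ)) := by
    ext a b
    simp [Matrix.mul_apply, Matrix.vandermonde_apply]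
  have hdet := congrArg Matrix.det hprod
  rw [Matrix.det_mul, Matrix.det_vandermonde, Matrix.det_vandermonde] at hdet
  have h12 : ∏ a : Fin 4, ∏ b ∈ Finset.Ioi a, (((b : Fin 4) : ℝ) - (a : ℝ)) = 12 := by
    have : ∏ a : Fin 4, ∏ b ∈ Finset.Ioi a, (((b : Fin 4) : ℤ) - (a : ℤ)) = 12 := by decide
    exact_mod_cast congrArg (Int.cast : ℤ → ℝ) this
  rw [h12] at hdet
  rw [leviCivita, mul_comm, hdet]
  have hI0 : Finset.Ioi (0 : Fin 4) = {1, 2, 3} := by decide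
  have hI1 : Finset.Ioi (1 : Fin 4) = {2, 3} := by decide
  have hI2 : Finset.Ioi (2 : Fin 4) = {3} := by decide
  have hI3 : Finset.Ioi (3 : Fin 4) = ∅ := by decide
  rw [Fin.prod_univ_four, hI0, hI1, hI2, hI3]
  rw [Finset.prod_insert (by decide), Finset.prod_insert (by decide),
    Finset.prod_insert (by decide), Finset.prod_singleton, Finset.prod_singleton,
    Finset.prod_singleton, Finset.prod_empty]
  simp only [vandermondeProd, Matrix.cons_val]
  push_cast
  ring

theorem leviCivita_rotate (i j k m : Fin 4) : leviCivita i j k m = leviCivita j k i m := by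
  have h : vandermondeProd i j k m = vandermondeProd j k i m := by
    simp only [vandermondeProd]
    ring
  have h1 := twelve_mul_leviCivita i j k m
  rw [h, ← twelve_mul_leviCivita] at h1
  linarith

/-- The contraction of two Levi-Civita symbols over two indices. -/
theorem sum_leviCivita_mul_leviCivita (p q a i : Fin 4) :
    ∑ b, ∑ c, leviCivita b c a i * leviCivita p q b c =
      2 * ((if p = a ∧ q = i then 1 else 0) - if p = i ∧ q = a then 1 else 0) := by
  have h : ∀ p q a i : Fin 4, ∑ b, ∑ c, vandermondeProd b c a i * vandermondeProd p q b c =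
      288 * ((if p = a ∧ q = i then 1 else 0) - if p = i ∧ q = a then 1 else 0) := by
    decide +kernel
  have h1 := congrArg (Int.cast : ℤ → ℝ) (h p q a i)
  push_cast at h1
  simp only [← twelve_mul_leviCivita] at h1
  have h2 : ∀ b c, 12 * leviCivita b c a i * (12 * leviCivita p q b c) =
      144 * (leviCivita b c a i * leviCivita p q b c) := fun b c => by ring
  simp only [h2, ← Finset.mul_sum] at h1
  linarith

/-- The expansion of a determinant with the Levi-Civita symbol. -/
theorem sum_leviCivita_mul (r₀ r₁ r₂ r₃ : Fin 4 → ℝ) :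
    ∑ a, ∑ b, ∑ c, ∑ m, leviCivita a b c m * (r₀ a * r₁ b * r₂ c * r₃ m) =
      (Matrix.of ![r₀, r₁, r₂, r₃]).det := by
  have h : ∀ a b c m, leviCivita a b c m = (vandermondeProd a b c m : ℝ) / 12 := fun a b c m => by
    rw [← twelve_mul_leviCivita]
    ring
  simp only [h, Fin.sum_univ_four, vandermondeProd, Matrix.det_succ_row_zero]
  simp [Fin.sum_univ_succ, Fin.succAbove]
  ring

/-- The Levi-Civita symbol transforms with the determinant. -/
theorem sum_leviCivita_mul_matrix (A : Matrix (Fin 4) (Fin 4) ℝ) (i j k l : Fin 4) :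
    ∑ a, ∑ b, ∑ c, ∑ m, leviCivita a b c m * (A a i * A b j * A c k * A m l) =
      A.det * leviCivita i j k l := by
  rw [sum_leviCivita_mul (fun a => A a i) (fun a => A a j) (fun a => A a k) fun a => A a l,
    leviCivita, mul_comm, ← Matrix.det_transpose A, ← Matrix.det_mul]
  congr 1
  ext a b
  simp only [Matrix.mul_apply, Matrix.of_apply, Matrix.transpose_apply, ite_mul, one_mul, zero_mul,
    Finset.sum_ite_eq, Finset.mem_univ, if_true]
  fin_cases a <;> rfl

/-- Contracting the cyclic sum of derivatives of a dual with the Levi-Civita symbol leaves the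
divergence. -/
theorem sum_leviCivita_mul_cyclic {T : Fin 4 → Fin 4 → Fin 4 → ℝ}
    (hT : ∀ a p q, T a p q = -T a q p) (i : Fin 4) :
    ∑ a, ∑ b, ∑ c, leviCivita a b c i *
      ((∑ p, ∑ q, leviCivita p q b c * T a p q) + (∑ p, ∑ q, leviCivita p q c a * T b p q) +
        ∑ p, ∑ q, leviCivita p q a b * T c p q) = 12 * ∑ a, T a a i := by
  have h : ∑ a, ∑ b, ∑ c, leviCivita a b c i * (∑ p, ∑ q, leviCivita p q b c * T a p q) =
      4 * ∑ a, T a a i := by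
    rw [Finset.mul_sum]
    refine Finset.sum_congr rfl fun a _ => ?_
    have h1 : ∑ b, ∑ c, leviCivita a b c i * (∑ p, ∑ q, leviCivita p q b c * T a p q) =
        ∑ p, ∑ q, (∑ b, ∑ c, leviCivita b c a i * leviCivita p q b c) * T a p q := by
      simp only [Finset.mul_sum, Finset.sum_mul, leviCivita_rotate a]
      calc _ = ∑ b, ∑ p, ∑ c, ∑ q, _ := Finset.sum_congr rfl fun b _ => Finset.sum_comm
        _ = ∑ p, ∑ b, ∑ c, ∑ q, _ := Finset.sum_comm
        _ = ∑ p, ∑ b, ∑ q, ∑ c, _ := Finset.sum_congr rfl fun p _ =>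
            Finset.sum_congr rfl fun b _ => Finset.sum_comm
        _ = ∑ p, ∑ q, ∑ b, ∑ c, _ := Finset.sum_congr rfl fun p _ => Finset.sum_comm
        _ = _ := by simp only [mul_assoc]
    rw [h1]
    simp only [sum_leviCivita_mul_leviCivita, mul_sub, sub_mul, Finset.sum_sub_distrib, ite_and,
      mul_ite, ite_mul, mul_one, mul_zero, zero_mul]
    rw [Finset.sum_comm (f := fun p q => if p = i then if q = a then 2 * T a p q else 0 else 0)]
    simp only [Finset.sum_ite_eq', Finset.sum_ite_irrel, Finset.sum_const_zero, Finset.mem_univ,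
      if_true, hT a i a]
    ring
  have h' : ∑ a, ∑ b, ∑ c, leviCivita a b c i * (∑ p, ∑ q, leviCivita p q c a * T b p q) =
      4 * ∑ a, T a a i := by
    rw [Finset.sum_comm, ← h]
    refine Finset.sum_congr rfl fun b _ => ?_
    rw [Finset.sum_comm]
    simp only [leviCivita_rotate _ b]
  have h'' : ∑ a, ∑ b, ∑ c, leviCivita a b c i * (∑ p, ∑ q, leviCivita p q a b * T c p q) =
      4 * ∑ a, T a a i := by
    rw [← h]
    refine ((Finset.sum_congr rfl fun a _ => Finset.sum_comm).trans Finset.sum_comm).trans ?_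
    refine Finset.sum_congr rfl fun c _ => Finset.sum_congr rfl fun a _ =>
      Finset.sum_congr rfl fun b _ => ?_
    rw [leviCivita_rotate c a b]
  simp only [mul_add, Finset.sum_add_distrib, h, h', h'']
  ring

/-- Jacobi's formula for the derivative of a determinant. -/
theorem hasFDerivAt_det {E : Type*} [NormedAddCommGroup E] [NormedSpace ℝ E] {n : Type*}
    [Fintype n] [DecidableEq n] {f : n → n → E → ℝ} {f' : n → n → E →L[ℝ] ℝ} {y : E}
    (hf : ∀ i j, HasFDerivAt (f i j) (f' i j) y) :
    HasFDerivAt (fun y => (Matrix.of fun i j => f i j y).det)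
      (∑ i, ∑ j, (Matrix.of fun i j => f i j y).adjugate i j • f' j i) y := by
  have h1 : HasFDerivAt (fun y => ∑ σ : Equiv.Perm n, ((Equiv.Perm.sign σ : ℤ) : ℝ) *
      ∏ i, f (σ i) i y) (∑ σ : Equiv.Perm n, ((Equiv.Perm.sign σ : ℤ) : ℝ) •
        ∑ i, (∏ j ∈ Finset.univ.erase i, f (σ j) j y) • f' (σ i) i) y :=
    HasFDerivAt.fun_sum fun σ _ => (HasFDerivAt.finsetProd fun i _ => hf (σ i) i).const_mul _
  simp only [Matrix.det_apply', Matrix.of_apply]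
  refine h1.congr_fderiv ?_
  ext u
  have h2 : ∀ i, ∑ j, (Matrix.of fun i j => f i j y).adjugate i j * f' j i u =
      ∑ σ : Equiv.Perm n, ((Equiv.Perm.sign σ : ℤ) : ℝ) *
        ((∏ j ∈ Finset.univ.erase i, f (σ j) j y) * f' (σ i) i u) := by
    intro i
    have h3 := congrFun (Matrix.cramer_eq_adjugate_mulVec (Matrix.of fun i j => f i j y)
      fun j => f' j i u) i
    rw [Matrix.cramer_apply, Matrix.mulVec, dotProduct] at h3
    rw [← h3, Matrix.det_apply']
    refine Finset.sum_congr rfl fun σ _ => ?_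
    congr 1
    rw [← Finset.prod_erase_mul _ _ (Finset.mem_univ i)]
    congr 1
    · refine Finset.prod_congr rfl fun j hj => ?_
      simp [Finset.ne_of_mem_erase hj]
    · simp
  simp only [sum_apply, smul_apply, smul_eq_mul, h2,
    Finset.mul_sum]
  exact Finset.sum_comm

end LeviCivita

/-! ### Divergence and current -/

section Divergence

variable {M : Type*} [TopologicalSpace M] [ChartedSpace (EuclideanSpace ℝ (Fin 4)) M]
  {g : LorentzMetric M} {e : OpenPartialHomeomorph M (EuclideanSpace ℝ (Fin 4))} {x : M}

theorem sum_val_mul_coordDiff (he : e ∈ charts M) (hx : x ∈ e.source) (v w : TangentSpace (𝓡 4) x) :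
    ∑ a, g.val x v (coordVec e a x) * coordDiff e a x w = g.val x v w := by
  conv_rhs => rw [← sum_coordDiff_smul_coordVec he hx w, map_sum]
  simp only [map_smul, smul_eq_mul, mul_comm]

/-- Raising the index of `v♭` gives back `v`. -/
theorem sum_metricInv_mul_val (he : e ∈ charts M) (hx : x ∈ e.source) (v : TangentSpace (𝓡 4) x)
    (a : Fin 4) : ∑ c, metricInv g e a c x * g.val x v (coordVec e c x) = coordDiff e a x v := by
  have h : ∀ c, g.val x v (coordVec e c x) = ∑ k, comp e g.val c k x * coordDiff e k x v := by
    intro c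
    rw [g.symm, ← sum_val_mul_coordDiff he hx]
    rfl
  simp only [h, Finset.mul_sum]
  rw [Finset.sum_comm]
  simp only [← mul_assoc, ← Finset.sum_mul, sum_metricInv_mul_comp he hx]
  simp

/-- The divergence `∇ₐ Xᵃ` in a tetrad. -/
theorem IsTetrad.sum_coordDiff_nabla {s l α n : TangentSpace (𝓡 4) x} (h : IsTetrad g x s l α n)
    (he : e ∈ charts M) (hx : x ∈ e.source) (X : VectorField M) :
    ∑ a, coordDiff e a x (nabla g e X x (coordVec e a x)) =
      g.val x s (nabla g e X x s) + g.val x α (nabla g e X x α) - g.val x n (nabla g e X x l)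
        - g.val x l (nabla g e X x n) := by
  let L : TangentSpace (𝓡 4) x →ₗ[ℝ] TangentSpace (𝓡 4) x :=
    { toFun := nabla g e X x
      map_add' := nabla_add X
      map_smul' := nabla_smul X }
  have h1 : ∀ v w : TangentSpace (𝓡 4) x,
      ∑ a, g.val x v (L (coordVec e a x)) * coordDiff e a x w = g.val x v (L w) := by
    intro v w
    conv_rhs => rw [← sum_coordDiff_smul_coordVec he hx w, map_sum, map_sum]
    simp only [map_smul, smul_eq_mul, mul_comm]
  change ∑ a, coordDiff e a x (L (coordVec e a x)) = g.val x s (L s) + g.val x α (L α) -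
    g.val x n (L l) - g.val x l (L n)
  rw [← h1 s s, ← h1 α α, ← h1 n l, ← h1 l n]
  simp only [← Finset.sum_add_distrib, ← Finset.sum_sub_distrib]
  refine Finset.sum_congr rfl fun a _ => ?_
  conv_lhs => rw [h.expand (L (coordVec e a x))]
  simp only [map_add, map_sub, map_smul, smul_eq_mul]

/-- The trace of the Christoffel symbols: two of the three derivative terms cancel by symmetry. -/
theorem sum_christoffel (i : Fin 4) :
    ∑ a, christoffel g e a i a x =
      (1 / 2) * ∑ a, ∑ m, metricInv g e a m x * pderiv e i (comp e g.val m a) x := by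
  simp only [christoffel, ← Finset.mul_sum]
  congr 1
  simp only [mul_add, mul_sub, Finset.sum_add_distrib, Finset.sum_sub_distrib]
  have h1 : ∑ a, ∑ m, metricInv g e a m x * pderiv e a (comp e g.val i m) x =
      ∑ a, ∑ m, metricInv g e a m x * pderiv e m (comp e g.val i a) x := by
    rw [Finset.sum_comm]
    refine Finset.sum_congr rfl fun a _ => Finset.sum_congr rfl fun m _ => ?_
    rw [metricInv_symm]
  rw [h1, add_sub_cancel_right]
  refine Finset.sum_congr rfl fun a _ => Finset.sum_congr rfl fun m _ => ?_
  rw [comp_symm g a m]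

theorem smoothFunOn_volDensity (g : LorentzMetric M) (he : e ∈ charts M) :
    SmoothFunOn (volDensity g e) e.source := by
  have h1 : SmoothFunOn (fun x => (metricMatrix g e x).det) e.source := by
    simp only [Matrix.det_apply']
    exact contMDiffOn_finsetSum fun σ _ => ContMDiffOn.mul contMDiffOn_const
      (contMDiffOn_finsetProd fun i _ => smoothFunOn_comp g he (σ i) i)
  have h2 : ContDiffOn ℝ ∞ (fun t : ℝ => Real.sqrt |t|) {0}ᶜ := fun t ht =>
    ((Real.contDiffAt_sqrt (abs_ne_zero.2 ht)).comp t (contDiffAt_abs ht)).contDiffWithinAt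
  exact h2.contMDiffOn.comp h1 fun x hx => det_metricMatrix_ne_zero he hx

theorem volDensity_pos (he : e ∈ charts M) (hx : x ∈ e.source) : 0 < volDensity g e x :=
  Real.sqrt_pos.2 (abs_pos.2 (det_metricMatrix_ne_zero he hx))

/-- The logarithmic derivative of the volume density is the trace of the Christoffel symbols. -/
theorem pderiv_volDensity (he : e ∈ charts M) (hx : x ∈ e.source) (i : Fin 4) :
    pderiv e i (volDensity g e) x = volDensity g e x * ∑ a, christoffel g e a i a x := by
  have hd : ∀ j k, HasFDerivAt (fun y => comp e g.val j k (e.symm y))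
      (fderiv ℝ (fun y => comp e g.val j k (e.symm y)) (e x)) (e x) := fun j k =>
    (differentiableAt_comp_symm he hx ((smoothFunOn_comp g he j k).mdifferentiableAt e.open_source
      hx)).hasFDerivAt
  have h1 := hasFDerivAt_det hd
  have hdet0 := det_metricMatrix_ne_zero (g := g) he hx
  have hmx : (Matrix.of fun j k => comp e g.val j k (e.symm (e x))) = metricMatrix g e x := by
    rw [e.left_inv hx]
    rfl
  have h2 := (hasDerivAt_abs (hmx ▸ hdet0)).comp_hasFDerivAt (e x) h1
  have h3 := h2.sqrt (by simpa only [Function.comp_apply, hmx, abs_ne_zero] using hdet0)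
  have hadj : ∀ j k, (metricMatrix g e x).adjugate j k =
      (metricMatrix g e x).det * metricInv g e j k x := by
    intro j k
    rw [metricInv, Matrix.inv_def, Matrix.smul_apply, smul_eq_mul, ← mul_assoc,
      Ring.mul_inverse_cancel _ (isUnit_iff_ne_zero.2 hdet0), one_mul]
  have h4 := congrArg (fun L : EuclideanSpace ℝ (Fin 4) →L[ℝ] ℝ =>
    L (EuclideanSpace.single i 1)) h3.fderiv
  refine Eq.trans h4 ?_
  simp only [Function.comp_apply, hmx, smul_apply, sum_apply, smul_eq_mul, hadj]
  rw [sum_christoffel]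
  have h5 : volDensity g e x ≠ 0 := (volDensity_pos he hx).ne'
  have h6 : volDensity g e x * volDensity g e x = |(metricMatrix g e x).det| :=
    Real.mul_self_sqrt (abs_nonneg _)
  have h7 := sign_mul_self (metricMatrix g e x).det
  change 1 / (2 * volDensity g e x) * (_ * ∑ a, ∑ m, (metricMatrix g e x).det *
    metricInv g e a m x * pderiv e i (comp e g.val m a) x) = _
  simp only [mul_assoc (metricMatrix g e x).det, ← Finset.mul_sum]
  rw [← mul_assoc (_ : ℝ) (metricMatrix g e x).det, h7, ← h6]
  field_simp

theorem sum_comm_four {ι κ : Type*} [Fintype ι] [Fintype κ] (f : ι → ι → ι → ι → κ → ℝ) :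
    ∑ m, ∑ a, ∑ b, ∑ c, ∑ j, f m a b c j = ∑ j, ∑ m, ∑ a, ∑ b, ∑ c, f m a b c j := by
  simp only [Finset.sum_comm (s := (Finset.univ : Finset ι)) (t := (Finset.univ : Finset κ))]

variable {U : Set M}

/-- The current of a two-form is, up to a factor, the divergence of the bivector obtained by
raising its indices. -/
theorem sum_metricInv_mul_current (he : e ∈ charts M) (hU : IsOpen U) (hx : x ∈ e.source ∩ U)
    {F : BilinField M} {f : Fin 4 → Fin 4 → M → ℝ}
    (hf : ∀ a b, SmoothFunOn (f a b) (e.source ∩ U)) (hfa : ∀ a b y, f a b y = -f b a y)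
    (hF : ∀ y ∈ e.source ∩ U, ∀ a b, raise2 g e (comp e F) a b y = f a b y) (i : Fin 4) :
    ∑ m, metricInv g e i m x * current g e F m x =
      volDensity g e x * ((metricMatrix g e x)⁻¹).det *
        ∑ a, pderiv e a (fun y => volDensity g e y * f a i y) x := by
  have hN := e.open_source.inter hU
  set T : Fin 4 → Fin 4 → Fin 4 → ℝ :=
    fun k p q => pderiv e k (fun y => volDensity g e y * f p q y) x with hT
  have hTa : ∀ a p q, T a p q = -T a q p := by
    intro a p q
    simp only [hT, hfa p q, mul_neg, pderiv]
    rw [fderiv_fun_neg]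
    rfl
  have hd : ∀ p q, MDifferentiableAt (𝓡 4) 𝓘(ℝ, ℝ) (fun y => volDensity g e y * f p q y) x :=
    fun p q => ((smoothFunOn_volDensity g he).mdifferentiableAt e.open_source hx.1).mul
      ((hf p q).mdifferentiableAt hN hx)
  have hH : ∀ k b c, pderiv e k (hodge2 g e (comp e F) b c) x =
      (1 / 2) * ∑ p, ∑ q, leviCivita p q b c * T k p q := by
    intro k b c
    have h1 : hodge2 g e (comp e F) b c =ᶠ[𝓝 x] fun y =>
        ∑ p : Fin 4 × Fin 4,
          (1 / 2 * leviCivita p.1 p.2 b c) * (volDensity g e y * f p.1 p.2 y) := by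
      filter_upwards [hN.mem_nhds hx] with y hy
      simp only [hodge2, hF y hy, Finset.mul_sum, Fintype.sum_prod_type]
      refine Finset.sum_congr rfl fun a _ => Finset.sum_congr rfl fun m _ => ?_
      ring
    have hd' : ∀ p q, MDifferentiableAt (𝓡 4) 𝓘(ℝ, ℝ)
        (fun y => (1 / 2 * leviCivita p q b c) * (volDensity g e y * f p q y)) x := fun p q =>
      (mdifferentiableAt_const (c := 1 / 2 * leviCivita p q b c)).mul (hd p q)
    rw [pderiv_congr hx.1 h1, pderiv_sum he hx.1 fun p _ => hd' p.1 p.2]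
    have hmul : ∀ p q, pderiv e k (fun y => (1 / 2 * leviCivita p q b c) *
        (volDensity g e y * f p q y)) x = (1 / 2 * leviCivita p q b c) * T k p q := by
      intro p q
      rw [pderiv_mul he hx.1 (mdifferentiableAt_const (c := 1 / 2 * leviCivita p q b c)) (hd p q),
        pderiv_const, zero_mul, zero_add]
    simp only [hmul]
    simp only [Finset.mul_sum, Fintype.sum_prod_type, mul_assoc]
  set t := fun a b c => extDeriv2 e (hodge2 g e (comp e F)) a b c x with ht
  have h1 : ∑ m, metricInv g e i m x * current g e F m x = (1 / 6) * volDensity g e x *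
      ∑ a', ∑ b', ∑ c', (∑ a, ∑ b, ∑ c, ∑ m, leviCivita a b c m * (metricInv g e a a' x *
        metricInv g e b b' x * metricInv g e c c' x * metricInv g e m i x)) * t a' b' c' := by
    simp only [current, hodge3, Finset.mul_sum, Finset.sum_mul]
    rw [sum_comm_four]
    refine Finset.sum_congr rfl fun a' _ => ?_
    rw [sum_comm_four]
    refine Finset.sum_congr rfl fun b' _ => ?_
    rw [sum_comm_four]
    refine Finset.sum_congr rfl fun c' _ => ?_
    refine Finset.sum_comm.trans (Finset.sum_congr rfl fun a _ => ?_)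
    refine Finset.sum_comm.trans (Finset.sum_congr rfl fun b _ => ?_)
    refine Finset.sum_comm.trans (Finset.sum_congr rfl fun c _ => ?_)
    refine Finset.sum_congr rfl fun m _ => ?_
    rw [metricInv_symm i m]
    ring
  have h2 : ∀ a b c, t a b c = (1 / 2) * ((∑ p, ∑ q, leviCivita p q b c * T a p q) +
      (∑ p, ∑ q, leviCivita p q c a * T b p q) + ∑ p, ∑ q, leviCivita p q a b * T c p q) := by
    intro a b c
    simp only [ht, extDeriv2, hH]
    ring
  have h3 := sum_leviCivita_mul_cyclic hTa i
  have h4 : ∀ a' b' c', ∑ a, ∑ b, ∑ c, ∑ m, leviCivita a b c m * (metricInv g e a a' x *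
        metricInv g e b b' x * metricInv g e c c' x * metricInv g e m i x) =
        ((metricMatrix g e x)⁻¹).det * leviCivita a' b' c' i := fun a' b' c' =>
    sum_leviCivita_mul_matrix (metricMatrix g e x)⁻¹ a' b' c' i
  rw [h1]
  simp only [h4, h2]
  have h5 : ∀ a b c, ((metricMatrix g e x)⁻¹).det * leviCivita a b c i * ((1 / 2) *
      ((∑ p, ∑ q, leviCivita p q b c * T a p q) +
      (∑ p, ∑ q, leviCivita p q c a * T b p q) + ∑ p, ∑ q, leviCivita p q a b * T c p q)) =
      (1 / 2 * ((metricMatrix g e x)⁻¹).det) * (leviCivita a b c i *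
      ((∑ p, ∑ q, leviCivita p q b c * T a p q) +
      (∑ p, ∑ q, leviCivita p q c a * T b p q) + ∑ p, ∑ q, leviCivita p q a b * T c p q)) :=
    fun a b c => by ring
  simp only [h5, ← Finset.mul_sum]
  rw [h3]
  ring

variable [IsManifold (𝓡 4) ∞ M]

/-- The divergence of a vector field in terms of the volume density. -/
theorem sum_pderiv_volDensity_mul (he : e ∈ charts M) (hU : IsOpen U) (hx : x ∈ e.source ∩ U)
    {X : VectorField M} (hX : SmoothOn X U) :
    ∑ a, pderiv e a (fun y => volDensity g e y * coordDiff e a y (X y)) x =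
      volDensity g e x * ∑ a, coordDiff e a x (nabla g e X x (coordVec e a x)) := by
  have hv := (smoothFunOn_volDensity g he).mdifferentiableAt e.open_source hx.1
  have hXd : ∀ a, MDifferentiableAt (𝓡 4) 𝓘(ℝ, ℝ) (fun y => coordDiff e a y (X y)) x := fun a =>
    (hX.coordDiff hU he a).mdifferentiableAt (e.open_source.inter hU) hx
  simp only [pderiv_mul he hx.1 hv (hXd _), pderiv_volDensity he hx.1,
    coordDiff_nabla he hx.1, coordDiff_coordVec he hx.1]
  simp only [ite_mul, one_mul, zero_mul, Finset.sum_ite_eq', Finset.mem_univ, if_true]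
  simp only [Finset.sum_add_distrib, mul_add, Finset.mul_sum, Finset.sum_mul]
  rw [add_comm]
  congr 1
  rw [Finset.sum_comm]
  refine Finset.sum_congr rfl fun a _ => Finset.sum_congr rfl fun m _ => ?_
  rw [christoffel_symm]
  ring

end Divergence

/-! ### Adapted charts -/

section AdaptedChart

variable {M : Type*} [TopologicalSpace M] [ChartedSpace (EuclideanSpace ℝ (Fin 4)) M]
  {g : LorentzMetric M} {e z : OpenPartialHomeomorph M (EuclideanSpace ℝ (Fin 4))} {x : M}
  {s l α n : VectorField M} {u : ℝ × ℝ → ℝ}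

/-- In an adapted chart the covectors `l♭` and `α♭` are combinations of the last two coordinate
differentials. -/
theorem IsAdaptedChart.wedge_eq (hz : IsAdaptedChart (spanField l s) z) (hx : x ∈ z.source)
    (ht : IsTetrad g x (s x) (l x) (α x) (n x)) (v w : TangentSpace (𝓡 4) x) :
    g.val x (α x) v * g.val x (l x) w - g.val x (α x) w * g.val x (l x) v =
      coeffDet g z α l x * (coordDiff z 2 x v * coordDiff z 3 x w -
        coordDiff z 2 x w * coordDiff z 3 x v) := by
  have h1 : ∀ i : Fin 4, i ≠ 2 → i ≠ 3 →
      g.val x (l x) (coordVec z i x) = 0 ∧ g.val x (α x) (coordVec z i x) = 0 := by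
    intro i h2 h3
    rw [← ht.mem_span_iff]
    refine (hz.2 x hx _).2 ⟨?_, ?_⟩
    · rw [coordDiff_coordVec hz.1 hx, if_neg h2.symm]
    · rw [coordDiff_coordVec hz.1 hx, if_neg h3.symm]
  have h0 := h1 0 (by decide) (by decide)
  have h1 := h1 1 (by decide) (by decide)
  have hα : ∀ v, g.val x (α x) v = g.val x (α x) (coordVec z 2 x) * coordDiff z 2 x v +
      g.val x (α x) (coordVec z 3 x) * coordDiff z 3 x v := fun v => by
    rw [← sum_val_mul_coordDiff hz.1 hx (α x) v, Fin.sum_univ_four, h0.2, h1.2]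
    ring
  have hl : ∀ v, g.val x (l x) v = g.val x (l x) (coordVec z 2 x) * coordDiff z 2 x v +
      g.val x (l x) (coordVec z 3 x) * coordDiff z 3 x v := fun v => by
    rw [← sum_val_mul_coordDiff hz.1 hx (l x) v, Fin.sum_univ_four, h0.1, h1.1]
    ring
  rw [hα v, hα w, hl v, hl w, coeffDet]
  ring

/-- Evaluating `α♭ ∧ l♭` on `(α, n)` yields `-1`, so the determinant `α₃ l₄ - α₄ l₃` is
invertible. -/
theorem IsAdaptedChart.coeffDet_mul_eq (hz : IsAdaptedChart (spanField l s) z) (hx : x ∈ z.source)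
    (ht : IsTetrad g x (s x) (l x) (α x) (n x)) :
    coeffDet g z α l x * (coordDiff z 2 x (α x) * coordDiff z 3 x (n x) -
      coordDiff z 2 x (n x) * coordDiff z 3 x (α x)) = -1 := by
  rw [← hz.wedge_eq hx ht, ht.αα, ht.ln, ht.αn, ht.lα]
  ring

theorem IsAdaptedChart.coeffDet_ne_zero (hz : IsAdaptedChart (spanField l s) z)
    (hx : x ∈ z.source) (ht : IsTetrad g x (s x) (l x) (α x) (n x)) : coeffDet g z α l x ≠ 0 := by
  intro h
  have h1 := hz.coeffDet_mul_eq hx ht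
  rw [h, zero_mul] at h1
  norm_num at h1

/-- The field `u κ α♭ ∧ l♭` is `u dz³ ∧ dz⁴`. -/
theorem IsAdaptedChart.nullField_apply (hz : IsAdaptedChart (spanField l s) z) (hx : x ∈ z.source)
    (ht : IsTetrad g x (s x) (l x) (α x) (n x)) (v w : TangentSpace (𝓡 4) x) :
    nullField g z u α l x v w = u (z x 2, z x 3) * (coordDiff z 2 x v * coordDiff z 3 x w -
        coordDiff z 2 x w * coordDiff z 3 x v) := by
  have h1 : nullField g z u α l x v w = u (z x 2, z x 3) * (coeffDet g z α l x)⁻¹ *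
      (g.val x (α x) v * g.val x (l x) w - g.val x (α x) w * g.val x (l x) v) := rfl
  rw [h1, hz.wedge_eq hx ht, ← mul_assoc, inv_mul_cancel_right₀ (hz.coeffDet_ne_zero hx ht)]

/-- The kernel of `u κ α♭ ∧ l♭` is the common kernel of `α♭` and `l♭`, that is `span (l, s)`. -/
theorem nullField_kernel_iff (hc : coeffDet g z α l x ≠ 0) (hu : u (z x 2, z x 3) ≠ 0)
    (ht : IsTetrad g x (s x) (l x) (α x) (n x)) (v : TangentSpace (𝓡 4) x) :
    (∀ w, nullField g z u α l x v w = 0) ↔ v ∈ spanField l s x := by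
  rw [spanField, ht.mem_span_iff]
  have h1 : ∀ w, nullField g z u α l x v w = u (z x 2, z x 3) * (coeffDet g z α l x)⁻¹ *
      (g.val x (α x) v * g.val x (l x) w - g.val x (α x) w * g.val x (l x) v) := fun w => rfl
  have h2 : u (z x 2, z x 3) * (coeffDet g z α l x)⁻¹ ≠ 0 := mul_ne_zero hu (inv_ne_zero hc)
  simp only [h1, mul_eq_zero, h2, false_or]
  constructor
  · intro h
    have hα := h (α x)
    have hn := h (n x)
    rw [ht.αα, ht.lα] at hα
    rw [ht.ln, ht.αn] at hn
    constructor <;> linarith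
  · rintro ⟨h3, h4⟩ w
    rw [h3, h4]
    ring

theorem smoothFunOn_lastCoords (hz : z ∈ charts M)
    (hu : ContDiffOn ℝ ∞ u ((fun y : EuclideanSpace ℝ (Fin 4) => (y 2, y 3)) '' z.target)) :
    SmoothFunOn (fun x => u (z x 2, z x 3)) z.source := by
  have h1 : ContDiff ℝ ∞ (fun y : EuclideanSpace ℝ (Fin 4) => (y 2, y 3)) := by fun_prop
  exact (hu.comp h1.contDiffOn fun y hy => mem_image_of_mem _ hy).contMDiffOn.comp
    (contMDiffOn_of_mem_maximalAtlas hz) fun x hx => z.map_source hx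

/-- The partial derivatives of a function of the last two coordinates of `z`. -/
theorem exists_pderiv_lastCoords (hz : z ∈ charts M) (he : e ∈ charts M)
    (hx : x ∈ e.source ∩ z.source)
    (hu : ContDiffOn ℝ ∞ u ((fun y : EuclideanSpace ℝ (Fin 4) => (y 2, y 3)) '' z.target)) :
    ∃ a b : ℝ, ∀ i, pderiv e i (fun x => u (z x 2, z x 3)) x =
      a * coordDiff z 2 x (coordVec e i x) + b * coordDiff z 3 x (coordVec e i x) := by
  set f : M → ℝ := fun x => u (z x 2, z x 3) with hf
  have hfd : MDifferentiableAt (𝓡 4) 𝓘(ℝ, ℝ) f x :=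
    (smoothFunOn_lastCoords hz hu).mdifferentiableAt z.open_source hx.2
  have h0 : ∀ i : Fin 4, i ≠ 2 → i ≠ 3 → pderiv z i f x = 0 := by
    intro i h2 h3
    have hd := (differentiableAt_comp_symm hz hx.2 hfd).hasFDerivAt
    have hline : HasDerivAt (fun t : ℝ => z x + t • EuclideanSpace.single i (1 : ℝ))
        (EuclideanSpace.single i 1) 0 := by
      simpa using ((hasDerivAt_id (0 : ℝ)).smul_const (EuclideanSpace.single i (1 : ℝ))).const_add
        (z x)
    have hd' : HasFDerivAt (fun y => f (z.symm y)) (fderiv ℝ (fun y => f (z.symm y)) (z x))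
        (z x + (0 : ℝ) • EuclideanSpace.single i (1 : ℝ)) := by simpa using hd
    have h4 := hd'.comp_hasDerivAt (0 : ℝ) hline
    have h5 : ((fun y => f (z.symm y)) ∘ fun t : ℝ => z x + t • EuclideanSpace.single i (1 : ℝ))
        =ᶠ[𝓝 0] fun _ => f x := by
      have h6 : Tendsto (fun t : ℝ => z x + t • EuclideanSpace.single i (1 : ℝ)) (𝓝 0)
          (𝓝 (z x)) := by
        have := hline.continuousAt
        rw [ContinuousAt] at this
        simpa using this
      filter_upwards [h6 (z.open_target.mem_nhds (z.map_source hx.2))] with t ht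
      have ht' : z x + t • EuclideanSpace.single i (1 : ℝ) ∈ z.target := ht
      simp [hf, z.right_inv ht', h2.symm, h3.symm]
    exact h4.unique ((hasDerivAt_const (0 : ℝ) (f x)).congr_of_eventuallyEq h5)
  refine ⟨pderiv z 2 f x, pderiv z 3 f x, fun i => ?_⟩
  have h1 : pderiv e i f x = ∑ k, coordDiff z k x (coordVec e i x) * pderiv z k f x :=
    (pderiv_eq_mfderiv he hx.1 hfd i).trans (mfderiv_eq_sum hz hx.2 hfd _)
  rw [h1, Fin.sum_univ_four, h0 0 (by decide) (by decide), h0 1 (by decide) (by decide)]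
  ring

variable [IsManifold (𝓡 4) ∞ M]

/-- The bracket of vector fields as commutator of derivations, applied to a coordinate function of
a second chart. -/
theorem coordDiff_bracket (hz : z ∈ charts M) (he : e ∈ charts M) (hx : x ∈ e.source ∩ z.source)
    {X Y : VectorField M} (hX : SmoothOn X z.source) (hY : SmoothOn Y z.source) (k : Fin 4) :
    coordDiff z k x (bracket e X Y x) =
      (∑ i, coordDiff e i x (X x) * pderiv e i (fun y => coordDiff z k y (Y y)) x) -
        ∑ i, coordDiff e i x (Y x) * pderiv e i (fun y => coordDiff z k y (X y)) x := by
  have hζ := smoothFunOn_coord hz k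
  have hN := e.open_source.inter z.open_source
  have hsum : ∀ y ∈ e.source ∩ z.source, ∀ v : TangentSpace (𝓡 4) y, coordDiff z k y v =
      ∑ j, coordDiff e j y v * pderiv e j (fun x => z x k) y := fun y hy v =>
    mfderiv_eq_sum he hy.1 (hζ.mdifferentiableAt z.open_source hy.2) v
  have hder : ∀ {Z : VectorField M}, SmoothOn Z z.source → ∀ i,
      pderiv e i (fun y => coordDiff z k y (Z y)) x =
        ∑ j, (pderiv e i (fun y => coordDiff e j y (Z y)) x * pderiv e j (fun x => z x k) x +
          coordDiff e j x (Z x) * pderiv e i (pderiv e j (fun x => z x k)) x) := by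
    intro Z hZ i
    have h1 : (fun y => coordDiff z k y (Z y)) =ᶠ[𝓝 x]
        fun y => ∑ j, coordDiff e j y (Z y) * pderiv e j (fun x => z x k) y := by
      filter_upwards [hN.mem_nhds hx] with y hy using hsum y hy (Z y)
    have hZd : ∀ j, MDifferentiableAt (𝓡 4) 𝓘(ℝ, ℝ) (fun y => coordDiff e j y (Z y)) x := fun j =>
      (hZ.coordDiff z.open_source he j).mdifferentiableAt hN hx
    have hζd : ∀ j, MDifferentiableAt (𝓡 4) 𝓘(ℝ, ℝ) (pderiv e j fun x => z x k) x := fun j =>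
      (smoothFunOn_pderiv he z.open_source hζ j).mdifferentiableAt hN hx
    have hd : ∀ j, MDifferentiableAt (𝓡 4) 𝓘(ℝ, ℝ)
        (fun y => coordDiff e j y (Z y) * pderiv e j (fun x => z x k) y) x := fun j =>
      (hZd j).mul (hζd j)
    rw [pderiv_congr hx.1 h1, pderiv_sum he hx.1 fun j _ => hd j]
    exact Finset.sum_congr rfl fun j _ => pderiv_mul he hx.1 (hZd j) (hζd j) i
  simp only [hder hX, hder hY, hsum x hx, bracket, map_sum, map_smul, smul_eq_mul,
    coordDiff_coordVec he hx.1, mul_ite, mul_one, mul_zero, Finset.sum_ite_eq, Finset.mem_univ,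
    if_true, mul_add, Finset.mul_sum, Finset.sum_mul, Finset.sum_add_distrib]
  have h2 : ∑ i, ∑ j, coordDiff e i x (Y x) *
        (coordDiff e j x (X x) * pderiv e i (pderiv e j fun x => z x k) x) =
      ∑ i, ∑ j, coordDiff e i x (X x) *
        (coordDiff e j x (Y x) * pderiv e i (pderiv e j fun x => z x k) x) := by
    rw [Finset.sum_comm]
    refine Finset.sum_congr rfl fun i _ => Finset.sum_congr rfl fun j _ => ?_
    rw [pderiv_comm he z.open_source hx hζ j i]
    ring
  rw [h2, add_sub_add_right_eq_sub]
  rw [Finset.sum_comm (f := fun i j => coordDiff e i x (X x) * _),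
    Finset.sum_comm (f := fun i j => coordDiff e i x (Y x) * _), ← Finset.sum_sub_distrib]
  refine Finset.sum_congr rfl fun j _ => ?_
  rw [← Finset.sum_sub_distrib]
  refine Finset.sum_congr rfl fun i _ => ?_
  ring

end AdaptedChart

/-! ### The closed two-form of an adapted chart -/

section ForceFree

variable {M : Type*} [TopologicalSpace M] [ChartedSpace (EuclideanSpace ℝ (Fin 4)) M]
  [IsManifold (𝓡 4) ∞ M]
  {g : LorentzMetric M} {e z : OpenPartialHomeomorph M (EuclideanSpace ℝ (Fin 4))} {x : M}
  {s l α n : VectorField M} {u : ℝ × ℝ → ℝ}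

theorem smoothFunOn_coordDiff_coordVec (hz : z ∈ charts M) (he : e ∈ charts M) (k i : Fin 4) :
    SmoothFunOn (fun x => coordDiff z k x (coordVec e i x)) (e.source ∩ z.source) :=
  ContMDiffOn.mono ((smoothOn_coordVec he i).coordDiff e.open_source hz k)
    fun _ hx => ⟨hx.2, hx.1⟩

omit [IsManifold (𝓡 4) ∞ M] in
/-- The coordinate differentials of `z` are closed. -/
theorem pderiv_coordDiff_coordVec (hz : z ∈ charts M) (he : e ∈ charts M)
    (hx : x ∈ e.source ∩ z.source) (k i j : Fin 4) :
    pderiv e i (fun y => coordDiff z k y (coordVec e j y)) x =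
      pderiv e j (fun y => coordDiff z k y (coordVec e i y)) x := by
  have hζ := smoothFunOn_coord hz k
  have hN := e.open_source.inter z.open_source
  have h1 : ∀ j, (fun y => coordDiff z k y (coordVec e j y)) =ᶠ[𝓝 x]
      pderiv e j fun y => z y k := by
    intro j
    filter_upwards [hN.mem_nhds hx] with y hy
    exact (pderiv_eq_mfderiv he hy.1 (hζ.mdifferentiableAt z.open_source hy.2) j).symm
  rw [pderiv_congr hx.1 (h1 j), pderiv_congr hx.1 (h1 i), pderiv_comm he z.open_source hx hζ]

theorem smoothBilinOn_nullField (hz : IsAdaptedChart (spanField l s) z)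
    (ht : ∀ y ∈ z.source, IsTetrad g y (s y) (l y) (α y) (n y))
    (hu : ContDiffOn ℝ ∞ u ((fun y : EuclideanSpace ℝ (Fin 4) => (y 2, y 3)) '' z.target)) :
    SmoothBilinOn (nullField g z u α l) z.source := by
  intro e he i j
  have hd := smoothFunOn_coordDiff_coordVec hz.1 he
  have h1 : SmoothFunOn (fun x => u (z x 2, z x 3) *
      (coordDiff z 2 x (coordVec e i x) * coordDiff z 3 x (coordVec e j x) -
        coordDiff z 2 x (coordVec e j x) * coordDiff z 3 x (coordVec e i x)))
      (e.source ∩ z.source) :=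
    ContMDiffOn.mul ((smoothFunOn_lastCoords hz.1 hu).mono inter_subset_right)
      (ContMDiffOn.sub (ContMDiffOn.mul (hd 2 i) (hd 3 j)) (ContMDiffOn.mul (hd 2 j) (hd 3 i)))
  exact h1.congr fun y hy => hz.nullField_apply hy.2 (ht y hy.2) _ _

/-- The two-form `u(z³, z⁴) dz³ ∧ dz⁴` is closed. -/
theorem extDeriv2_nullField (hz : IsAdaptedChart (spanField l s) z)
    (ht : ∀ y ∈ z.source, IsTetrad g y (s y) (l y) (α y) (n y))
    (hu : ContDiffOn ℝ ∞ u ((fun y : EuclideanSpace ℝ (Fin 4) => (y 2, y 3)) '' z.target))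
    (he : e ∈ charts M) (hx : x ∈ e.source ∩ z.source) (i j k : Fin 4) :
    extDeriv2 e (comp e (nullField g z u α l)) i j k x = 0 := by
  have hN := e.open_source.inter z.open_source
  set a : Fin 4 → M → ℝ := fun i y => coordDiff z 2 y (coordVec e i y) with ha
  set b : Fin 4 → M → ℝ := fun i y => coordDiff z 3 y (coordVec e i y) with hb
  have had : ∀ i, MDifferentiableAt (𝓡 4) 𝓘(ℝ, ℝ) (a i) x := fun i =>
    (smoothFunOn_coordDiff_coordVec hz.1 he 2 i).mdifferentiableAt hN hx
  have hbd : ∀ i, MDifferentiableAt (𝓡 4) 𝓘(ℝ, ℝ) (b i) x := fun i =>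
    (smoothFunOn_coordDiff_coordVec hz.1 he 3 i).mdifferentiableAt hN hx
  have hud : MDifferentiableAt (𝓡 4) 𝓘(ℝ, ℝ) (fun x => u (z x 2, z x 3)) x :=
    (smoothFunOn_lastCoords hz.1 hu).mdifferentiableAt z.open_source hx.2
  obtain ⟨c, d, hcd⟩ := exists_pderiv_lastCoords hz.1 he hx hu
  have hF : ∀ i j k, pderiv e i (comp e (nullField g z u α l) j k) x =
      (c * a i x + d * b i x) * (a j x * b k x - a k x * b j x) + u (z x 2, z x 3) *
        (pderiv e i (a j) x * b k x + a j x * pderiv e i (b k) x -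
          (pderiv e i (a k) x * b j x + a k x * pderiv e i (b j) x)) := by
    intro i j k
    have h1 : comp e (nullField g z u α l) j k =ᶠ[𝓝 x] fun y => u (z y 2, z y 3) *
        (a j y * b k y - a k y * b j y) := by
      filter_upwards [hN.mem_nhds hx] with y hy using hz.nullField_apply hy.2 (ht y hy.2) _ _
    have hd1 : ∀ j k, MDifferentiableAt (𝓡 4) 𝓘(ℝ, ℝ) (fun y => a j y * b k y) x := fun j k =>
      (had j).mul (hbd k)
    have hd2 : MDifferentiableAt (𝓡 4) 𝓘(ℝ, ℝ) (fun y => a j y * b k y - a k y * b j y) x :=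
      (hd1 j k).sub (hd1 k j)
    rw [pderiv_congr hx.1 h1, pderiv_mul he hx.1 hud hd2, pderiv_sub he hx.1 (hd1 j k) (hd1 k j),
      pderiv_mul he hx.1 (had j) (hbd k), pderiv_mul he hx.1 (had k) (hbd j), hcd i]
  have hasym : ∀ i j, pderiv e i (a j) x = pderiv e j (a i) x :=
    pderiv_coordDiff_coordVec hz.1 he hx 2
  have hbsym : ∀ i j, pderiv e i (b j) x = pderiv e j (b i) x :=
    pderiv_coordDiff_coordVec hz.1 he hx 3
  rw [extDeriv2, hF, hF, hF, hasym j i, hasym k i, hasym k j, hbsym j i, hbsym k i, hbsym k j]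
  ring

/-- The coefficient `φ` in `F = φ α♭ ∧ l♭`. -/
theorem smoothFunOn_coefficient (hz : IsAdaptedChart (spanField l s) z)
    (ht : ∀ y ∈ z.source, IsTetrad g y (s y) (l y) (α y) (n y)) (hl : SmoothOn l z.source)
    (hα : SmoothOn α z.source)
    (hu : ContDiffOn ℝ ∞ u ((fun y : EuclideanSpace ℝ (Fin 4) => (y 2, y 3)) '' z.target)) :
    SmoothFunOn (fun x => u (z x 2, z x 3) * (coeffDet g z α l x)⁻¹) z.source := by
  refine ContMDiffOn.mul (smoothFunOn_lastCoords hz.1 hu)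
    (ContMDiffOn.inv₀ ?_ fun x hx => hz.coeffDet_ne_zero hx (ht x hx))
  have h1 : ∀ {X : VectorField M}, SmoothOn X z.source → ∀ i,
      SmoothFunOn (fun x => g.val x (X x) (coordVec z i x)) z.source := fun hX i =>
    smoothFunOn_val g z.open_source hX (smoothOn_coordVec hz.1 i)
  exact ContMDiffOn.sub (ContMDiffOn.mul (h1 hα 2) (h1 hl 3))
    (ContMDiffOn.mul (h1 hα 3) (h1 hl 2))

omit [IsManifold (𝓡 4) ∞ M] in
/-- Raising the indices of `F = φ α♭ ∧ l♭` gives the bivector `φ α ∧ l`. -/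
theorem raise2_nullField (he : e ∈ charts M) (hx : x ∈ e.source) (a b : Fin 4) :
    raise2 g e (comp e (nullField g z u α l)) a b x =
      u (z x 2, z x 3) * (coeffDet g z α l x)⁻¹ *
        (coordDiff e a x (α x) * coordDiff e b x (l x) -
          coordDiff e b x (α x) * coordDiff e a x (l x)) := by
  have h1 : ∀ c d, comp e (nullField g z u α l) c d x =
      u (z x 2, z x 3) * (coeffDet g z α l x)⁻¹ *
      (g.val x (α x) (coordVec e c x) * g.val x (l x) (coordVec e d x) -
        g.val x (α x) (coordVec e d x) * g.val x (l x) (coordVec e c x)) := fun c d => rfl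
  have h2 : ∀ v w : TangentSpace (𝓡 4) x, ∑ c, ∑ d, metricInv g e a c x * metricInv g e b d x *
      (g.val x v (coordVec e c x) * g.val x w (coordVec e d x)) =
      coordDiff e a x v * coordDiff e b x w := by
    intro v w
    rw [← sum_metricInv_mul_val (g := g) he hx v a, ← sum_metricInv_mul_val (g := g) he hx w b,
      Finset.sum_mul_sum]
    refine Finset.sum_congr rfl fun c _ => Finset.sum_congr rfl fun d _ => ?_
    ring
  rw [mul_comm (coordDiff e b x (α x)), ← h2, ← h2, ← Finset.sum_sub_distrib, Finset.mul_sum]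
  refine Finset.sum_congr rfl fun c _ => ?_
  rw [← Finset.sum_sub_distrib, Finset.mul_sum]
  refine Finset.sum_congr rfl fun d _ => ?_
  rw [h1]
  ring

omit [IsManifold (𝓡 4) ∞ M] in
/-- `F` is null because `l` is null and orthogonal to `α`. -/
theorem sum_nullField_mul_raise2 (he : e ∈ charts M) (hx : x ∈ e.source)
    (ht : IsTetrad g x (s x) (l x) (α x) (n x)) :
    ∑ a, ∑ b, comp e (nullField g z u α l) a b x *
      raise2 g e (comp e (nullField g z u α l)) a b x = 0 := by
  have h1 : ∀ c d, comp e (nullField g z u α l) c d x =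
      u (z x 2, z x 3) * (coeffDet g z α l x)⁻¹ *
      (g.val x (α x) (coordVec e c x) * g.val x (l x) (coordVec e d x) -
        g.val x (α x) (coordVec e d x) * g.val x (l x) (coordVec e c x)) := fun c d => rfl
  set φ := u (z x 2, z x 3) * (coeffDet g z α l x)⁻¹ with hφ
  have h3 : ∀ a b, comp e (nullField g z u α l) a b x *
      raise2 g e (comp e (nullField g z u α l)) a b x = φ ^ 2 *
      (g.val x (α x) (coordVec e a x) * coordDiff e a x (α x) *
          (g.val x (l x) (coordVec e b x) * coordDiff e b x (l x)) -
        g.val x (α x) (coordVec e a x) * coordDiff e a x (l x) *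
          (g.val x (l x) (coordVec e b x) * coordDiff e b x (α x)) -
        g.val x (l x) (coordVec e a x) * coordDiff e a x (α x) *
          (g.val x (α x) (coordVec e b x) * coordDiff e b x (l x)) +
        g.val x (l x) (coordVec e a x) * coordDiff e a x (l x) *
          (g.val x (α x) (coordVec e b x) * coordDiff e b x (α x))) := by
    intro a b
    rw [raise2_nullField he hx, h1]
    ring
  simp only [h3, ← Finset.mul_sum, ← Finset.sum_mul, Finset.sum_add_distrib,
    Finset.sum_sub_distrib, sum_val_mul_coordDiff he hx, ht.ll, ht.αl]
  ring

end ForceFree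

/-! ### The force-free condition -/

section Current

variable {M : Type*} [TopologicalSpace M] [ChartedSpace (EuclideanSpace ℝ (Fin 4)) M]
  [IsManifold (𝓡 4) ∞ M]
  {g : LorentzMetric M} {e z : OpenPartialHomeomorph M (EuclideanSpace ℝ (Fin 4))} {x : M}
  {s l α n : VectorField M} {u : ℝ × ℝ → ℝ}

/-- The transport equation of the coefficient `φ` of `F = φ α♭ ∧ l♭` along `l`, a consequence of
the invariance of `u dz³ ∧ dz⁴` under the flow of `l`. -/
theorem sum_coordDiff_mul_pderiv_coefficient (hz : IsAdaptedChart (spanField l s) z)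
    (ht : ∀ y ∈ z.source, IsTetrad g y (s y) (l y) (α y) (n y)) (hl : SmoothOn l z.source)
    (hα : SmoothOn α z.source) (hn : SmoothOn n z.source)
    (hu : ContDiffOn ℝ ∞ u ((fun y : EuclideanSpace ℝ (Fin 4) => (y 2, y 3)) '' z.target))
    (he : e ∈ charts M) (hx : x ∈ e.source ∩ z.source) :
    ∑ i, coordDiff e i x (l x) *
        pderiv e i (fun x => u (z x 2, z x 3) * (coeffDet g z α l x)⁻¹) x =
      u (z x 2, z x 3) * (coeffDet g z α l x)⁻¹ *
        (g.val x (α x) (bracket e l α x) - g.val x (l x) (bracket e l n x)) := by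
  have hN := e.open_source.inter z.open_source
  have hlz : ∀ y ∈ z.source, coordDiff z 2 y (l y) = 0 ∧ coordDiff z 3 y (l y) = 0 :=
    fun y hy => (hz.2 y hy _).1 (Submodule.subset_span (by simp))
  have hlp : ∀ k : Fin 4, (∀ y ∈ z.source, coordDiff z k y (l y) = 0) → ∀ i,
      pderiv e i (fun y => coordDiff z k y (l y)) x = 0 := by
    intro k hk i
    rw [pderiv_congr hx.1 (h := fun _ => 0), pderiv_const]
    filter_upwards [z.open_source.mem_nhds hx.2] with y hy using hk y hy
  have hlp2 := hlp 2 fun y hy => (hlz y hy).1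
  have hlp3 := hlp 3 fun y hy => (hlz y hy).2
  have hD : ∀ {X : VectorField M}, SmoothOn X z.source → ∀ k, MDifferentiableAt (𝓡 4) 𝓘(ℝ, ℝ)
      (fun y => coordDiff z k y (X y)) x := fun hX k =>
    (hX.coordDiff z.open_source hz.1 k).mdifferentiableAt (z.open_source.inter z.open_source)
      ⟨hx.2, hx.2⟩
  -- the derivatives along `l` of the components of `X` transverse to the foliation
  have hbr : ∀ {X : VectorField M}, SmoothOn X z.source → ∀ k : Fin 4,
      (∀ i, pderiv e i (fun y => coordDiff z k y (l y)) x = 0) →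
      ∑ i, coordDiff e i x (l x) * pderiv e i (fun y => coordDiff z k y (X y)) x =
        coordDiff z k x (bracket e l X x) := by
    intro X hX k hk
    rw [coordDiff_bracket hz.1 he hx hl hX]
    simp [hk]
  set U : M → ℝ := fun x => u (z x 2, z x 3) with hU
  have hUd : MDifferentiableAt (𝓡 4) 𝓘(ℝ, ℝ) U x :=
    (smoothFunOn_lastCoords hz.1 hu).mdifferentiableAt z.open_source hx.2
  have hlU : ∑ i, coordDiff e i x (l x) * pderiv e i U x = 0 := by
    obtain ⟨a, b, hab⟩ := exists_pderiv_lastCoords hz.1 he hx hu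
    have h1 : ∀ k, coordDiff z k x (l x) =
        ∑ i, coordDiff e i x (l x) * coordDiff z k x (coordVec e i x) := by
      intro k
      conv_lhs => rw [← sum_coordDiff_smul_coordVec he hx.1 (l x), map_sum]
      simp only [map_smul, smul_eq_mul]
    have h2 : ∑ i, coordDiff e i x (l x) * pderiv e i U x =
        a * coordDiff z 2 x (l x) + b * coordDiff z 3 x (l x) := by
      rw [h1 2, h1 3, Finset.mul_sum, Finset.mul_sum, ← Finset.sum_add_distrib]
      refine Finset.sum_congr rfl fun i _ => ?_
      rw [hab i]
      ring
    rw [h2, (hlz x hx.2).1, (hlz x hx.2).2]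
    ring
  -- by `coeffDet_mul_eq`, the inverse of the determinant is a polynomial in the components
  have hco : ∀ y ∈ z.source, (coeffDet g z α l y)⁻¹ =
      coordDiff z 2 y (n y) * coordDiff z 3 y (α y) -
        coordDiff z 2 y (α y) * coordDiff z 3 y (n y) := by
    intro y hy
    have h1 := hz.coeffDet_mul_eq hy (ht y hy)
    have h2 := hz.coeffDet_ne_zero hy (ht y hy)
    rw [inv_eq_iff_eq_inv, eq_comm, inv_eq_iff_eq_inv, eq_comm]
    field_simp
    linarith
  have hpd : ∀ i, pderiv e i (fun x => U x * (coeffDet g z α l x)⁻¹) x =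
      pderiv e i U x * (coeffDet g z α l x)⁻¹ + U x *
        ((pderiv e i (fun y => coordDiff z 2 y (n y)) x * coordDiff z 3 x (α x) +
          coordDiff z 2 x (n x) * pderiv e i (fun y => coordDiff z 3 y (α y)) x) -
        (pderiv e i (fun y => coordDiff z 2 y (α y)) x * coordDiff z 3 x (n x) +
          coordDiff z 2 x (α x) * pderiv e i (fun y => coordDiff z 3 y (n y)) x)) := by
    intro i
    have h1 : (fun x => U x * (coeffDet g z α l x)⁻¹) =ᶠ[𝓝 x] fun y => U y *
        (coordDiff z 2 y (n y) * coordDiff z 3 y (α y) -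
          coordDiff z 2 y (α y) * coordDiff z 3 y (n y)) := by
      filter_upwards [z.open_source.mem_nhds hx.2] with y hy
      rw [hco y hy]
    have hd1 : MDifferentiableAt (𝓡 4) 𝓘(ℝ, ℝ)
        (fun y => coordDiff z 2 y (n y) * coordDiff z 3 y (α y)) x := (hD hn 2).mul (hD hα 3)
    have hd2 : MDifferentiableAt (𝓡 4) 𝓘(ℝ, ℝ)
        (fun y => coordDiff z 2 y (α y) * coordDiff z 3 y (n y)) x := (hD hα 2).mul (hD hn 3)
    have hd3 : MDifferentiableAt (𝓡 4) 𝓘(ℝ, ℝ)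
        (fun y => coordDiff z 2 y (n y) * coordDiff z 3 y (α y) -
          coordDiff z 2 y (α y) * coordDiff z 3 y (n y)) x := hd1.sub hd2
    rw [pderiv_congr hx.1 h1, pderiv_mul he hx.1 hUd hd3, pderiv_sub he hx.1 hd1 hd2,
      pderiv_mul he hx.1 (hD hn 2) (hD hα 3), pderiv_mul he hx.1 (hD hα 2) (hD hn 3),
      hco x hx.2]
  have hα2 := hbr hα 2 hlp2
  have hα3 := hbr hα 3 hlp3
  have hn2 := hbr hn 2 hlp2
  have hn3 := hbr hn 3 hlp3
  have htx := ht x hx.2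
  have hw1 := hz.wedge_eq hx.2 htx (bracket e l α x) (n x)
  have hw2 := hz.wedge_eq hx.2 htx (α x) (bracket e l n x)
  rw [htx.ln, htx.αn] at hw1
  rw [htx.αα, htx.lα] at hw2
  have hc := hz.coeffDet_ne_zero hx.2 htx
  have hsum : ∑ i, coordDiff e i x (l x) *
      pderiv e i (fun x => U x * (coeffDet g z α l x)⁻¹) x =
      (coeffDet g z α l x)⁻¹ * 0 + U x *
        ((coordDiff z 2 x (bracket e l n x) * coordDiff z 3 x (α x) +
          coordDiff z 2 x (n x) * coordDiff z 3 x (bracket e l α x)) -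
        (coordDiff z 2 x (bracket e l α x) * coordDiff z 3 x (n x) +
          coordDiff z 2 x (α x) * coordDiff z 3 x (bracket e l n x))) := by
    rw [← hlU, ← hα2, ← hα3, ← hn2, ← hn3]
    simp only [Finset.mul_sum, Finset.sum_mul, ← Finset.sum_add_distrib, ← Finset.sum_sub_distrib]
    refine Finset.sum_congr rfl fun i _ => ?_
    rw [hpd i]
    ring
  rw [hsum]
  field_simp
  linear_combination U x * hw1 + U x * hw2

/-- The contraction of the divergence of `φ α ∧ l` with a covector. -/
theorem sum_val_mul_pderiv_wedge (he : e ∈ charts M) {V : Set M} (hV : IsOpen V)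
    (hx : x ∈ e.source ∩ V) {φ : M → ℝ} (hφ : SmoothFunOn φ V) (hα : SmoothOn α V)
    (hl : SmoothOn l V) (w : TangentSpace (𝓡 4) x) :
    ∑ i, g.val x w (coordVec e i x) * ∑ a, pderiv e a (fun y => volDensity g e y * (φ y *
        (coordDiff e a y (α y) * coordDiff e i y (l y) -
          coordDiff e i y (α y) * coordDiff e a y (l y)))) x =
      volDensity g e x *
        ((∑ a, coordDiff e a x (nabla g e (fun y => φ y • α y) x (coordVec e a x))) *
            g.val x w (l x) -
          (∑ a, coordDiff e a x (nabla g e (fun y => φ y • l y) x (coordVec e a x))) *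
            g.val x w (α x) +
          φ x * g.val x w (bracket e α l x)) := by
  have hN := e.open_source.inter hV
  have hD : ∀ {X : VectorField M}, SmoothOn X V → ∀ k, MDifferentiableAt (𝓡 4) 𝓘(ℝ, ℝ)
      (fun y => coordDiff e k y (X y)) x := fun hX k =>
    (hX.coordDiff hV he k).mdifferentiableAt hN hx
  have hv : MDifferentiableAt (𝓡 4) 𝓘(ℝ, ℝ) (volDensity g e) x :=
    (smoothFunOn_volDensity g he).mdifferentiableAt e.open_source hx.1
  have hφα : SmoothOn (fun y => φ y • α y) V := .smul hφ hα
  have hφl : SmoothOn (fun y => φ y • l y) V := .smul hφ hl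
  rw [mul_add, mul_sub, ← mul_assoc, ← mul_assoc, ← sum_pderiv_volDensity_mul he hV hx hφα,
    ← sum_pderiv_volDensity_mul he hV hx hφl, ← sum_val_mul_coordDiff he hx.1 w (l x),
    ← sum_val_mul_coordDiff he hx.1 w (α x),
    ← sum_val_mul_coordDiff he hx.1 w (bracket e α l x)]
  have hd1 : ∀ {X : VectorField M}, SmoothOn X V → ∀ k, MDifferentiableAt (𝓡 4) 𝓘(ℝ, ℝ)
      (fun y => volDensity g e y * coordDiff e k y (φ y • X y)) x := fun hX k =>
    hv.mul (hD (.smul hφ hX) k)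
  have hpd : ∀ i a, pderiv e a (fun y => volDensity g e y * (φ y *
        (coordDiff e a y (α y) * coordDiff e i y (l y) -
          coordDiff e i y (α y) * coordDiff e a y (l y)))) x =
      (pderiv e a (fun y => volDensity g e y * coordDiff e a y (φ y • α y)) x *
          coordDiff e i x (l x) + volDensity g e x * (φ x * coordDiff e a x (α x)) *
            pderiv e a (fun y => coordDiff e i y (l y)) x) -
        (pderiv e a (fun y => volDensity g e y * coordDiff e a y (φ y • l y)) x *
          coordDiff e i x (α x) + volDensity g e x * (φ x * coordDiff e a x (l x)) *
            pderiv e a (fun y => coordDiff e i y (α y)) x) := by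
    intro i a
    have h1 : (fun y => volDensity g e y * (φ y *
        (coordDiff e a y (α y) * coordDiff e i y (l y) -
          coordDiff e i y (α y) * coordDiff e a y (l y)))) = fun y =>
        volDensity g e y * coordDiff e a y (φ y • α y) * coordDiff e i y (l y) -
          volDensity g e y * coordDiff e a y (φ y • l y) * coordDiff e i y (α y) := by
      funext y
      simp only [map_smul, smul_eq_mul]
      ring
    have hp1 : MDifferentiableAt (𝓡 4) 𝓘(ℝ, ℝ) (fun y =>
        volDensity g e y * coordDiff e a y (φ y • α y) * coordDiff e i y (l y)) x :=
      (hd1 hα a).mul (hD hl i)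
    have hp2 : MDifferentiableAt (𝓡 4) 𝓘(ℝ, ℝ) (fun y =>
        volDensity g e y * coordDiff e a y (φ y • l y) * coordDiff e i y (α y)) x :=
      (hd1 hl a).mul (hD hα i)
    rw [h1, pderiv_sub he hx.1 hp1 hp2, pderiv_mul he hx.1 (hd1 hα a) (hD hl i),
      pderiv_mul he hx.1 (hd1 hl a) (hD hα i)]
    simp only [map_smul, smul_eq_mul]
  have hb : ∀ i, coordDiff e i x (bracket e α l x) =
      ∑ a, (coordDiff e a x (α x) * pderiv e a (fun y => coordDiff e i y (l y)) x -
        coordDiff e a x (l x) * pderiv e a (fun y => coordDiff e i y (α y)) x) := by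
    intro i
    simp [bracket, coordDiff_coordVec he hx.1]
  simp only [hb]
  rw [Finset.mul_sum, Finset.mul_sum, Finset.mul_sum, Finset.mul_sum, ← Finset.sum_sub_distrib,
    ← Finset.sum_add_distrib]
  refine Finset.sum_congr rfl fun i _ => ?_
  simp only [hpd, Finset.mul_sum, Finset.sum_mul, ← Finset.sum_add_distrib,
    ← Finset.sum_sub_distrib]
  refine Finset.sum_congr rfl fun a _ => ?_
  ring

omit [IsManifold (𝓡 4) ∞ M] in
theorem bracket_swap (X Y : VectorField M) : bracket e X Y x = -bracket e Y X x := by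
  rw [bracket, bracket, ← Finset.sum_neg_distrib]
  refine Finset.sum_congr rfl fun k _ => ?_
  rw [← neg_smul, ← Finset.sum_neg_distrib]
  congr 1
  refine Finset.sum_congr rfl fun i _ => ?_
  ring

/-- For a null geodesic field with equipartition, the divergence of the closed field
`F = φ α♭ ∧ l♭` is annihilated by `l♭` and by `α♭`: the former because `[l, α]` is orthogonal to
`l`, the latter because the two transverse contributions to the expansion of `l` are equal. -/
theorem nullField_forceFree (hz : IsAdaptedChart (spanField l s) z)
    (hl : IsNullGeodesicOn g l z.source) (hα : SmoothOn α z.source) (hn : SmoothOn n z.source)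
    (ht : ∀ y ∈ z.source, IsTetrad g y (s y) (l y) (α y) (n y))
    (hu : ContDiffOn ℝ ∞ u ((fun y : EuclideanSpace ℝ (Fin 4) => (y 2, y 3)) '' z.target))
    (he : e ∈ charts M) (hx : x ∈ e.source ∩ z.source)
    (heq : Equipartition g e l x (s x) (α x)) (k : Fin 4) :
    ∑ i, (∑ m, metricInv g e i m x * current g e (nullField g z u α l) m x) *
      comp e (nullField g z u α l) i k x = 0 := by
  have hN := e.open_source.inter z.open_source
  have htx := ht x hx.2
  have hV := z.open_source
  set φ : M → ℝ := fun x => u (z x 2, z x 3) * (coeffDet g z α l x)⁻¹ with hφ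
  have hφs : SmoothFunOn φ z.source := smoothFunOn_coefficient hz ht hl.smooth hα hu
  set f : Fin 4 → Fin 4 → M → ℝ := fun a b y => φ y *
    (coordDiff e a y (α y) * coordDiff e b y (l y) -
      coordDiff e b y (α y) * coordDiff e a y (l y)) with hf
  have hfs : ∀ a b, SmoothFunOn (f a b) (e.source ∩ z.source) := by
    intro a b
    have hcα := hα.coordDiff hV he
    have hcl := hl.smooth.coordDiff hV he
    exact ContMDiffOn.mul (ContMDiffOn.mono hφs inter_subset_right)
      (ContMDiffOn.sub (ContMDiffOn.mul (hcα a) (hcl b)) (ContMDiffOn.mul (hcα b) (hcl a)))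
  have hJ := sum_metricInv_mul_current he hV hx hfs (fun a b y => by simp only [hf]; ring)
    (F := nullField g z u α l) (g := g) fun y hy a b => raise2_nullField he hy.1 a b
  obtain ⟨c, hc⟩ := hl.geodesic e he x hx
  -- the products of the tetrad with the derivatives of `l`
  have hlc : ∀ v, g.val x (nabla g e l x v) (l x) = 0 := by
    intro v
    have h1 := val_nabla_add_eq_zero he hV hx hl.smooth hl.smooth hl.null v
    rw [g.symm x (l x)] at h1
    linarith
  have hbl : g.val x (l x) (bracket e α l x) = 0 := by
    rw [bracket_swap, map_neg, g.symm, val_bracket_null he hV hx hl hα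
      (fun y hy => (ht y hy).αl), neg_zero]
  have hbα : g.val x (α x) (bracket e α l x) = g.val x (nabla g e l x (α x)) (α x) := by
    have h1 := val_nabla_add_eq_zero he hV hx hα hα (fun y hy => (ht y hy).αα) (l x)
    rw [g.symm x (α x)] at h1
    rw [← nabla_sub_nabla (g := g), map_sub, g.symm x (α x), g.symm x (α x)]
    linarith
  have hbn : g.val x (l x) (bracket e l n x) = c := by
    have h1 := val_nabla_add_eq_zero he hV hx hl.smooth hn (fun y hy => (ht y hy).ln) (l x)
    rw [hc, map_smul, LinearMap.smul_apply, htx.ln, smul_eq_mul] at h1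
    rw [← nabla_sub_nabla (g := g), map_sub, g.symm x (l x) (nabla g e l x (n x)), hlc]
    linarith
  set B := g.val x (nabla g e l x (α x)) (α x) with hB
  have hdiv : ∑ a, coordDiff e a x (nabla g e l x (coordVec e a x)) = 2 * B + c := by
    rw [htx.sum_coordDiff_nabla he hx.1, g.symm x (s x), g.symm x (α x), g.symm x (l x), hlc, hc,
      map_smul, htx.nl, heq, smul_eq_mul]
    ring
  have htrans : ∑ i, coordDiff e i x (l x) * pderiv e i φ x = φ x * (-B - c) := by
    rw [hφ, sum_coordDiff_mul_pderiv_coefficient hz ht hl.smooth hα hn hu he hx, hbn,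
      bracket_swap, map_neg, hbα]
  have hdivl : ∑ a, coordDiff e a x (nabla g e (fun y => φ y • l y) x (coordVec e a x)) =
      φ x * B := by
    have h1 : ∀ a, coordDiff e a x (nabla g e (fun y => φ y • l y) x (coordVec e a x)) =
        coordDiff e a x (l x) * pderiv e a φ x +
          φ x * coordDiff e a x (nabla g e l x (coordVec e a x)) := by
      intro a
      rw [nabla_fun_smul he hV hx hφs hl.smooth]
      simp [coordDiff_coordVec he hx.1]
      ring
    simp only [h1, Finset.sum_add_distrib, ← Finset.mul_sum, htrans, hdiv]
    ring
  have hcl := sum_val_mul_pderiv_wedge (g := g) he hV hx hφs hα hl.smooth (l x)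
  have hcα := sum_val_mul_pderiv_wedge (g := g) he hV hx hφs hα hl.smooth (α x)
  rw [htx.ll, htx.lα, hbl] at hcl
  rw [htx.αl, htx.αα, hbα, hdivl] at hcα
  have hF : ∀ i, comp e (nullField g z u α l) i k x = φ x *
      (g.val x (α x) (coordVec e i x) * g.val x (l x) (coordVec e k x) -
        g.val x (α x) (coordVec e k x) * g.val x (l x) (coordVec e i x)) := fun i => rfl
  set W : Fin 4 → ℝ := fun i => ∑ a, pderiv e a (fun y => volDensity g e y * f a i y) x with hW
  have hcl' : ∑ i, g.val x (l x) (coordVec e i x) * W i = 0 := hcl.trans (by ring)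
  have hcα' : ∑ i, g.val x (α x) (coordVec e i x) * W i = 0 := hcα.trans (by ring)
  have hterm : ∀ i, (∑ m, metricInv g e i m x * current g e (nullField g z u α l) m x) *
      comp e (nullField g z u α l) i k x =
      volDensity g e x * ((metricMatrix g e x)⁻¹).det * φ x * g.val x (l x) (coordVec e k x) *
          (g.val x (α x) (coordVec e i x) * W i) -
        volDensity g e x * ((metricMatrix g e x)⁻¹).det * φ x * g.val x (α x) (coordVec e k x) *
          (g.val x (l x) (coordVec e i x) * W i) := by
    intro i
    rw [hJ, hF]
    ring
  simp only [hterm, Finset.sum_sub_distrib, ← Finset.mul_sum, hcl', hcα']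
  ring

theorem isNullForceFree_nullField (hz : IsAdaptedChart (spanField l s) z)
    (hl : IsNullGeodesicOn g l z.source) (hα : SmoothOn α z.source) (hn : SmoothOn n z.source)
    (ht : ∀ y ∈ z.source, IsTetrad g y (s y) (l y) (α y) (n y))
    (heq : ∀ e ∈ charts M, ∀ x ∈ e.source ∩ z.source, Equipartition g e l x (s x) (α x))
    (hu : ContDiffOn ℝ ∞ u ((fun y : EuclideanSpace ℝ (Fin 4) => (y 2, y 3)) '' z.target)) :
    IsNullForceFree g (nullField g z u α l) z.source where
  alt x hx v := by
    rw [hz.nullField_apply hx (ht x hx)]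
    ring
  smooth := smoothBilinOn_nullField hz ht hu
  closed e he x hx i j k := extDeriv2_nullField hz ht hu he hx i j k
  forceFree e he x hx k := nullField_forceFree hz hl hα hn ht hu he hx (heq e he x hx) k
  null e he x hx := sum_nullField_mul_raise2 he hx.1 (ht x hx.2)

end Current

/-! ### Null field sheet foliations -/

section Foliation

variable {M : Type*} [TopologicalSpace M] [ChartedSpace (EuclideanSpace ℝ (Fin 4)) M]
  {g : LorentzMetric M} {x : M} {e : OpenPartialHomeomorph M (EuclideanSpace ℝ (Fin 4))}
  {s l α n : VectorField M} {Θ₀ : M → ℝ} {f : ℝ × ℝ × ℝ → ℝ} {r : ℝ}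

theorem contDiffOn_lastThree (hf : ContDiffOn ℝ ∞ f (Ioo (-r) r ×ˢ Ioo (-r) r ×ˢ Ioo (-r) r)) :
    ContDiffOn ℝ ∞ (fun y : EuclideanSpace ℝ (Fin 4) => f (y 1, y 2, y 3)) (cube 4 r) := by
  have h1 : ContDiff ℝ ∞ (fun y : EuclideanSpace ℝ (Fin 4) => (y 1, y 2, y 3)) := by fun_prop
  refine hf.comp h1.contDiffOn fun y hy => ?_
  exact ⟨abs_lt.1 (hy 1), abs_lt.1 (hy 2), abs_lt.1 (hy 3)⟩

theorem smoothFunOn_angle (he : e ∈ charts M) (hr : e.target = cube 4 r)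
    (hΘ₀ : SmoothFunOn Θ₀ e.source)
    (hf : ContDiffOn ℝ ∞ f (Ioo (-r) r ×ˢ Ioo (-r) r ×ˢ Ioo (-r) r)) :
    SmoothFunOn (angle e Θ₀ f) e.source :=
  ContMDiffOn.add hΘ₀ ((contDiffOn_lastThree hf).contMDiffOn.comp
    (contMDiffOn_of_mem_maximalAtlas he) fun _ hx => hr ▸ e.map_source hx)

/-- Adding a function of the last three coordinates does not change the derivative of the angle
along the first coordinate. -/
theorem pderiv_zero_angle (he : e ∈ charts M) (hr : e.target = cube 4 r)
    (hΘ₀ : SmoothFunOn Θ₀ e.source)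
    (hf : ContDiffOn ℝ ∞ f (Ioo (-r) r ×ˢ Ioo (-r) r ×ˢ Ioo (-r) r)) (hx : x ∈ e.source) :
    pderiv e 0 (angle e Θ₀ f) x = pderiv e 0 Θ₀ x := by
  have hfs : SmoothFunOn (fun x => f (e x 1, e x 2, e x 3)) e.source :=
    (contDiffOn_lastThree hf).contMDiffOn.comp
      (contMDiffOn_of_mem_maximalAtlas he) fun _ hx => hr ▸ e.map_source hx
  have h1 := pderiv_add he hx (hΘ₀.mdifferentiableAt e.open_source hx)
    (hfs.mdifferentiableAt e.open_source hx) 0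
  refine h1.trans ?_
  rw [add_eq_left]
  set F : EuclideanSpace ℝ (Fin 4) → ℝ := fun y => f (y 1, y 2, y 3) with hF
  have hcube : e x ∈ cube 4 r := hr ▸ e.map_source hx
  have h2 : (fun y => f (e (e.symm y) 1, e (e.symm y) 2, e (e.symm y) 3)) =ᶠ[𝓝 (e x)] F := by
    filter_upwards [e.open_target.mem_nhds (e.map_source hx)] with y hy
    rw [e.right_inv hy]
  have hd := (((contDiffOn_lastThree hf).contDiffAt
    ((isOpen_cube 4 r).mem_nhds hcube)).differentiableAt (by simp)).hasFDerivAt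
  have hline : HasDerivAt (fun t : ℝ => e x + t • EuclideanSpace.single 0 (1 : ℝ))
      (EuclideanSpace.single 0 1) 0 := by
    simpa using ((hasDerivAt_id (0 : ℝ)).smul_const (EuclideanSpace.single 0 (1 : ℝ))).const_add
      (e x)
  have hd' : HasFDerivAt F (fderiv ℝ F (e x))
      (e x + (0 : ℝ) • EuclideanSpace.single 0 (1 : ℝ)) := by simpa using hd
  have h3 := hd'.comp_hasDerivAt (0 : ℝ) hline
  have h4 : F ∘ (fun t : ℝ => e x + t • EuclideanSpace.single 0 (1 : ℝ)) = fun _ => F (e x) := by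
    funext t
    simp [hF]
  rw [h4] at h3
  rw [pderiv, h2.fderiv_eq]
  exact h3.unique (hasDerivAt_const (0 : ℝ) (F (e x)))

variable [IsManifold (𝓡 4) ∞ M]

/-- Every angle `Θ₀ + f(x², x³, x⁴)` generates a null field sheet foliation. -/
theorem isNullFieldSheetFoliation_angle (hl : IsNullGeodesicOn g l univ) (hsf : IsShearFree g l)
    (he : e ∈ charts M) (hr : e.target = cube 4 r) (hle : ∀ x ∈ e.source, l x = coordVec e 0 x)
    (hs : SmoothOn s e.source) (hα : SmoothOn α e.source) (hn : SmoothOn n e.source)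
    (ht : ∀ x ∈ e.source, IsTetrad g x (s x) (l x) (α x) (n x)) (hΘ₀ : SmoothFunOn Θ₀ e.source)
    (hobs : ∀ x ∈ e.source, pderiv e 0 Θ₀ x + g.val x (bracket e l s x) (α x) = 0)
    (hf : ContDiffOn ℝ ∞ f (Ioo (-r) r ×ˢ Ioo (-r) r ×ˢ Ioo (-r) r)) :
    IsNullFieldSheetFoliation g e.source (rotS (angle e Θ₀ f) s α) l (rotA (angle e Θ₀ f) s α)
      n := by
  have hU := e.open_source
  have hΘ := smoothFunOn_angle he hr hΘ₀ hf
  have ht' : ∀ x ∈ e.source, IsTetrad g x (rotS (angle e Θ₀ f) s α x) (l x)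
      (rotA (angle e Θ₀ f) s α x) (n x) := fun x hx => (ht x hx).rotate _
  have hlU : IsNullGeodesicOn g l e.source :=
    ⟨hl.smooth.mono (subset_univ _), fun x _ => hl.ne_zero x (mem_univ x),
      fun x _ => hl.null x (mem_univ x), fun e' he' x hx => hl.geodesic e' he' x ⟨hx.1, mem_univ x⟩⟩
  have hS := smoothOn_rotS hs hα hΘ
  refine ⟨?_, hlU, hS, smoothOn_rotA hs hα hΘ, hn, ht', fun e' he' x hx => ?_⟩
  · refine isFoliation_spanField he hr hle hS (fun x hx a h => ?_) fun x hx => ?_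
    · have h1 := (ht' x hx).ss
      rw [h] at h1
      simp only [map_smul, LinearMap.smul_apply, (ht' x hx).ll, smul_zero] at h1
      exact zero_ne_one h1
    · have hx' : x ∈ e.source ∩ e.source := ⟨hx, hx⟩
      rw [spanField, (ht' x hx).mem_span_iff]
      constructor
      · rw [g.symm]
        exact val_bracket_null he hU hx' hlU hS fun y hy => (ht' y hy).sl
      · have heq := (uniformEquipartition_iff_shear_eq_zero (ht x hx)).2
          (hsf e he x hx (s x) (α x) (n x) (ht x hx))
        rw [g.symm, val_bracket_rotS he hU hx' hs hα hΘ ht heq, ← hobs x hx,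
          ← pderiv_zero_angle he hr hΘ₀ hf hx, hle x hx]
        simp [coordDiff_coordVec he hx]
  · exact ((uniformEquipartition_iff_shear_eq_zero (ht' x hx.2)).2
      (hsf e' he' x hx.1 _ _ _ (ht' x hx.2))).1

end Foliation

end NullFFE

end

theorem theorem5 {M : Type*} [TopologicalSpace M] [ChartedSpace (EuclideanSpace ℝ (Fin 4)) M]
    [IsManifold (𝓡 4) ∞ M] (g : NullFFE.LorentzMetric M) (l : NullFFE.VectorField M)
    (hl : NullFFE.IsNullGeodesicOn g l Set.univ) :
    -- uniform equipartition is equivalent to vanishing shear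
    (∀ e ∈ NullFFE.charts M, ∀ x ∈ e.source, ∀ s α n : TangentSpace (𝓡 4) x,
      NullFFE.IsTetrad g x s (l x) α n →
        (NullFFE.UniformEquipartition g e l x s α ↔
          ∀ v w, NullFFE.shear g e l x s α v w = 0)) ∧
    -- foliations and force-free fields of a shear-free congruence
    (NullFFE.IsShearFree g l → ∀ p : M,
      ∃ e ∈ NullFFE.charts M, ∃ r : ℝ, 0 < r ∧ p ∈ e.source ∧
        e.target = {y | ∀ i, |y i| < r} ∧
        (∀ x ∈ e.source, l x = NullFFE.coordVec e 0 x) ∧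
        ∃ (s α n : NullFFE.VectorField M) (Θ₀ : M → ℝ),
          ContMDiffOn (𝓡 4) 𝓘(ℝ, ℝ) ∞ Θ₀ e.source ∧
          -- every function of three variables generates a null field sheet foliation
          (∀ f : ℝ × ℝ × ℝ → ℝ,
            ContDiffOn ℝ ∞ f (Set.Ioo (-r) r ×ˢ Set.Ioo (-r) r ×ˢ Set.Ioo (-r) r) →
            NullFFE.IsNullFieldSheetFoliation g e.source
              (NullFFE.rotS (NullFFE.angle e Θ₀ f) s α) l
              (NullFFE.rotA (NullFFE.angle e Θ₀ f) s α) n ∧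
            -- every function of two variables gives a null force-free field of that foliation
            (∀ z, NullFFE.IsAdaptedChart
                (NullFFE.spanField l (NullFFE.rotS (NullFFE.angle e Θ₀ f) s α)) z →
              z.source ⊆ e.source →
              (∀ x ∈ z.source,
                NullFFE.coeffDet g z (NullFFE.rotA (NullFFE.angle e Θ₀ f) s α) l x ≠ 0) ∧
              ∀ u : ℝ × ℝ → ℝ,
                ContDiffOn ℝ ∞ u ((fun y : EuclideanSpace ℝ (Fin 4) => (y 2, y 3)) '' z.target) →
                NullFFE.IsNullForceFree g
                  (NullFFE.nullField g z u (NullFFE.rotA (NullFFE.angle e Θ₀ f) s α) l)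
                  z.source ∧
                ∀ x ∈ z.source, u (z x 2, z x 3) ≠ 0 → ∀ v,
                  ((∀ w, NullFFE.nullField g z u
                      (NullFFE.rotA (NullFFE.angle e Θ₀ f) s α) l x v w = 0) ↔
                    v ∈ NullFFE.spanField l
                      (NullFFE.rotS (NullFFE.angle e Θ₀ f) s α) x))) ∧
          -- the tangent planes for two functions agree exactly where they differ by `k π`
          (∀ f₁ f₂ : ℝ × ℝ × ℝ → ℝ, ∀ x ∈ e.source,
            (NullFFE.spanField l (NullFFE.rotS (NullFFE.angle e Θ₀ f₁) s α) x =
              NullFFE.spanField l (NullFFE.rotS (NullFFE.angle e Θ₀ f₂) s α) x ↔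
            ∃ k : ℤ, f₁ (e x 1, e x 2, e x 3) - f₂ (e x 1, e x 2, e x 3) = k * Real.pi))) := by
  refine ⟨fun e he x hx s α n ht => NullFFE.uniformEquipartition_iff_shear_eq_zero ht,
    fun hsf p => ?_⟩
  obtain ⟨e, he, r, hr, hpe, hte, hle, s, α, n, Θ₀, hs, hα, hn, ht, hΘ₀, hobs⟩ :=
    NullFFE.exists_flowBox_tetrad_angle hl p
  refine ⟨e, he, r, hr, hpe, hte, hle, s, α, n, Θ₀, hΘ₀, fun f hf => ?_, fun f₁ f₂ x hx => ?_⟩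
  · have hfol := NullFFE.isNullFieldSheetFoliation_angle hl hsf he hte hle hs hα hn ht hΘ₀ hobs hf
    refine ⟨hfol, fun z hz hze => ?_⟩
    have hc := fun x hx => hz.coeffDet_ne_zero hx (hfol.tetrad x (hze hx))
    refine ⟨hc, fun u hu => ⟨?_, fun x hx hux v => ?_⟩⟩
    · refine NullFFE.isNullForceFree_nullField hz ?_ (hfol.smooth_α.mono hze)
        (hfol.smooth_n.mono hze) (fun y hy => hfol.tetrad y (hze hy))
        (fun e' he' x hx => hfol.equipartition e' he' x ⟨hx.1, hze hx.2⟩) hu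
      exact ⟨hfol.nullGeodesic.smooth.mono hze, fun x hx => hfol.nullGeodesic.ne_zero x (hze hx),
        fun x hx => hfol.nullGeodesic.null x (hze hx),
        fun e' he' x hx => hfol.nullGeodesic.geodesic e' he' x ⟨hx.1, hze hx.2⟩⟩
    · exact NullFFE.nullField_kernel_iff (hc x hx) hux (hfol.tetrad x (hze hx)) v
  · refine (NullFFE.span_rotate_eq_iff (ht x hx) _ _).trans (exists_congr fun k => ?_)
    simp only [NullFFE.angle, add_sub_add_left_eq_sub]
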